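/- **Setting.** Write $[n]=\{1,\dots,n\}$. Let $\alpha,\beta,\sigma>0$. The class $\mathcal{BL}(\alpha,\beta)$ consists of the matrices $F\in[0,1]^{n\times n}$ such that for all $i<j$: $\max_{k}|F_{ik}-F_{jk}|\le \beta|i-j|/n$; $F_{ik}-F_{jk}\ge\alpha|i-j|/n$ for all $k\le i$; and $F_{jk}-F_{ik}\ge\alpha|i-j|/n$ for all $k\ge j$. We observe $A=(F_{\pi_i\pi_j})_{i,j}+\sigma E$, where $F$ is an unknown Robinson matrix (symmetric, with $F_{jk}<F_{ik}$ for $k\le i<j$ and $F_{ik}<F_{jk}$ for $i<j\le k$), $\pi$ is an unknown permutation of $[n]$, and $E$ is a symmetric random matrix whose entries $(E_{ij})_{i\le j}$ are independent, centred, with $\mathbb E e^{tE_{ij}}\le e^{t^2/2}$ for all $t\in\mathbb R$. The loss is $$L_{\max}(\hat\pi,\pi)=\frac1n\Big(\max_i|\hat\pi_i-\pi_i|\ \wedge\ \max_i|\hat\pi_i-(n+1-\pi_i)|\Big).$$ **The estimator SABRE** $\hat\pi=\hat\pi(A,\sigma)$ uses $\delta_1=n^{3/4}\log n$, $\delta_{k+1}=\delta_k\log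 n$ ($k=1,2,3$). Ties in $\arg\min$, $\arg\max$ are broken by the smallest index. *Distance estimate on $S\subset[n]$.* Let $A^S$ be $A$ with the entries outside $S\times S$ set to $0$, and $A^S_i$ its rows. For $i\in S$ put $\hat m_i=\arg\min_{j\in S\setminus\{i\}}\max_{k\in S\setminus\{i,j\}}|\langle A^S_k,A^S_i-A^S_j\rangle|$. For distinct $i,j\in S$ put $\hat D_{ij}(S)=\sqrt{n\,(\langle A^S_i,A^S_{\hat m_i}\rangle+\langle A^S_j,A^S_{\hat m_j}\rangle-2\langle A^S_i,A^S_j\rangle)_+}$; all other $\hat D_{ij}(S)$ are $0$. Let $\hat D=\hat D([n])$. *First seriation.* For each $i$ let $\mathcal G_i$ be the graph on $[n]\setminus\{i\}$ that links $k\ne l$ when $\hat D_{kl}\le\delta_1$ and $\hat D_{ik}\vee\hat D_{il}\ge\delta_2$. Let $G_i,G'_i$ be the largest and second largest among the connected components of $\mathcal G_i$ that contain some $k$ with $\hat D_{ik}\ge\delta_3$ (empty if missing). Choose $c\in\arg\max_i|G_i|\wedge|G'_i|$ and set $(L_c,R_c)=(G_c,G'_c)$. For $i\ne c$ with $G_i'=\emptyset$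 set $(L_i,R_i)=(\emptyset,G_i)$ if $i\in L_c$ and $(G_i,\emptyset)$ otherwise. For $i\neq c$ with $G'_i\ne\emptyset$ set $(L_i,R_i)=(G'_i,G_i)$ if $G_i\cap L_c=\emptyset$ or $G_i'\cap R_c=\emptyset$, and $(G_i,G'_i)$ otherwise. For $i\ne j$ with $(L_i,R_i)\ne(\emptyset,\emptyset)$ put $H_{ij}=-1$ if $i\in L_j$ or $j\in R_i$; else $H_{ij}=1$ if $i\in R_j$ or $j\in L_i$. All other $H_{ij}$ are $0$. *Refined seriation.* Draw, independently of $E$, a uniformly random partition $[n]=S^1\cup S^2\cup S^3$ into labelled blocks with $\lfloor n/3\rfloor\le|S^t|\le\lceil n/3\rceil$. For $i<j$ with $H_{ij}=0$ let $t$ be the least label with $i,j\notin S^t$, let $p\in\arg\min_{p\in S^t}\hat D_{ip}$, and $$\tilde L=\{k\in S^t: H_{ik}=H_{jk}=1,\ \hat D_{pk}(S^t)\ge\delta_4\},\qquad \tilde R=\{k\in S^t: H_{ik}=H_{jk}=-1,\ \hat D_{pk}(S^t)\ge\delta_4\}.$$ With $l=\sum_{k\in\tilde L}(A_{ik}-A_{jk})$,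 $r=\sum_{k\in\tilde R}(A_{ik}-A_{jk})$, put $\tilde H_{ij}=-\mathrm{sign}(l)$ if $|l|\ge5\sigma\sqrt{n\log n}$; else $\tilde H_{ij}=\mathrm{sign}(r)$ if $|r|\ge 5\sigma\sqrt{n\log n}$; else $0$. Put $\tilde H_{ji}=-\tilde H_{ij}$ and all other $\tilde H_{ij}=0$. Finally $\hat\pi_i=\frac12\big(\sum_j(H+\tilde H)_{ij}+n+1\big)$. **Statement.** (1) SABRE is computable in polynomial time: given $A$, $\sigma$ and the partition, an explicit implementation computes $\hat\pi$ with at most $Kn^3$ elementary steps for every $n\ge1$, where $K$ is a universal constant. Elementary steps are real or integer arithmetic operations, comparisons, Boolean operations, array accesses, absolute values, roots, powers and logarithms. (2) For all $\alpha,\beta,\sigma>0$ there is a constant $C_{\alpha\beta\sigma}$, depending only on $(\alpha,\beta,\sigma)$, such that for all $n\ge C_{\alpha\beta\sigma}$, all Robinson $F\in\mathcal{BL}(\alpha,\beta)$, all permutations $\pi$ and all noise distributions as above, $$L_{\max}(\hat\pi,\pi)\ \le\ 160\,\frac{\sigma}{\alpha}\sqrt{\frac{\log n}{n}}\qquad\text{with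 probability at least } 1-\frac1{n^2}.$$ -/

import Mathlib

open MeasureTheory ProbabilityTheory
open scoped Matrix

namespace Seriation

variable {n : ℕ}

/-! ### The statistical model

Items and positions are indexed by `Fin n`; the element `k` of `Fin n` stands for the index `k + 1`
of `{1, …, n}`. -/

/-- Robinson matrices: symmetric, with entries that decrease when one moves away from the
diagonal. -/
structure IsRobinson (F : Matrix (Fin n) (Fin n) ℝ) : Prop where
  symm : F.IsSymm
  left : ∀ i j k : Fin n, k ≤ i → i < j → F j k < F i k
  right : ∀ i j k : Fin n, i < j → j ≤ k → F i k < F j k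

/-- The bi-Lipschitz class `BL(α, β)`. -/
structure IsBiLipschitz (α β : ℝ) (F : Matrix (Fin n) (Fin n) ℝ) : Prop where
  mem_Icc : ∀ i j : Fin n, F i j ∈ Set.Icc (0 : ℝ) 1
  upper : ∀ i j : Fin n, i < j → ∀ k : Fin n,
    |F i k - F j k| ≤ β * (|(i : ℝ) - (j : ℝ)| / n)
  lower_left : ∀ i j : Fin n, i < j → ∀ k : Fin n, k ≤ i →
    α * (|(i : ℝ) - (j : ℝ)| / n) ≤ F i k - F j k
  lower_right : ∀ i j : Fin n, i < j → ∀ k : Fin n, j ≤ k →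
    α * (|(i : ℝ) - (j : ℝ)| / n) ≤ F j k - F i k

/-- Symmetric noise whose entries on and above the diagonal are independent, centred and
sub-Gaussian with variance proxy at most one. -/
structure IsNoise {Ω : Type*} [MeasurableSpace Ω] (μ : Measure Ω)
    (E : Fin n → Fin n → Ω → ℝ) : Prop where
  measurable : ∀ i j, Measurable (E i j)
  symm : ∀ i j ω, E i j ω = E j i ω
  indep : iIndepFun (fun p : {p : Fin n × Fin n // p.1 ≤ p.2} => E p.1.1 p.1.2) μ
  centered : ∀ i j, i ≤ j → ∫ ω, E i j ω ∂μ = 0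
  subGaussian : ∀ i j, i ≤ j → HasSubgaussianMGF (E i j) 1 μ

/-- The observation `A = F_π + σ E`. -/
def observation {Ω : Type*} (F : Matrix (Fin n) (Fin n) ℝ) (π : Equiv.Perm (Fin n)) (σ : ℝ)
    (E : Fin n → Fin n → Ω → ℝ) (ω : Ω) (i j : Fin n) : ℝ :=
  F (π i) (π j) + σ * E i j ω

/-- The position `π_i`, as an element of `{1, …, n}`. -/
def position (π : Equiv.Perm (Fin n)) (i : Fin n) : ℝ := ((π i : ℕ) : ℝ) + 1

/-- The normalised maximum error `L_max`, up to reversal of the order. -/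
noncomputable def maxLoss (p : Fin n → ℝ) (π : Equiv.Perm (Fin n)) : ℝ :=
  (1 / (n : ℝ)) * min (⨆ i, |p i - position π i|) (⨆ i, |p i - (n + 1 - position π i)|)

/-- The partitions of the index set into three labelled blocks `{i | s i = t}`, each of which has
size between `⌊n/3⌋` and `⌈n/3⌉`. -/
def balancedPartitions (n : ℕ) : Finset (Fin n → Fin 3) :=
  Finset.univ.filter fun s => ∀ t : Fin 3,
    n / 3 ≤ (Finset.univ.filter fun i => s i = t).card ∧
      (Finset.univ.filter fun i => s i = t).card ≤ (n + 2) / 3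

/-! ### The estimator SABRE -/

open Classical in
/-- The set of the indices that satisfy `p`. -/
noncomputable def select (p : Fin n → Prop) : Finset (Fin n) := Finset.univ.filter p

theorem mem_select (p : Fin n → Prop) (k : Fin n) : k ∈ select p ↔ p k := by
  simp [select]

/-- The first minimiser of `f` on `s`, in the order of the indices (`none` if `s` is empty). -/
def argminOn {β : Type} [LinearOrder β] (s : Finset (Fin n)) (f : Fin n → β) : Option (Fin n) :=
  ((List.finRange n).filter (· ∈ s)).argmin f

/-- The first maximiser of `f` on `s`, in the order of the indices (`none` if `s` is empty). -/
def argmaxOn {β : Type} [LinearOrder β] (s : Finset (Fin n)) (f : Fin n → β) : Option (Fin n) :=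
  ((List.finRange n).filter (· ∈ s)).argmax f

/-- The maximum of a nonnegative `f` on `s` (zero if `s` is empty). -/
noncomputable def maxOn (s : Finset (Fin n)) (f : Fin n → ℝ) : ℝ := s.fold max 0 f

/-! #### Stage 1: distance estimation -/

/-- The matrix `A^S`: the entries outside `S × S` are set to zero. -/
def restrict (A : Fin n → Fin n → ℝ) (S : Finset (Fin n)) : Fin n → Fin n → ℝ :=
  fun i j => if i ∈ S ∧ j ∈ S then A i j else 0

/-- `max_{k ∈ S \ {i, j}} |⟨A^S_k, A^S_i - A^S_j⟩|`. -/
noncomputable def proxyScore (A : Fin n → Fin n → ℝ) (S : Finset (Fin n)) (i j : Fin n) :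
    ℝ :=
  maxOn ((S.erase i).erase j) fun k =>
    |restrict A S k ⬝ᵥ (restrict A S i - restrict A S j)|

/-- The nearest-neighbour proxy `m̂_i`. -/
noncomputable def proxy (A : Fin n → Fin n → ℝ) (S : Finset (Fin n)) (i : Fin n) : Fin n :=
  (argminOn (S.erase i) (proxyScore A S i)).getD i

/-- The routine *Estimate Distance*. The square root of a negative number is read as zero. -/
noncomputable def estimateDistance (A : Fin n → Fin n → ℝ) (S : Finset (Fin n)) :
    Fin n → Fin n → ℝ :=
  fun i j =>
    if i ∈ S ∧ j ∈ S ∧ i ≠ j then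
      √(n * (restrict A S i ⬝ᵥ restrict A S (proxy A S i)
        + restrict A S j ⬝ᵥ restrict A S (proxy A S j)
        - 2 * (restrict A S i ⬝ᵥ restrict A S j)))
    else 0

/-! #### Stage 2: first seriation -/

/-- The linking rule of the graph attached to `i`. -/
def Linked (D : Fin n → Fin n → ℝ) (δ₁ δ₂ : ℝ) (i k l : Fin n) : Prop :=
  k ≠ i ∧ l ≠ i ∧ D k l ≤ δ₁ ∧ δ₂ ≤ max (D i k) (D i l)

/-- The graph attached to `i`. Its vertex set is the set of all indices other than `i`; here `i`
is kept as an isolated vertex, which is discarded below. -/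
def bisectionGraph (D : Fin n → Fin n → ℝ) (δ₁ δ₂ : ℝ) (i : Fin n) :
    SimpleGraph (Fin n) :=
  SimpleGraph.fromRel (Linked D δ₁ δ₂ i)

/-- The vertex set of the connected component of `k` in the graph attached to `i`. -/
noncomputable def component (D : Fin n → Fin n → ℝ) (δ₁ δ₂ : ℝ) (i k : Fin n) :
    Finset (Fin n) :=
  select fun l => (bisectionGraph D δ₁ δ₂ i).Reachable k l

/-- The vertices whose component contains some `l` with `D i l ≥ δ₃`. -/
noncomputable def keptVertices (D : Fin n → Fin n → ℝ) (δ₁ δ₂ δ₃ : ℝ) (i : Fin n) :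
    Finset (Fin n) :=
  select fun k => k ≠ i ∧ ∃ l ∈ component D δ₁ δ₂ i k, δ₃ ≤ D i l

/-- The largest component among those of the vertices in `s` (empty if `s` is empty). -/
noncomputable def largestComponent (D : Fin n → Fin n → ℝ) (δ₁ δ₂ : ℝ) (i : Fin n)
    (s : Finset (Fin n)) : Finset (Fin n) :=
  match argmaxOn s fun k => (component D δ₁ δ₂ i k).card with
  | none => ∅
  | some k => component D δ₁ δ₂ i k

/-- The pair `(G_i, G'_i)` of the two largest kept components. -/
noncomputable def bisection (D : Fin n → Fin n → ℝ) (δ₁ δ₂ δ₃ : ℝ) (i : Fin n) :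
    Finset (Fin n) × Finset (Fin n) :=
  let K := keptVertices D δ₁ δ₂ δ₃ i
  let G := largestComponent D δ₁ δ₂ i K
  (G, largestComponent D δ₁ δ₂ i (K \ G))

/-- The subroutine *Orientation*: it turns the pairs `(G_i, G'_i)` into pairs `(L_i, R_i)`. -/
def orientation (G : Fin n → Finset (Fin n) × Finset (Fin n)) (i : Fin n) :
    Finset (Fin n) × Finset (Fin n) :=
  match argmaxOn Finset.univ fun i => min (G i).1.card (G i).2.card with
  | none => (∅, ∅)
  | some c =>
    if i = c then G c
    else if (G i).2 = ∅ then
      if i ∈ (G c).1 then (∅, (G i).1) else ((G i).1, ∅)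
    else if (G i).1 ∩ (G c).1 = ∅ ∨ (G i).2 ∩ (G c).2 = ∅ then ((G i).2, (G i).1)
    else G i

/-- The comparison matrix deduced from the pairs `(L_i, R_i)`. -/
def comparisons (LR : Fin n → Finset (Fin n) × Finset (Fin n)) : Fin n → Fin n → ℤ :=
  fun i j =>
    if i = j ∨ LR i = (∅, ∅) then 0
    else if i ∈ (LR j).1 ∨ j ∈ (LR i).2 then -1
    else if i ∈ (LR j).2 ∨ j ∈ (LR i).1 then 1
    else 0

/-- The routine *Aggregate Bisections*. -/
noncomputable def aggregateBisections (D : Fin n → Fin n → ℝ) (δ₁ δ₂ δ₃ : ℝ) :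
    Fin n → Fin n → ℤ :=
  comparisons (orientation (bisection D δ₁ δ₂ δ₃))

/-! #### Stage 3: refined seriation -/

/-- The threshold `5 σ √(n log n)`. -/
noncomputable def noiseThreshold (n : ℕ) (σ : ℝ) : ℝ := 5 * σ * √(n * Real.log n)

/-- The decision rule of *Evaluate Comparison*, from the two statistics `l` and `r`. -/
noncomputable def decisionRule (τ l r : ℝ) : ℤ :=
  if τ ≤ |l| then -(SignType.sign l : ℤ) else if τ ≤ |r| then (SignType.sign r : ℤ) else 0

/-- The subroutine *Evaluate Comparison*. -/
noncomputable def evaluateComparison (A : Fin n → Fin n → ℝ) (σ : ℝ) (i j : Fin n)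
    (L R : Finset (Fin n)) : ℤ :=
  decisionRule (noiseThreshold n σ) (∑ k ∈ L, (A i k - A j k)) (∑ k ∈ R, (A i k - A j k))

/-- A block of the partition that contains neither `i` nor `j`. -/
def freeBlock (s : Fin n → Fin 3) (i j : Fin n) : Fin 3 :=
  if s i ≠ 0 ∧ s j ≠ 0 then 0 else if s i ≠ 1 ∧ s j ≠ 1 then 1 else 2

/-- The block of the partition with label `t`. -/
noncomputable def block (s : Fin n → Fin 3) (t : Fin 3) : Finset (Fin n) :=
  select fun i => s i = t

/-- The index `p_ij`, a minimiser of `D i p` over the block that is free of `i` and `j`. -/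
noncomputable def anchor (D : Fin n → Fin n → ℝ) (s : Fin n → Fin 3) (i j : Fin n) :
    Fin n :=
  (argminOn (block s (freeBlock s i j)) (D i)).getD i

/-- The modified comparison sets: for `h = 1` the left set, for `h = -1` the right set. -/
noncomputable def comparisonSet (H : Fin n → Fin n → ℤ) (D A : Fin n → Fin n → ℝ)
    (δ₄ : ℝ) (s : Fin n → Fin 3) (h : ℤ) (i j : Fin n) : Finset (Fin n) :=
  select fun k => k ∈ block s (freeBlock s i j) ∧ H i k = h ∧ H j k = h ∧
    δ₄ ≤ estimateDistance A (block s (freeBlock s i j)) (anchor D s i j) k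

/-- The new value attached to an undecided pair `i < j`. -/
noncomputable def reevaluate (H : Fin n → Fin n → ℤ) (D A : Fin n → Fin n → ℝ)
    (σ δ₄ : ℝ) (s : Fin n → Fin 3) (i j : Fin n) : ℤ :=
  evaluateComparison A σ i j (comparisonSet H D A δ₄ s 1 i j) (comparisonSet H D A δ₄ s (-1) i j)

/-- The routine *Re-evaluate Comparisons*, for a given partition into three blocks. -/
noncomputable def reevaluateComparisons (H : Fin n → Fin n → ℤ)
    (D A : Fin n → Fin n → ℝ) (σ δ₄ : ℝ) (s : Fin n → Fin 3) :
    Fin n → Fin n → ℤ :=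
  fun i j => H i j +
    if i < j ∧ H i j = 0 then reevaluate H D A σ δ₄ s i j
    else if j < i ∧ H j i = 0 then -reevaluate H D A σ δ₄ s j i
    else 0

/-- The estimator SABRE with general tuning parameters. The random partition drawn by the
algorithm is passed as the argument `s`. -/
noncomputable def sabreWith (δ₁ δ₂ δ₃ δ₄ σ : ℝ) (A : Fin n → Fin n → ℝ)
    (s : Fin n → Fin 3) (i : Fin n) : ℝ :=
  let D := estimateDistance A Finset.univ
  let H := aggregateBisections D δ₁ δ₂ δ₃
  let H' := reevaluateComparisons H D A σ δ₄ s
  (((∑ j, H' i j : ℤ) : ℝ) + n + 1) / 2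

/-- The tuning parameters: `δ₁ = n^(3/4) log n` and `δ_(k+1) = δ_k log n`. -/
noncomputable def tuning (n k : ℕ) : ℝ := (n : ℝ) ^ (3 / 4 : ℝ) * Real.log n ^ k

/-- The estimator SABRE with the tuning parameters above. -/
noncomputable def sabre (σ : ℝ) (A : Fin n → Fin n → ℝ) (s : Fin n → Fin 3) :
    Fin n → ℝ :=
  sabreWith (tuning n 1) (tuning n 2) (tuning n 3) (tuning n 4) σ A s

/-! ### A step-counting implementation of SABRE

A computation carries its result and the number of elementary steps it takes. The elementary steps
are those of a random-access machine with real registers: reading or writing a memory cell, an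
arithmetic operation, an absolute value, a root, a logarithm or a power, a comparison, and a
Boolean operation. Arrays are stored: an array is produced only by a loop that writes each of its
cells, and it is read one cell per step. -/

/-- A result together with the number of elementary steps spent on it. -/
structure Timed (α : Type) where
  val : α
  time : ℕ

instance : Monad Timed where
  pure a := ⟨a, 0⟩
  bind x f := ⟨(f x.val).val, x.time + (f x.val).time⟩

/-- The evaluation of one expression of constant size, with `c` elementary steps. -/
def steps {α : Type} (c : ℕ) (a : α) : Timed α := ⟨a, c⟩

open Classical in
/-- A conditional jump: one step and the branch that is taken. -/
noncomputable def branch {α : Type} (p : Prop) (x y : Timed α) : Timed α :=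
  ⟨if p then x.val else y.val, (if p then x.time else y.time) + 1⟩

/-- Filling an array: each cell is computed and written, plus one step to advance the loop. -/
def fill {α : Type} (f : Fin n → Timed α) : Timed (Fin n → α) :=
  ⟨fun k => (f k).val, 1 + ∑ k, ((f k).time + 2)⟩

/-- A loop over all indices that updates a state. -/
def iterate {α : Type} (a : α) (f : Fin n → α → Timed α) : Timed α :=
  (List.finRange n).foldl (fun x k => ⟨(f k x.val).val, x.time + (f k x.val).time + 2⟩) ⟨a, 1⟩

/-- Accumulating a sum in one pass over all indices. -/
def sumLoop {α : Type} [AddCommMonoid α] (f : Fin n → Timed α) : Timed α :=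
  ⟨∑ k, (f k).val, 1 + ∑ k, ((f k).time + 2)⟩

/-- Accumulating the maximum of nonnegative numbers in one pass, over the indices that pass the
test `p`. -/
noncomputable def maxLoop (p : Fin n → Timed Prop) (f : Fin n → Timed ℝ) : Timed ℝ :=
  ⟨maxOn (select fun k => (p k).val) fun k => (f k).val,
    1 + ∑ k, ((p k).time + (f k).time + 4)⟩

/-- The first minimiser among the indices that pass the test `p`, found in one pass. -/
noncomputable def argminLoop (p : Fin n → Timed Prop) (f : Fin n → Timed ℝ) :
    Timed (Option (Fin n)) :=
  ⟨argminOn (select fun k => (p k).val) fun k => (f k).val,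
    1 + ∑ k, ((p k).time + (f k).time + 5)⟩

/-- The first maximiser among the indices that pass the test `p`, found in one pass. -/
noncomputable def argmaxLoop (p : Fin n → Timed Prop) (f : Fin n → Timed ℕ) :
    Timed (Option (Fin n)) :=
  ⟨argmaxOn (select fun k => (p k).val) fun k => (f k).val,
    1 + ∑ k, ((p k).time + (f k).time + 5)⟩

/-- Testing in one pass whether some index passes the test `p`. -/
def anyLoop (p : Fin n → Timed Prop) : Timed Prop :=
  ⟨∃ k, (p k).val, 1 + ∑ k, ((p k).time + 2)⟩

/-- Counting in one pass the indices that pass the test `p`. -/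
noncomputable def countLoop (p : Fin n → Timed Prop) : Timed ℕ :=
  ⟨(select fun k => (p k).val).card, 1 + ∑ k, ((p k).time + 2)⟩

/-- Clearing a Boolean array of length `n` and then marking, in one pass, the cells `g k` for the
indices `k` that pass the test `p`. -/
def markLoop (p : Fin n → Timed Prop) (g : Fin n → Fin n) : Timed (Fin n → Prop) :=
  ⟨fun l => ∃ k, (p k).val ∧ g k = l, 1 + ∑ k : Fin n, ((p k).time + 5)⟩

/-- The Gram matrix of the rows of a matrix. -/
def gramTimed (B : Fin n → Fin n → ℝ) : Timed (Fin n → Fin n → ℝ) :=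
  fill fun i => fill fun j => sumLoop fun k => steps 3 (B i k * B j k)

/-- *Estimate Distance*, for the set of indices with membership array `S`. -/
noncomputable def estimateDistanceTimed (A : Fin n → Fin n → ℝ) (S : Fin n → Prop) :
    Timed (Fin n → Fin n → ℝ) := do
  let B ← fill fun i => fill fun j => branch (S i ∧ S j) (steps 4 (A i j)) (steps 4 0)
  let P ← gramTimed B
  let m ← fill fun i => do
    let o ← argminLoop (fun j => steps 3 (S j ∧ j ≠ i)) fun j =>
      maxLoop (fun k => steps 5 (S k ∧ k ≠ i ∧ k ≠ j)) fun k => steps 4 |P k i - P k j|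
    steps 2 (o.getD i)
  fill fun i => fill fun j => branch (S i ∧ S j ∧ i ≠ j)
    (steps 16 √(n * (P i (m i) + P j (m j) - 2 * P i j))) (steps 6 0)

/-- Labels of the connected components of a graph given by its adjacency test, which takes `c`
steps. Initially each vertex is its own label. The vertices `v` are processed one after the other:
all vertices whose label is carried by `v` or by a neighbour of `v` receive the label of `v`. -/
noncomputable def labelsTimed (c : ℕ) (adj : Fin n → Fin n → Prop) : Timed (Fin n → Fin n) := do
  let start ← fill fun k : Fin n => steps 1 k
  iterate start fun v lab => do
    let hit ← markLoop (fun w => steps (c + 2) (w = v ∨ adj v w)) lab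
    fill fun u => branch (hit (lab u)) (steps 3 (lab v)) (steps 3 (lab u))

/-- The two largest kept components of the graph attached to `i`, as membership arrays. -/
noncomputable def bisectionTimed (D : Fin n → Fin n → ℝ) (δ₁ δ₂ δ₃ : ℝ) (i : Fin n) :
    Timed ((Fin n → Prop) × (Fin n → Prop)) := do
  let lab ← labelsTimed 30 fun k l =>
    k ≠ l ∧ (Linked D δ₁ δ₂ i k l ∨ Linked D δ₁ δ₂ i l k)
  let far ← markLoop (fun k => steps 4 (k ≠ i ∧ δ₃ ≤ D i k)) lab
  let size ← fill fun k => countLoop fun l => steps 3 (lab k = lab l)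
  let g ← argmaxLoop (fun k => steps 4 (k ≠ i ∧ far (lab k))) fun k => steps 1 (size k)
  let G ← fill fun k => steps 4 (∃ m ∈ g, lab m = lab k)
  let g' ← argmaxLoop (fun k => steps 7 ((k ≠ i ∧ far (lab k)) ∧ ¬ G k)) fun k => steps 1 (size k)
  let G' ← fill fun k => steps 4 (∃ m ∈ g', lab m = lab k)
  pure (G, G')

/-- *Orientation*, on membership arrays. -/
noncomputable def orientationTimed (G : Fin n → (Fin n → Prop) × (Fin n → Prop)) :
    Timed (Fin n → (Fin n → Prop) × (Fin n → Prop)) := do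
  let size ← fill fun i => do
    let a ← countLoop fun k => steps 1 ((G i).1 k)
    let b ← countLoop fun k => steps 1 ((G i).2 k)
    steps 1 (min a b)
  let o ← argmaxLoop (fun _ => steps 1 True) fun i => steps 1 (size i)
  let o ← steps 1 o
  match o with
  | none => fill fun _ => steps 1 (fun _ => False, fun _ => False)
  | some c => fill fun i => do
    let full ← anyLoop fun k => steps 1 ((G i).2 k)
    let a ← anyLoop fun k => steps 3 ((G i).1 k ∧ (G c).1 k)
    let b ← anyLoop fun k => steps 3 ((G i).2 k ∧ (G c).2 k)
    let L ← fill fun k =>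
      branch (i = c) (steps 4 ((G c).1 k)) <|
        branch full
          (branch (a ∧ b) (steps 4 ((G i).1 k)) (steps 4 ((G i).2 k)))
          (branch ((G c).1 i) (steps 4 False) (steps 4 ((G i).1 k)))
    let R ← fill fun k =>
      branch (i = c) (steps 4 ((G c).2 k)) <|
        branch full
          (branch (a ∧ b) (steps 4 ((G i).2 k)) (steps 4 ((G i).1 k)))
          (branch ((G c).1 i) (steps 4 ((G i).1 k)) (steps 4 False))
    pure (L, R)

/-- *Aggregate Bisections*. -/
noncomputable def aggregateBisectionsTimed (D : Fin n → Fin n → ℝ) (δ₁ δ₂ δ₃ : ℝ) :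
    Timed (Fin n → Fin n → ℤ) := do
  let G ← fill fun i => bisectionTimed D δ₁ δ₂ δ₃ i
  let LR ← orientationTimed G
  let nonempty ← fill fun i => anyLoop fun k => steps 3 ((LR i).1 k ∨ (LR i).2 k)
  fill fun i => fill fun j =>
    branch (i = j ∨ ¬ nonempty i) (steps 4 0) <|
      branch ((LR j).1 i ∨ (LR i).2 j) (steps 7 (-1)) <|
        branch ((LR j).2 i ∨ (LR i).1 j) (steps 10 1) (steps 10 0)

/-- The new value attached to an undecided pair, given the distance estimates `Dt` of the three
blocks and the threshold `τ`. -/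
noncomputable def reevaluateTimed (H : Fin n → Fin n → ℤ) (D A : Fin n → Fin n → ℝ)
    (Dt : Fin 3 → Fin n → Fin n → ℝ) (τ δ₄ : ℝ) (s : Fin n → Fin 3) (i j : Fin n) :
    Timed ℤ := do
  let t ← steps 10 (freeBlock s i j)
  let o ← argminLoop (fun p => steps 2 (s p = t)) fun p => steps 1 (D i p)
  let p ← steps 2 (o.getD i)
  let l ← sumLoop fun k =>
    branch (s k = t ∧ H i k = 1 ∧ H j k = 1 ∧ δ₄ ≤ Dt t p k)
      (steps 14 (A i k - A j k)) (steps 14 0)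
  let r ← sumLoop fun k =>
    branch (s k = t ∧ H i k = -1 ∧ H j k = -1 ∧ δ₄ ≤ Dt t p k)
      (steps 14 (A i k - A j k)) (steps 14 0)
  steps 8 (decisionRule τ l r)

/-- *Re-evaluate Comparisons*. -/
noncomputable def reevaluateComparisonsTimed (H : Fin n → Fin n → ℤ) (D A : Fin n → Fin n → ℝ)
    (τ δ₄ : ℝ) (s : Fin n → Fin 3) : Timed (Fin n → Fin n → ℤ) := do
  let Dt ← fill fun t : Fin 3 => do
    let S ← fill fun k => steps 2 (s k = t)
    estimateDistanceTimed A S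
  fill fun i => fill fun j => do
    let x ← branch (i < j ∧ H i j = 0)
      (reevaluateTimed H D A Dt τ δ₄ s i j)
      (branch (j < i ∧ H j i = 0)
        (do
          let y ← reevaluateTimed H D A Dt τ δ₄ s j i
          steps 1 (-y))
        (steps 1 0))
    steps 10 (H i j + x)

/-- SABRE, with a count of its elementary steps. -/
noncomputable def sabreTimed (σ : ℝ) (A : Fin n → Fin n → ℝ) (s : Fin n → Fin 3) :
    Timed (Fin n → ℝ) := do
  let ℓ ← steps 1 (Real.log n)
  let q ← steps 2 ((n : ℝ) ^ (3 / 4 : ℝ))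
  let δ₁ ← steps 1 (q * ℓ)
  let δ₂ ← steps 1 (δ₁ * ℓ)
  let δ₃ ← steps 1 (δ₂ * ℓ)
  let δ₄ ← steps 1 (δ₃ * ℓ)
  let τ ← steps 4 (5 * σ * √(n * ℓ))
  let S ← fill fun _ : Fin n => steps 1 True
  let D ← estimateDistanceTimed A S
  let H ← aggregateBisectionsTimed D δ₁ δ₂ δ₃
  let H' ← reevaluateComparisonsTimed H D A τ δ₄ s
  fill fun i => do
    let z ← sumLoop fun j => steps 1 (H' i j)
    steps 4 (((z : ℝ) + n + 1) / 2)

end Seriation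

/-!
The claim on the running time holds because every loop of the implementation runs over the `n`
indices, so that nesting adds up to three loops (`sabreTimed_val`, `sabreTimed_time_le`). The
connected components are found by relabelling, in quadratic time for each of the `n` graphs.

The error bound is proved by a deterministic analysis for a good noise matrix and a good partition,
together with a bound on the probability that one of them is not good.

*Distances.* If the off-diagonal inner products of the rows of the data are within
`η ≍ √n log n` of those of the signal, then `n` times the squared distance of two signal rows is
estimated with an error of order `n η`. The noise ruins only the squared norms; each of these is
replaced by the inner product with the proxy, which has nearly the same inner products with all
other rows, in particular with a neighbour of the item (`proxy_accuracy`). By the bi-Lipschitz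
condition the row distances are of the order of the gaps between positions, so all estimates are
comparable to the gaps up to `n ^ (3 / 4) √(log n)`, of lower order than the first threshold
(`estimateDistance_bounds`). The same works on the columns of one block of the partition as long as
the block meets all windows of length `w`, with a loss of `√w` in the lower bound.

*First seriation.* The thresholds are so far apart that a link in the graph of `i` never jumps over
`i`, while all items far from `i` on the same side are connected. So the two components are a left
part and a right part of `i`. The centre `c` is far from both ends, and its parts orient all others
consistently. Hence the comparisons are correct, up to one global reversal, for all pairs at
distance at least `ρ₃` and undecided or correct for the others (`Resolves.isSound`). Reversing both
the order and the signal leaves the data unchanged, which reduces everything that follows to one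
orientation.

*Refined seriation.* For an undecided pair `i`, `j` the comparison sets are the parts left and right
of `i` (equivalently of `j`) of the elements of a free block that are far from an anchor
(`RefinedSetting.comparisonSet_eq`). Given the anchor, these sets depend on the noise only through
the block, so they are independent of the rows of `i` and `j` in the columns of the block, and the
noise sums over them are below the threshold. They contain at least `n / 4` elements, so the signal
is at least `α |y i - y j| / 4` in total; a decision is never wrong, and a pair stays undecided only
if its gap is at most `80 (σ / α) √(n log n)` (`RefinedSetting.reevaluate_correct`). Summing the
comparisons gives the positions up to the same error.

*Probability.* All noise sums are weighted sums of entries of one row whose weights are functions of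
the remaining entries; conditioning on the latter leaves a sub-Gaussian variable
(`IsNoise.weighted_row_sum_tail`), and a union bound gives `IsNoise.measure_not_goodNoise_le`. For
products of two noise rows the weights are truncated entries of the other row. Exchangeability shows
that a block avoids a given window of length `w` with probability at most `(3 / 4) ^ w`
(`card_avoidingPartitions_le`), so that `w ≍ n ^ (1 / 4)` makes all blocks meet all windows. Since
the partition is independent of the noise, it can be fixed first (`measure_not_good_le`).
-/

namespace Seriation

variable {n : ℕ}

/-! ### Correctness and cost of the step-counting implementation -/

section Combinators

variable {α γ : Type}

@[simp] lemma bind_val (x : Timed α) (f : α → Timed γ) : (x >>= f).val = (f x.val).val := rfl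

@[simp] lemma bind_time (x : Timed α) (f : α → Timed γ) :
    (x >>= f).time = x.time + (f x.val).time := rfl

@[simp] lemma pure_val (a : α) : (pure a : Timed α).val = a := rfl

@[simp] lemma pure_time (a : α) : (pure a : Timed α).time = 0 := rfl

@[simp] lemma steps_val (c : ℕ) (a : α) : (steps c a).val = a := rfl

@[simp] lemma steps_time (c : ℕ) (a : α) : (steps c a).time = c := rfl

open Classical in
@[simp] lemma branch_val (p : Prop) (x y : Timed α) :
    (branch p x y).val = if p then x.val else y.val := by
  unfold branch; congr

lemma branch_time_le {p : Prop} {x y : Timed α} {T : ℕ} (hx : x.time ≤ T) (hy : y.time ≤ T) :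
    (branch p x y).time ≤ T + 1 := by
  unfold branch; dsimp only; split_ifs <;> omega

@[simp] lemma fill_val (f : Fin n → Timed α) : (fill f).val = fun k => (f k).val := rfl

@[simp] lemma maxLoop_val (p : Fin n → Timed Prop) (f : Fin n → Timed ℝ) :
    (maxLoop p f).val = maxOn (select fun k => (p k).val) fun k => (f k).val := rfl

@[simp] lemma argminLoop_val (p : Fin n → Timed Prop) (f : Fin n → Timed ℝ) :
    (argminLoop p f).val = argminOn (select fun k => (p k).val) fun k => (f k).val := rfl

@[simp] lemma argmaxLoop_val (p : Fin n → Timed Prop) (f : Fin n → Timed ℕ) :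
    (argmaxLoop p f).val = argmaxOn (select fun k => (p k).val) fun k => (f k).val := rfl

@[simp] lemma anyLoop_val (p : Fin n → Timed Prop) : (anyLoop p).val = ∃ k, (p k).val := rfl

@[simp] lemma countLoop_val (p : Fin n → Timed Prop) :
    (countLoop p).val = (select fun k => (p k).val).card := rfl

@[simp] lemma markLoop_val (p : Fin n → Timed Prop) (g : Fin n → Fin n) :
    (markLoop p g).val = fun l => ∃ k, (p k).val ∧ g k = l := rfl

/-- A loop over `n` indices raises the degree of a polynomial cost bound by one. -/
lemma loop_time_le (hn : 1 ≤ n) {c d k : ℕ} {f : Fin n → ℕ} (h : ∀ i, f i ≤ c * n ^ k) :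
    1 + ∑ i, (f i + d) ≤ (c + d + 1) * n ^ (k + 1) := by
  have h1 : ∑ i, (f i + d) ≤ ∑ _i : Fin n, (c * n ^ k + d) :=
    Finset.sum_le_sum fun i _ => Nat.add_le_add_right (h i) d
  rw [Finset.sum_const, Finset.card_univ, Fintype.card_fin, smul_eq_mul] at h1
  have h2 : 1 ≤ n ^ k := Nat.one_le_pow _ _ hn
  have h3 : 1 ≤ n ^ (k + 1) := Nat.one_le_pow _ _ hn
  have h4 : n * d ≤ d * n ^ (k + 1) := by
    rw [pow_succ]; nlinarith [Nat.mul_le_mul_left (d * n) h2]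
  have h5 : n * (c * n ^ k + d) = c * n ^ (k + 1) + n * d := by ring
  nlinarith

lemma fill_time_le (hn : 1 ≤ n) {c k : ℕ} {f : Fin n → Timed α}
    (h : ∀ i, (f i).time ≤ c * n ^ k) : (fill f).time ≤ (c + 3) * n ^ (k + 1) :=
  loop_time_le hn h

lemma sumLoop_time_le [AddCommMonoid α] (hn : 1 ≤ n) {c k : ℕ} {f : Fin n → Timed α}
    (h : ∀ i, (f i).time ≤ c * n ^ k) : (sumLoop f).time ≤ (c + 3) * n ^ (k + 1) :=
  loop_time_le hn h

lemma anyLoop_time_le (hn : 1 ≤ n) {c k : ℕ} {p : Fin n → Timed Prop}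
    (h : ∀ i, (p i).time ≤ c * n ^ k) : (anyLoop p).time ≤ (c + 3) * n ^ (k + 1) :=
  loop_time_le hn h

lemma countLoop_time_le (hn : 1 ≤ n) {c k : ℕ} {p : Fin n → Timed Prop}
    (h : ∀ i, (p i).time ≤ c * n ^ k) : (countLoop p).time ≤ (c + 3) * n ^ (k + 1) :=
  loop_time_le hn h

lemma markLoop_time_le (hn : 1 ≤ n) {c k : ℕ} {p : Fin n → Timed Prop} {g : Fin n → Fin n}
    (h : ∀ i, (p i).time ≤ c * n ^ k) : (markLoop p g).time ≤ (c + 6) * n ^ (k + 1) :=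
  loop_time_le hn h

lemma maxLoop_time_le (hn : 1 ≤ n) {c k : ℕ} {p : Fin n → Timed Prop} {f : Fin n → Timed ℝ}
    (h : ∀ i, (p i).time + (f i).time ≤ c * n ^ k) :
    (maxLoop p f).time ≤ (c + 5) * n ^ (k + 1) :=
  loop_time_le hn h

lemma argminLoop_time_le (hn : 1 ≤ n) {c k : ℕ} {p : Fin n → Timed Prop} {f : Fin n → Timed ℝ}
    (h : ∀ i, (p i).time + (f i).time ≤ c * n ^ k) :
    (argminLoop p f).time ≤ (c + 6) * n ^ (k + 1) :=
  loop_time_le hn h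

lemma argmaxLoop_time_le (hn : 1 ≤ n) {c k : ℕ} {p : Fin n → Timed Prop} {f : Fin n → Timed ℕ}
    (h : ∀ i, (p i).time + (f i).time ≤ c * n ^ k) :
    (argmaxLoop p f).time ≤ (c + 6) * n ^ (k + 1) :=
  loop_time_le hn h

lemma iterate_time_le (hn : 1 ≤ n) {c k : ℕ} {a : α} {f : Fin n → α → Timed α}
    (h : ∀ i b, (f i b).time ≤ c * n ^ k) : (iterate a f).time ≤ (c + 3) * n ^ (k + 1) := by
  have key : ∀ (l : List (Fin n)) (x : Timed α),
      (l.foldl (fun x k => (⟨(f k x.val).val, x.time + (f k x.val).time + 2⟩ : Timed α)) x).time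
        ≤ x.time + l.length * (c * n ^ k + 2) := by
    intro l
    induction l with
    | nil => intro x; simp
    | cons v l ih =>
      intro x
      refine (ih _).trans ?_
      have := h v x.val
      simp only [List.length_cons]
      nlinarith
  refine (key _ _).trans ?_
  simp only [List.length_finRange]
  have h2 : 1 ≤ n ^ k := Nat.one_le_pow _ _ hn
  have h3 : 1 ≤ n ^ (k + 1) := Nat.one_le_pow _ _ hn
  have h4 : n ≤ n ^ (k + 1) := by rw [pow_succ]; nlinarith
  have h5 : n * (c * n ^ k + 2) = c * n ^ (k + 1) + 2 * n := by ring
  nlinarith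

/-- An invariant of a loop over all indices, with the list of the indices already processed. -/
lemma iterate_invariant (P : List (Fin n) → α → Prop) {a : α} {f : Fin n → α → Timed α}
    (h0 : P [] a) (hs : ∀ l v b, P l b → P (l ++ [v]) (f v b).val) :
    P (List.finRange n) (iterate a f).val := by
  have key : ∀ (l l' : List (Fin n)) (x : Timed α), P l' x.val →
      P (l' ++ l)
        (l.foldl (fun x k =>
          (⟨(f k x.val).val, x.time + (f k x.val).time + 2⟩ : Timed α)) x).val := by
    intro l
    induction l with
    | nil => intro l' x hx; simpa using hx
    | cons v l ih =>
      intro l' x hx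
      simpa using ih (l' ++ [v]) ⟨(f v x.val).val, x.time + (f v x.val).time + 2⟩ (hs l' v _ hx)
  exact key (List.finRange n) [] ⟨a, 1⟩ h0

end Combinators

/-! ### Distance estimation, implemented -/

/-- The implementation reads the proxy scores off the Gram matrix by this identity. -/
lemma restrict_dotProduct_sub (A : Fin n → Fin n → ℝ) (S : Finset (Fin n)) (k i j : Fin n) :
    restrict A S k ⬝ᵥ (restrict A S i - restrict A S j) =
      restrict A S k ⬝ᵥ restrict A S i - restrict A S k ⬝ᵥ restrict A S j :=
  dotProduct_sub _ _ _

lemma estimateDistanceTimed_val (A : Fin n → Fin n → ℝ) (S : Finset (Fin n)) (T : Fin n → Prop)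
    (hT : ∀ k, T k ↔ k ∈ S) : (estimateDistanceTimed A T).val = estimateDistance A S := by
  classical
  have hT' : T = fun k => k ∈ S := funext fun k => propext (hT k)
  subst hT'
  have hB : (fill fun i => fill fun j =>
      branch (i ∈ S ∧ j ∈ S) (steps 4 (A i j)) (steps 4 0)).val = restrict A S := by
    funext i j
    change (branch (i ∈ S ∧ j ∈ S) (steps 4 (A i j)) (steps 4 0)).val = _
    rw [branch_val, restrict]
    congr
  have hP : (gramTimed (restrict A S)).val = fun i j => restrict A S i ⬝ᵥ restrict A S j := rfl
  have hm : (fill fun i => do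
      let o ← argminLoop (fun j => steps 3 (j ∈ S ∧ j ≠ i)) fun j =>
        maxLoop (fun k => steps 5 (k ∈ S ∧ k ≠ i ∧ k ≠ j)) fun k =>
          steps 4 |restrict A S k ⬝ᵥ restrict A S i - restrict A S k ⬝ᵥ restrict A S j|
      steps 2 (o.getD i)).val = proxy A S := by
    funext i
    have h1 : (select fun j => j ∈ S ∧ j ≠ i) = S.erase i := by
      ext j; simp [mem_select, and_comm]
    have h2 : ∀ j, (select fun k => k ∈ S ∧ k ≠ i ∧ k ≠ j) = (S.erase i).erase j := by
      intro j; ext k; simp only [mem_select, Finset.mem_erase]; tauto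
    simp only [fill_val, bind_val, argminLoop_val, maxLoop_val, steps_val, proxy, h1]
    congr 2
    funext j
    rw [h2]
    simp only [proxyScore, restrict_dotProduct_sub]
  simp only [estimateDistanceTimed, bind_val]
  rw [hB, hP, hm]
  funext i j
  change (branch (i ∈ S ∧ j ∈ S ∧ i ≠ j) (steps 16 _) (steps 6 0)).val = _
  rw [branch_val, estimateDistance]
  congr

lemma estimateDistanceTimed_time_le (hn : 1 ≤ n) (A : Fin n → Fin n → ℝ) (T : Fin n → Prop) :
    (estimateDistanceTimed A T).time ≤ 100 * n ^ 3 := by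
  have hB : (fill fun i => fill fun j => branch (T i ∧ T j) (steps 4 (A i j)) (steps 4 0)).time
      ≤ 11 * n ^ 2 := by
    refine fill_time_le (c := 8) hn fun i => fill_time_le (c := 5) (k := 0) hn fun j => ?_
    simpa using branch_time_le (T := 4) le_rfl le_rfl
  have hP : ∀ B : Fin n → Fin n → ℝ, (gramTimed B).time ≤ 12 * n ^ 3 := fun B =>
    fill_time_le (c := 9) hn fun i => fill_time_le (c := 6) (k := 1) hn fun j =>
      sumLoop_time_le (c := 3) (k := 0) hn fun k => by simp
  have hm : ∀ P : Fin n → Fin n → ℝ, (fill fun i => do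
      let o ← argminLoop (fun j => steps 3 (T j ∧ j ≠ i)) fun j =>
        maxLoop (fun k => steps 5 (T k ∧ k ≠ i ∧ k ≠ j)) fun k => steps 4 |P k i - P k j|
      steps 2 (o.getD i)).time ≤ 28 * n ^ 3 := by
    intro P
    refine fill_time_le (c := 25) hn fun i => ?_
    have h := argminLoop_time_le (c := 17) (k := 1) hn
      (p := fun j => steps 3 (T j ∧ j ≠ i)) (f := fun j =>
        maxLoop (fun k => steps 5 (T k ∧ k ≠ i ∧ k ≠ j)) fun k => steps 4 |P k i - P k j|)
      (fun j => by
        have h := maxLoop_time_le (c := 9) (k := 0) hn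
          (p := fun k => steps 5 (T k ∧ k ≠ i ∧ k ≠ j)) (f := fun k => steps 4 |P k i - P k j|)
          (fun k => by simp)
        simp only [steps_time]
        rw [pow_one] at *
        omega)
    have h1 : 1 ≤ n ^ 2 := Nat.one_le_pow _ _ hn
    rw [show 1 + 1 = 2 from rfl] at h
    simp only [bind_time, steps_time]
    omega
  have hf : ∀ (P : Fin n → Fin n → ℝ) (m : Fin n → Fin n),
      (fill fun i => fill fun j => branch (T i ∧ T j ∧ i ≠ j)
        (steps 16 √(n * (P i (m i) + P j (m j) - 2 * P i j))) (steps 6 0)).time ≤ 23 * n ^ 2 := by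
    intro P m
    refine fill_time_le (c := 20) hn fun i => fill_time_le (c := 17) (k := 0) hn fun j => ?_
    simpa using branch_time_le (T := 16) le_rfl (by simp)
  have h23 : n ^ 2 ≤ n ^ 3 := Nat.pow_le_pow_right hn (by norm_num)
  unfold estimateDistanceTimed
  simp only [bind_time]
  refine (Nat.add_le_add hB (Nat.add_le_add (hP _) (Nat.add_le_add (hm _) (hf _ _)))).trans ?_
  omega

/-! ### Connected components, implemented -/

/-- The labels are constant exactly on connected components: equal labels always mean reachability,
and the label of a processed vertex agrees with those of its neighbours from then on. -/
lemma labelsTimed_val_eq_iff (c : ℕ) (G : SimpleGraph (Fin n)) (u u' : Fin n) :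
    (labelsTimed c G.Adj).val u = (labelsTimed c G.Adj).val u' ↔ G.Reachable u u' := by
  have inv := iterate_invariant (n := n)
    (fun l (lab : Fin n → Fin n) => (∀ u u', lab u = lab u' → G.Reachable u u') ∧
      ∀ v ∈ l, ∀ w, G.Adj v w → lab v = lab w) (a := fun k => k)
    (f := fun v lab => do
      let hit ← markLoop (fun w => steps (c + 2) (w = v ∨ G.Adj v w)) lab
      fill fun u => branch (hit (lab u)) (steps 3 (lab v)) (steps 3 (lab u)))
    (by
      refine ⟨?_, by simp⟩
      rintro u u' rfl
      exact SimpleGraph.Reachable.refl _)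
    (by
      rintro l v lab ⟨h1, h2⟩
      simp only [bind_val, markLoop_val, fill_val, branch_val, steps_val]
      have hv : ∀ u, (∃ w, (w = v ∨ G.Adj v w) ∧ lab w = lab u) → G.Reachable v u := by
        rintro u ⟨w, hw, hwu⟩
        have hvw : G.Reachable v w := by
          rcases hw with rfl | hw
          · exact SimpleGraph.Reachable.refl _
          · exact hw.reachable
        exact hvw.trans (h1 _ _ hwu)
      refine ⟨?_, ?_⟩
      · intro u u' h
        split_ifs at h with hu hu' hu'
        · exact (hv u hu).symm.trans (hv u' hu')
        · exact absurd ⟨v, Or.inl rfl, h⟩ hu'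
        · exact absurd ⟨v, Or.inl rfl, h.symm⟩ hu
        · exact h1 _ _ h
      · intro v' hv' w hw
        rcases List.mem_append.1 hv' with hv' | hv'
        · rw [h2 v' hv' w hw]
        · obtain rfl : v' = v := by simpa using hv'
          rw [if_pos ⟨v', Or.inl rfl, rfl⟩, if_pos ⟨w, Or.inr hw, rfl⟩])
  refine ⟨inv.1 u u', fun h => ?_⟩
  obtain ⟨p⟩ := h
  induction p with
  | nil => rfl
  | cons hadj _ ih => exact (inv.2 _ (List.mem_finRange _) _ hadj).trans ih

lemma labelsTimed_time_le (hn : 1 ≤ n) (c : ℕ) (adj : Fin n → Fin n → Prop) :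
    (labelsTimed c adj).time ≤ (c + 22) * n ^ 2 := by
  unfold labelsTimed
  have h0 : (fill fun k : Fin n => steps 1 k).time ≤ 4 * n ^ 1 :=
    fill_time_le (c := 1) (k := 0) hn (by simp)
  have h1 : ∀ start : Fin n → Fin n, (iterate start fun v lab => do
      let hit ← markLoop (fun w => steps (c + 2) (w = v ∨ adj v w)) lab
      fill fun u => branch (hit (lab u)) (steps 3 (lab v)) (steps 3 (lab u))).time
      ≤ (c + 15 + 3) * n ^ 2 := by
    intro start
    refine iterate_time_le (k := 1) hn fun v lab => ?_
    have a := markLoop_time_le (c := c + 2) (k := 0) (g := lab) hn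
      (p := fun w => steps (c + 2) (w = v ∨ adj v w)) (by simp)
    have b : ∀ hit : Fin n → Prop,
        (fill fun u => branch (hit (lab u)) (steps 3 (lab v)) (steps 3 (lab u))).time ≤
          7 * n ^ 1 := by
      intro hit
      refine fill_time_le (c := 4) (k := 0) hn fun u => ?_
      simpa using branch_time_le (T := 3) le_rfl le_rfl
    simp only [bind_time]
    refine (Nat.add_le_add a (b _)).trans ?_
    simp only [zero_add, pow_one]
    nlinarith
  have h2 : n ^ 1 ≤ n ^ 2 := Nat.pow_le_pow_right hn (by norm_num)
  simp only [bind_time]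
  refine (Nat.add_le_add h0 (h1 _)).trans ?_
  nlinarith

/-! ### Seriation stages, implemented -/

/-- The pair of the membership arrays of a pair of sets. -/
def memberArrays (P : Finset (Fin n) × Finset (Fin n)) : (Fin n → Prop) × (Fin n → Prop) :=
  (fun k => k ∈ P.1, fun k => k ∈ P.2)

lemma bisectionGraph_isolated {D : Fin n → Fin n → ℝ} {δ₁ δ₂ : ℝ} {i k l : Fin n}
    (h : (bisectionGraph D δ₁ δ₂ i).Reachable k l) (hk : k ≠ i) : l ≠ i := by
  obtain ⟨p⟩ := h
  induction p with
  | nil => exact hk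
  | cons hadj _ ih =>
    refine ih ?_
    rcases ((SimpleGraph.fromRel_adj _ _ _).1 hadj).2 with h | h
    · exact h.2.1
    · exact h.1

/-- Membership in the largest component, in the form in which the implementation tests it: equality
of labels with an optional representative. -/
lemma largestComponent_mem_iff (D : Fin n → Fin n → ℝ) (δ₁ δ₂ : ℝ) (i : Fin n)
    (s : Finset (Fin n)) (k : Fin n) :
    k ∈ largestComponent D δ₁ δ₂ i s ↔
      ∃ m ∈ argmaxOn s fun k => (component D δ₁ δ₂ i k).card,
        (bisectionGraph D δ₁ δ₂ i).Reachable m k := by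
  unfold largestComponent
  rcases argmaxOn s fun k => (component D δ₁ δ₂ i k).card with _ | m
  · simp
  · simp [component, mem_select]

lemma bisectionTimed_val (D : Fin n → Fin n → ℝ) (δ₁ δ₂ δ₃ : ℝ) (i : Fin n) :
    (bisectionTimed D δ₁ δ₂ δ₃ i).val = memberArrays (bisection D δ₁ δ₂ δ₃ i) := by
  have hlab := labelsTimed_val_eq_iff 30 (bisectionGraph D δ₁ δ₂ i)
  have hadj : (fun k l => k ≠ l ∧ (Linked D δ₁ δ₂ i k l ∨ Linked D δ₁ δ₂ i l k)) =
      (bisectionGraph D δ₁ δ₂ i).Adj := by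
    funext k l; rw [bisectionGraph, SimpleGraph.fromRel_adj]
  unfold bisectionTimed
  rw [hadj]
  simp only [bind_val, pure_val, markLoop_val, fill_val, countLoop_val, argmaxLoop_val, steps_val,
    hlab]
  set lab := (labelsTimed 30 (bisectionGraph D δ₁ δ₂ i).Adj).val with hl
  have hK : (select fun k => k ≠ i ∧ ∃ l, (l ≠ i ∧ δ₃ ≤ D i l) ∧
      (bisectionGraph D δ₁ δ₂ i).Reachable l k) = keptVertices D δ₁ δ₂ δ₃ i := by
    ext k
    simp only [keptVertices, component, mem_select]
    refine and_congr_right fun hk => exists_congr fun l => ?_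
    exact ⟨fun h => ⟨h.2.symm, h.1.2⟩, fun h => ⟨⟨bisectionGraph_isolated h.1 hk, h.2⟩, h.1.symm⟩⟩
  have hc : (fun k => (select fun l => (bisectionGraph D δ₁ δ₂ i).Reachable k l).card) =
      fun k => (component D δ₁ δ₂ i k).card := rfl
  rw [hK, hc]
  have hK' : (select fun k => (k ≠ i ∧ ∃ l, (l ≠ i ∧ δ₃ ≤ D i l) ∧
      (bisectionGraph D δ₁ δ₂ i).Reachable l k) ∧
      ¬ ∃ m ∈ argmaxOn (keptVertices D δ₁ δ₂ δ₃ i) fun k => (component D δ₁ δ₂ i k).card,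
        (bisectionGraph D δ₁ δ₂ i).Reachable m k) =
      keptVertices D δ₁ δ₂ δ₃ i \ largestComponent D δ₁ δ₂ i (keptVertices D δ₁ δ₂ δ₃ i) := by
    ext k
    rw [Finset.mem_sdiff, largestComponent_mem_iff, ← hK, mem_select, mem_select, hK]
  rw [hK']
  simp only [memberArrays, bisection, largestComponent_mem_iff]

lemma bisectionTimed_time_le (hn : 1 ≤ n) (D : Fin n → Fin n → ℝ) (δ₁ δ₂ δ₃ : ℝ) (i : Fin n) :
    (bisectionTimed D δ₁ δ₂ δ₃ i).time ≤ 120 * n ^ 2 := by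
  unfold bisectionTimed
  have h1 := labelsTimed_time_le hn 30 fun k l =>
    k ≠ l ∧ (Linked D δ₁ δ₂ i k l ∨ Linked D δ₁ δ₂ i l k)
  have h2 : ∀ lab : Fin n → Fin n,
      (markLoop (fun k => steps 4 (k ≠ i ∧ δ₃ ≤ D i k)) lab).time ≤ 10 * n ^ 1 := fun lab =>
    markLoop_time_le (c := 4) (k := 0) hn (by simp)
  have h3 : ∀ lab : Fin n → Fin n,
      (fill fun k => countLoop fun l => steps 3 (lab k = lab l)).time ≤ 9 * n ^ 2 := fun lab =>
    fill_time_le (c := 6) hn fun k => countLoop_time_le (c := 3) (k := 0) hn (by simp)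
  have h4 : ∀ (p : Fin n → Prop) (size : Fin n → ℕ),
      (argmaxLoop (fun k => steps 4 (p k)) fun k => steps 1 (size k)).time ≤ 11 * n ^ 1 :=
    fun p size => argmaxLoop_time_le (c := 5) (k := 0) hn (by simp)
  have h5 : ∀ (p : Fin n → Prop), (fill fun k => steps 4 (p k)).time ≤ 7 * n ^ 1 := fun p =>
    fill_time_le (c := 4) (k := 0) hn (by simp)
  have h6 : ∀ (p : Fin n → Prop) (size : Fin n → ℕ),
      (argmaxLoop (fun k => steps 7 (p k)) fun k => steps 1 (size k)).time ≤ 14 * n ^ 1 :=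
    fun p size => argmaxLoop_time_le (c := 8) (k := 0) hn (by simp)
  have h12 : n ^ 1 ≤ n ^ 2 := Nat.pow_le_pow_right hn (by norm_num)
  simp only [bind_time, pure_time, add_zero]
  refine (Nat.add_le_add h1 (Nat.add_le_add (h2 _) (Nat.add_le_add (h3 _)
    (Nat.add_le_add (h4 _ _) (Nat.add_le_add (h5 _)
      (Nat.add_le_add (h6 _ _) (h5 _))))))).trans ?_
  omega

lemma orientationTimed_val (G : Fin n → Finset (Fin n) × Finset (Fin n)) :
    (orientationTimed fun i => memberArrays (G i)).val =
      fun i => memberArrays (orientation G i) := by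
  have hs : ∀ s : Finset (Fin n), (select fun k => k ∈ s) = s := fun s => by
    ext k; rw [mem_select]
  have hu : (select fun _ : Fin n => True) = Finset.univ := by
    ext k; rw [mem_select]; simp
  have hne : ∀ s : Finset (Fin n), (∃ k, k ∈ s) ↔ s ≠ ∅ := fun s =>
    Finset.nonempty_iff_ne_empty
  have hcap : ∀ s t : Finset (Fin n), (∃ k, k ∈ s ∧ k ∈ t) ↔ s ∩ t ≠ ∅ := fun s t => by
    rw [← hne]; simp
  unfold orientationTimed
  simp only [bind_val, fill_val, countLoop_val, argmaxLoop_val, steps_val, memberArrays, hs, hu]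
  funext i
  simp only [orientation]
  rcases argmaxOn Finset.univ fun i => min (G i).1.card (G i).2.card with _ | c
  · simp
  · simp only [fill_val, bind_val, anyLoop_val, steps_val, pure_val, branch_val, hne, hcap]
    by_cases h1 : i = c
    · simp [h1]
    · by_cases h2 : (G i).2 = ∅
      · by_cases h3 : i ∈ (G c).1 <;> simp [h1, h2, h3]
      · by_cases h4 : (G i).1 ∩ (G c).1 = ∅
        · simp [h1, h2, h4]
        · by_cases h5 : (G i).2 ∩ (G c).2 = ∅ <;> simp [h1, h2, h4, h5]

lemma orientationTimed_time_le (hn : 1 ≤ n) (G : Fin n → (Fin n → Prop) × (Fin n → Prop)) :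
    (orientationTimed G).time ≤ 100 * n ^ 2 := by
  have h1 : (fill fun i => do
      let a ← countLoop fun k => steps 1 ((G i).1 k)
      let b ← countLoop fun k => steps 1 ((G i).2 k)
      steps 1 (min a b)).time ≤ 12 * n ^ 2 := by
    refine fill_time_le (c := 9) (k := 1) hn fun i => ?_
    have ha := countLoop_time_le (c := 1) (k := 0) hn (p := fun k => steps 1 ((G i).1 k)) (by simp)
    have hb := countLoop_time_le (c := 1) (k := 0) hn (p := fun k => steps 1 ((G i).2 k)) (by simp)
    simp only [bind_time, steps_time, zero_add, pow_one] at *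
    omega
  have h2 : ∀ size : Fin n → ℕ,
      (argmaxLoop (fun _ => steps 1 True) fun i => steps 1 (size i)).time ≤ 8 * n ^ 1 := fun size =>
    argmaxLoop_time_le (c := 2) (k := 0) hn (by simp)
  have h3 : ∀ o : Option (Fin n), (match o with
      | none => fill fun _ => steps 1 (fun _ => False, fun _ => False)
      | some c => fill fun i => do
        let full ← anyLoop fun k => steps 1 ((G i).2 k)
        let a ← anyLoop fun k => steps 3 ((G i).1 k ∧ (G c).1 k)
        let b ← anyLoop fun k => steps 3 ((G i).2 k ∧ (G c).2 k)
        let L ← fill fun k =>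
          branch (i = c) (steps 4 ((G c).1 k)) <|
            branch full
              (branch (a ∧ b) (steps 4 ((G i).1 k)) (steps 4 ((G i).2 k)))
              (branch ((G c).1 i) (steps 4 False) (steps 4 ((G i).1 k)))
        let R ← fill fun k =>
          branch (i = c) (steps 4 ((G c).2 k)) <|
            branch full
              (branch (a ∧ b) (steps 4 ((G i).2 k)) (steps 4 ((G i).1 k)))
              (branch ((G c).1 i) (steps 4 ((G i).1 k)) (steps 4 False))
        pure (L, R) : Timed (Fin n → (Fin n → Prop) × (Fin n → Prop))).time ≤ 60 * n ^ 2 := by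
    rintro (_ | c)
    · refine (fill_time_le (c := 1) (k := 0) hn (by simp)).trans ?_
      have h12 : n ^ 1 ≤ n ^ 2 := Nat.pow_le_pow_right hn (by norm_num)
      simp only [zero_add]
      omega
    · refine fill_time_le (c := 57) (k := 1) hn fun i => ?_
      have any1 : ∀ p : Fin n → Prop, (anyLoop fun k => steps 1 (p k)).time ≤ 4 * n := fun p => by
        simpa using anyLoop_time_le (c := 1) (k := 0) hn (p := fun k => steps 1 (p k)) (by simp)
      have any3 : ∀ p : Fin n → Prop, (anyLoop fun k => steps 3 (p k)).time ≤ 6 * n := fun p => by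
        simpa using anyLoop_time_le (c := 3) (k := 0) hn (p := fun k => steps 3 (p k)) (by simp)
      have tree : ∀ (p q : Prop) (r s a b c d e : Fin n → Prop), (fill fun k =>
          branch p (steps 4 (a k)) <| branch q (branch (r k) (steps 4 (b k)) (steps 4 (c k)))
            (branch (s k) (steps 4 (d k)) (steps 4 (e k)))).time ≤ 10 * n := by
        intro p q r s a b c d e
        have := fill_time_le (c := 7) (k := 0) hn (f := fun k =>
          branch p (steps 4 (a k)) <| branch q (branch (r k) (steps 4 (b k)) (steps 4 (c k)))
            (branch (s k) (steps 4 (d k)) (steps 4 (e k)))) (fun k => by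
          simp only [pow_zero, mul_one]
          refine branch_time_le (T := 6) (by simp) (branch_time_le (T := 5) ?_ ?_) <;>
            exact branch_time_le (T := 4) le_rfl le_rfl)
        simpa using this
      simp only [bind_time, pure_time, add_zero, pow_one]
      refine (Nat.add_le_add (any1 _) (Nat.add_le_add (any3 _) (Nat.add_le_add (any3 _)
        (Nat.add_le_add (tree _ _ (fun _ => _) (fun _ => _) _ _ _ _ _)
          (tree _ _ (fun _ => _) (fun _ => _) _ _ _ _ _))))).trans ?_
      omega
  have h12 : n ^ 1 ≤ n ^ 2 := Nat.pow_le_pow_right hn (by norm_num)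
  have h02 : 1 ≤ n ^ 2 := Nat.one_le_pow _ _ hn
  unfold orientationTimed
  simp only [bind_time, steps_time]
  refine (Nat.add_le_add h1 (Nat.add_le_add (h2 _) (Nat.add_le_add_left (h3 _) 1))).trans ?_
  omega

lemma aggregateBisectionsTimed_val (D : Fin n → Fin n → ℝ) (δ₁ δ₂ δ₃ : ℝ) :
    (aggregateBisectionsTimed D δ₁ δ₂ δ₃).val = aggregateBisections D δ₁ δ₂ δ₃ := by
  unfold aggregateBisectionsTimed
  simp only [bind_val]
  have hG : (fill fun i => bisectionTimed D δ₁ δ₂ δ₃ i).val =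
      fun i => memberArrays (bisection D δ₁ δ₂ δ₃ i) := by
    funext i; exact bisectionTimed_val D δ₁ δ₂ δ₃ i
  rw [hG, orientationTimed_val]
  funext i j
  simp only [fill_val, anyLoop_val, steps_val, branch_val, memberArrays, aggregateBisections,
    comparisons]
  set LR := orientation (bisection D δ₁ δ₂ δ₃)
  have hne : (¬ ∃ k, k ∈ (LR i).1 ∨ k ∈ (LR i).2) ↔ LR i = (∅, ∅) := by
    rw [Prod.ext_iff, Finset.eq_empty_iff_forall_notMem, Finset.eq_empty_iff_forall_notMem]
    push Not
    exact forall_and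
  by_cases h1 : i = j
  · simp [h1]
  · by_cases h2 : LR i = (∅, ∅)
    · rw [if_pos (Or.inr (hne.2 h2)), if_pos (Or.inr h2)]
    · have h3 : ¬ (i = j ∨ LR i = (∅, ∅)) := by tauto
      rw [if_neg (by rw [hne]; exact h3), if_neg h3]
      by_cases h4 : i ∈ (LR j).1 ∨ j ∈ (LR i).2
      · rw [if_pos h4, if_pos h4]
      · rw [if_neg h4, if_neg h4]
        by_cases h5 : i ∈ (LR j).2 ∨ j ∈ (LR i).1
        · rw [if_pos h5, if_pos h5]
        · rw [if_neg h5, if_neg h5]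

lemma aggregateBisectionsTimed_time_le (hn : 1 ≤ n) (D : Fin n → Fin n → ℝ) (δ₁ δ₂ δ₃ : ℝ) :
    (aggregateBisectionsTimed D δ₁ δ₂ δ₃).time ≤ 300 * n ^ 3 := by
  unfold aggregateBisectionsTimed
  have h1 : (fill fun i => bisectionTimed D δ₁ δ₂ δ₃ i).time ≤ 123 * n ^ 3 :=
    fill_time_le (c := 120) hn fun i => bisectionTimed_time_le hn D δ₁ δ₂ δ₃ i
  have h2 : ∀ G : Fin n → (Fin n → Prop) × (Fin n → Prop),
      (orientationTimed G).time ≤ 100 * n ^ 2 := orientationTimed_time_le hn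
  have h3 : ∀ p : Fin n → Fin n → Prop,
      (fill fun i => anyLoop fun k => steps 3 (p i k)).time ≤ 9 * n ^ 2 := fun p =>
    fill_time_le (c := 6) hn fun i => anyLoop_time_le (c := 3) (k := 0) hn (by simp)
  have h4 : ∀ p q r : Fin n → Fin n → Prop, (fill fun i => fill fun j =>
      branch (p i j) (steps 4 (0 : ℤ)) <| branch (q i j) (steps 7 (-1)) <|
        branch (r i j) (steps 10 1) (steps 10 0)).time ≤ 19 * n ^ 2 := by
    intro p q r
    refine fill_time_le (c := 16) hn fun i => fill_time_le (c := 13) (k := 0) hn fun j => ?_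
    simp only [pow_zero, mul_one]
    exact branch_time_le (T := 12) (by simp) (branch_time_le (T := 11) (by simp)
      (branch_time_le (T := 10) le_rfl le_rfl))
  have h23 : n ^ 2 ≤ n ^ 3 := Nat.pow_le_pow_right hn (by norm_num)
  simp only [bind_time]
  refine (Nat.add_le_add h1 (Nat.add_le_add (h2 _) (Nat.add_le_add
    (h3 (fun i k => _)) (h4 (fun i j => _) (fun i j => _) (fun i j => _))))).trans ?_
  omega

lemma reevaluateTimed_val (H : Fin n → Fin n → ℤ) (D A : Fin n → Fin n → ℝ) (σ δ₄ : ℝ)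
    (s : Fin n → Fin 3) (i j : Fin n) :
    (reevaluateTimed H D A (fun t => estimateDistance A (block s t)) (noiseThreshold n σ) δ₄ s
      i j).val = reevaluate H D A σ δ₄ s i j := by
  have hsum : ∀ h : ℤ, (∑ k, (branch (s k = freeBlock s i j ∧ H i k = h ∧ H j k = h ∧
        δ₄ ≤ estimateDistance A (block s (freeBlock s i j)) (anchor D s i j) k)
        (steps 14 (A i k - A j k)) (steps 14 0)).val) =
      ∑ k ∈ comparisonSet H D A δ₄ s h i j, (A i k - A j k) := by
    intro h
    simp only [comparisonSet, select, block, Finset.mem_filter, Finset.mem_univ, true_and,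
      Finset.sum_filter, branch_val, steps_val]
    refine Finset.sum_congr rfl fun k _ => ?_
    congr
  unfold reevaluate evaluateComparison
  rw [← hsum, ← hsum]
  rfl

lemma reevaluateTimed_time_le (hn : 1 ≤ n) (H : Fin n → Fin n → ℤ) (D A : Fin n → Fin n → ℝ)
    (Dt : Fin 3 → Fin n → Fin n → ℝ) (τ δ₄ : ℝ) (s : Fin n → Fin 3) (i j : Fin n) :
    (reevaluateTimed H D A Dt τ δ₄ s i j).time ≤ 80 * n := by
  unfold reevaluateTimed
  have h1 : ∀ t, (argminLoop (fun p => steps 2 (s p = t)) fun p => steps 1 (D i p)).time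
      ≤ 9 * n := fun t => by
    simpa using argminLoop_time_le (c := 3) (k := 0) hn (p := fun p => steps 2 (s p = t))
      (f := fun p => steps 1 (D i p)) (by simp)
  have h2 : ∀ p : Fin n → Prop, (sumLoop fun k =>
      branch (p k) (steps 14 (A i k - A j k)) (steps 14 0)).time ≤ 18 * n := fun p => by
    simpa using sumLoop_time_le (c := 15) (k := 0) hn (f := fun k =>
      branch (p k) (steps 14 (A i k - A j k)) (steps 14 0))
      (fun k => by simpa using branch_time_le (T := 14) le_rfl le_rfl)
  simp only [bind_time, steps_time]
  refine (Nat.add_le_add_left (Nat.add_le_add (h1 _) (Nat.add_le_add_left (Nat.add_le_add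
    (h2 fun k => _) (Nat.add_le_add_right (h2 fun k => _) 8)) 2)) 10).trans ?_
  omega

lemma reevaluateComparisonsTimed_val (H : Fin n → Fin n → ℤ) (D A : Fin n → Fin n → ℝ)
    (σ δ₄ : ℝ) (s : Fin n → Fin 3) :
    (reevaluateComparisonsTimed H D A (noiseThreshold n σ) δ₄ s).val =
      reevaluateComparisons H D A σ δ₄ s := by
  have hDt : (fill fun t : Fin 3 => do
      let S ← fill fun k => steps 2 (s k = t)
      estimateDistanceTimed A S).val = fun t => estimateDistance A (block s t) := by
    funext t
    exact estimateDistanceTimed_val A (block s t) _ fun k => by simp [block, mem_select]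
  unfold reevaluateComparisonsTimed
  simp only [bind_val]
  rw [hDt]
  funext i j
  simp only [fill_val, bind_val, branch_val, steps_val, reevaluateTimed_val,
    reevaluateComparisons]
  congr

lemma reevaluateComparisonsTimed_time_le (hn : 1 ≤ n) (H : Fin n → Fin n → ℤ)
    (D A : Fin n → Fin n → ℝ) (τ δ₄ : ℝ) (s : Fin n → Fin 3) :
    (reevaluateComparisonsTimed H D A τ δ₄ s).time ≤ 1000 * n ^ 3 := by
  have h1 : (fill fun t : Fin 3 => do
      let S ← fill fun k => steps 2 (s k = t)
      estimateDistanceTimed A S).time ≤ 400 * n ^ 3 := by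
    have hS : ∀ t : Fin 3, (fill fun k => steps 2 (s k = t)).time ≤ 5 * n ^ 1 := fun t =>
      fill_time_le (c := 2) (k := 0) hn (by simp)
    have hD := estimateDistanceTimed_time_le hn A
    have h13 : n ^ 1 ≤ n ^ 3 := Nat.pow_le_pow_right hn (by norm_num)
    have h03 : 1 ≤ n ^ 3 := Nat.one_le_pow _ _ hn
    change 1 + ∑ t : Fin 3, ((fill fun k => steps 2 (s k = t)).time +
      (estimateDistanceTimed A (fill fun k => steps 2 (s k = t)).val).time + 2) ≤ _
    rw [Fin.sum_univ_three]
    have a0 := hS 0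
    have a1 := hS 1
    have a2 := hS 2
    have b0 := hD (fill fun k => steps 2 (s k = 0)).val
    have b1 := hD (fill fun k => steps 2 (s k = 1)).val
    have b2 := hD (fill fun k => steps 2 (s k = 2)).val
    omega
  have h2 : ∀ Dt : Fin 3 → Fin n → Fin n → ℝ, (fill fun i => fill fun j => do
      let x ← branch (i < j ∧ H i j = 0)
        (reevaluateTimed H D A Dt τ δ₄ s i j)
        (branch (j < i ∧ H j i = 0)
          (do
            let y ← reevaluateTimed H D A Dt τ δ₄ s j i
            steps 1 (-y))
          (steps 1 0))
      steps 10 (H i j + x)).time ≤ 100 * n ^ 3 := by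
    intro Dt
    refine fill_time_le (c := 97) (k := 2) hn fun i => fill_time_le (c := 94) (k := 1) hn
      fun j => ?_
    have hb : (branch (i < j ∧ H i j = 0)
        (reevaluateTimed H D A Dt τ δ₄ s i j)
        (branch (j < i ∧ H j i = 0)
          (do
            let y ← reevaluateTimed H D A Dt τ δ₄ s j i
            steps 1 (-y))
          (steps 1 0))).time ≤ 80 * n + 3 := by
      have a := reevaluateTimed_time_le hn H D A Dt τ δ₄ s i j
      have b := reevaluateTimed_time_le hn H D A Dt τ δ₄ s j i
      refine branch_time_le (T := 80 * n + 2) (by omega) (branch_time_le (T := 80 * n + 1) ?_ ?_)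
      · simp only [bind_time, steps_time]; omega
      · simp
    simp only [bind_time, steps_time, pow_one]
    omega
  unfold reevaluateComparisonsTimed
  simp only [bind_time]
  refine (Nat.add_le_add h1 (h2 _)).trans ?_
  omega

/-- The implementation computes SABRE. -/
theorem sabreTimed_val (σ : ℝ) (A : Fin n → Fin n → ℝ) (s : Fin n → Fin 3) :
    (sabreTimed σ A s).val = sabre σ A s := by
  have hD := estimateDistanceTimed_val A Finset.univ (fill fun _ : Fin n => steps 1 True).val
    (fun k => by simp)
  have ht : ∀ k, tuning n (k + 1) = tuning n k * Real.log n := fun k => by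
    unfold tuning; ring
  have h1 : tuning n 1 = (n : ℝ) ^ (3 / 4 : ℝ) * Real.log n := by unfold tuning; ring
  unfold sabreTimed
  simp only [bind_val, steps_val]
  rw [hD, ← h1, ← ht 1, ← ht 2, ← ht 3, aggregateBisectionsTimed_val]
  have hr := reevaluateComparisonsTimed_val (aggregateBisections (estimateDistance A Finset.univ)
    (tuning n 1) (tuning n 2) (tuning n 3)) (estimateDistance A Finset.univ) A σ (tuning n 4) s
  rw [noiseThreshold] at hr
  rw [hr]
  rfl

/-- The implementation takes a cubic number of steps. -/
theorem sabreTimed_time_le (hn : 1 ≤ n) (σ : ℝ) (A : Fin n → Fin n → ℝ) (s : Fin n → Fin 3) :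
    (sabreTimed σ A s).time ≤ 2000 * n ^ 3 := by
  have h1 : (fill fun _ : Fin n => steps 1 True).time ≤ 4 * n ^ 1 :=
    fill_time_le (c := 1) (k := 0) hn (by simp)
  have h2 : ∀ H' : Fin n → Fin n → ℤ, (fill fun i => do
      let z ← sumLoop fun j => steps 1 (H' i j)
      steps 4 (((z : ℝ) + n + 1) / 2)).time ≤ 11 * n ^ 2 := by
    intro H'
    refine fill_time_le (c := 8) (k := 1) hn fun i => ?_
    have := sumLoop_time_le (c := 1) (k := 0) hn (f := fun j => steps 1 (H' i j)) (by simp)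
    simp only [bind_time, steps_time, zero_add, pow_one] at *
    omega
  have h13 : n ^ 1 ≤ n ^ 3 := Nat.pow_le_pow_right hn (by norm_num)
  have h23 : n ^ 2 ≤ n ^ 3 := Nat.pow_le_pow_right hn (by norm_num)
  have h03 : 1 ≤ n ^ 3 := Nat.one_le_pow _ _ hn
  unfold sabreTimed
  simp only [bind_time, steps_time]
  refine le_trans (Nat.add_le_add_left (Nat.add_le_add_left (Nat.add_le_add_left
    (Nat.add_le_add_left (Nat.add_le_add_left (Nat.add_le_add_left (Nat.add_le_add_left
      (Nat.add_le_add h1 (Nat.add_le_add (estimateDistanceTimed_time_le hn _ _)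
        (Nat.add_le_add (aggregateBisectionsTimed_time_le hn _ _ _ _) (Nat.add_le_add
          (reevaluateComparisonsTimed_time_le hn _ _ _ _ _ _) (h2 _)))))
      4) 1) 1) 1) 1) 2) 1) ?_
  omega

/-! ### Positions and reversal -/

/-- The distance of the positions of `i` and `j` in the order `y`. -/
def gap (y : Equiv.Perm (Fin n)) (i j : Fin n) : ℕ :=
  ((y i : ℕ) - (y j : ℕ)) + ((y j : ℕ) - (y i : ℕ))

/-- The sign of `y i - y j`. -/
def orderSign (y : Equiv.Perm (Fin n)) (i j : Fin n) : ℤ :=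
  if y i < y j then -1 else if y j < y i then 1 else 0

/-- The reversed order. -/
def reverseOrder (y : Equiv.Perm (Fin n)) : Equiv.Perm (Fin n) := y.trans Fin.revPerm

lemma reverseOrder_val (y : Equiv.Perm (Fin n)) (i : Fin n) :
    (reverseOrder y i : ℕ) = n - (y i + 1) := by
  simp [reverseOrder, Fin.val_rev]

lemma gap_reverseOrder (y : Equiv.Perm (Fin n)) (i j : Fin n) :
    gap (reverseOrder y) i j = gap y i j := by
  have := (y i).isLt
  have := (y j).isLt
  simp only [gap, reverseOrder_val]
  omega

lemma gap_comm (y : Equiv.Perm (Fin n)) (i j : Fin n) : gap y i j = gap y j i := by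
  unfold gap; omega

lemma position_ne (y : Equiv.Perm (Fin n)) {i j : Fin n} (h : i ≠ j) : (y i : ℕ) ≠ y j :=
  fun h' => h (y.injective (Fin.ext h'))

lemma exists_position (y : Equiv.Perm (Fin n)) {a : ℕ} (ha : a < n) : ∃ k, (y k : ℕ) = a :=
  ⟨y.symm ⟨a, ha⟩, by simp⟩

lemma card_positions_Ico (y : Equiv.Perm (Fin n)) {a b : ℕ} (hb : b ≤ n) :
    (Finset.univ.filter fun k => a ≤ (y k : ℕ) ∧ (y k : ℕ) < b).card = b - a := by
  rw [← Nat.card_Ico a b, ← Finset.card_image_of_injective (f := fun k => (y k : ℕ)) _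
    (fun i j h => y.injective (Fin.ext h))]
  congr 1
  ext m
  simp only [Finset.mem_image, Finset.mem_filter, Finset.mem_univ, true_and, Finset.mem_Ico]
  constructor
  · rintro ⟨k, h, rfl⟩; exact h
  · intro h
    obtain ⟨k, hk⟩ := exists_position y (show m < n by omega)
    exact ⟨k, by omega, hk⟩

lemma argmaxOn_eq_none {β : Type} [LinearOrder β] {s : Finset (Fin n)} {f : Fin n → β}
    (h : argmaxOn s f = none) : s = ∅ := by
  rw [argmaxOn, List.argmax_eq_none, List.filter_eq_nil_iff] at h
  exact Finset.eq_empty_of_forall_notMem fun k hk => h k (List.mem_finRange k) (by simpa using hk)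

lemma argmaxOn_eq_some {β : Type} [LinearOrder β] {s : Finset (Fin n)} {f : Fin n → β} {m : Fin n}
    (h : argmaxOn s f = some m) : m ∈ s ∧ ∀ k ∈ s, f k ≤ f m := by
  constructor
  · simpa using (List.mem_filter.1 (List.argmax_mem h)).2
  · intro k hk
    exact List.le_of_mem_argmax (f := f)
      (List.mem_filter.2 ⟨List.mem_finRange k, by simpa using hk⟩) h

lemma argminOn_eq_none {β : Type} [LinearOrder β] {s : Finset (Fin n)} {f : Fin n → β}
    (h : argminOn s f = none) : s = ∅ := by
  rw [argminOn, List.argmin_eq_none, List.filter_eq_nil_iff] at h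
  exact Finset.eq_empty_of_forall_notMem fun k hk => h k (List.mem_finRange k) (by simpa using hk)

lemma argminOn_eq_some {β : Type} [LinearOrder β] {s : Finset (Fin n)} {f : Fin n → β} {m : Fin n}
    (h : argminOn s f = some m) : m ∈ s ∧ ∀ k ∈ s, f m ≤ f k := by
  constructor
  · simpa using (List.mem_filter.1 (List.argmin_mem h)).2
  · intro k hk
    exact List.le_of_mem_argmin (f := f)
      (List.mem_filter.2 ⟨List.mem_finRange k, by simpa using hk⟩) h

/-- A minimiser of `f` on a nonempty set, as the algorithm reads it off. -/
lemma argminOn_getD {β : Type} [LinearOrder β] {s : Finset (Fin n)} (hs : s.Nonempty)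
    (f : Fin n → β) (i : Fin n) :
    (argminOn s f).getD i ∈ s ∧ ∀ k ∈ s, f ((argminOn s f).getD i) ≤ f k := by
  rcases h : argminOn s f with _ | m
  · exact absurd (argminOn_eq_none h) hs.ne_empty
  · exact argminOn_eq_some h

/-! ### First seriation: bisections and their orientation -/

/-- The distance estimates `D` resolve the order `y`: the comparisons of `D` with the thresholds
`δ₁`, `δ₂`, `δ₃` are equivalent to comparisons of the gaps with `ρ₁`, `ρ₂`, `ρ₃`, up to the ratios
between consecutive thresholds. -/
structure Resolves (D : Fin n → Fin n → ℝ) (δ₁ δ₂ δ₃ : ℝ) (y : Equiv.Perm (Fin n))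
    (ρ₁ ρ₂ ρ₃ : ℕ) : Prop where
  le_one : ∀ i j, gap y i j ≤ 1 → D i j ≤ δ₁
  le_radius₁ : ∀ i j, D i j ≤ δ₁ → gap y i j ≤ ρ₁
  radius₁_lt : ∀ i j, δ₂ ≤ D i j → ρ₁ < gap y i j
  of_radius₂_le : ∀ i j, ρ₂ ≤ gap y i j → δ₂ ≤ D i j
  radius₂_le : ∀ i j, δ₃ ≤ D i j → ρ₂ ≤ gap y i j
  of_radius₃_le : ∀ i j, ρ₃ ≤ gap y i j → δ₃ ≤ D i j
  pos : 1 ≤ ρ₂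
  mono : ρ₂ ≤ ρ₃
  small : 4 * (ρ₂ + ρ₃ + 1) ≤ n

/-- `G` lies to the left of `i` and contains everything that is to the left of `i` and at distance
at least `ρ`; there is something of this kind. -/
structure IsLeftPart (y : Equiv.Perm (Fin n)) (ρ : ℕ) (i : Fin n) (G : Finset (Fin n)) : Prop where
  lt : ∀ k ∈ G, (y k : ℕ) < y i
  mem : ∀ k, (y k : ℕ) + ρ ≤ y i → k ∈ G
  le : ρ ≤ y i

/-- The mirror image of `IsLeftPart`. -/
structure IsRightPart (y : Equiv.Perm (Fin n)) (ρ : ℕ) (i : Fin n) (G : Finset (Fin n)) :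
    Prop where
  lt : ∀ k ∈ G, (y i : ℕ) < y k
  mem : ∀ k, (y i : ℕ) + ρ ≤ y k → k ∈ G
  le : (y i : ℕ) + ρ < n

lemma isLeftPart_reversed {y : Equiv.Perm (Fin n)} {ρ : ℕ} {i : Fin n} {G : Finset (Fin n)}
    (h : IsLeftPart (reverseOrder y) ρ i G) : IsRightPart y ρ i G where
  lt k hk := by have := h.lt k hk; simp only [reverseOrder_val] at this; omega
  mem k hk := h.mem k (by have := (y k).isLt; simp only [reverseOrder_val]; omega)
  le := by have := h.le; have := (y i).isLt; simp only [reverseOrder_val] at *; omega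

lemma isRightPart_reversed {y : Equiv.Perm (Fin n)} {ρ : ℕ} {i : Fin n} {G : Finset (Fin n)}
    (h : IsRightPart (reverseOrder y) ρ i G) : IsLeftPart y ρ i G where
  lt k hk := by
    have := h.lt k hk; have := (y i).isLt; have := (y k).isLt
    simp only [reverseOrder_val] at *; omega
  mem k hk := h.mem k (by have := (y i).isLt; simp only [reverseOrder_val]; omega)
  le := by have := h.le; have := (y i).isLt; simp only [reverseOrder_val] at *; omega

lemma IsRightPart.reversed {y : Equiv.Perm (Fin n)} {ρ : ℕ} {i : Fin n} {G : Finset (Fin n)}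
    (h : IsRightPart y ρ i G) : IsLeftPart (reverseOrder y) ρ i G where
  lt k hk := by have := h.lt k hk; have := (y k).isLt; simp only [reverseOrder_val]; omega
  mem k hk := h.mem k (by
    have := (y k).isLt; have := (y i).isLt; simp only [reverseOrder_val] at hk; omega)
  le := by have := h.le; simp only [reverseOrder_val]; omega

lemma IsLeftPart.reversed {y : Equiv.Perm (Fin n)} {ρ : ℕ} {i : Fin n} {G : Finset (Fin n)}
    (h : IsLeftPart y ρ i G) : IsRightPart (reverseOrder y) ρ i G where
  lt k hk := by have := h.lt k hk; have := (y i).isLt; simp only [reverseOrder_val]; omega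
  mem k hk := h.mem k (by
    have := (y k).isLt; have := (y i).isLt; simp only [reverseOrder_val] at hk; omega)
  le := by have := h.le; have := (y i).isLt; simp only [reverseOrder_val]; omega

section Bisection

variable {D : Fin n → Fin n → ℝ} {δ₁ δ₂ δ₃ : ℝ} {y : Equiv.Perm (Fin n)} {ρ₁ ρ₂ ρ₃ : ℕ}

lemma Resolves.reversed (h : Resolves D δ₁ δ₂ δ₃ y ρ₁ ρ₂ ρ₃) :
    Resolves D δ₁ δ₂ δ₃ (reverseOrder y) ρ₁ ρ₂ ρ₃ where
  le_one i j := by rw [gap_reverseOrder]; exact h.le_one i j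
  le_radius₁ i j := by rw [gap_reverseOrder]; exact h.le_radius₁ i j
  radius₁_lt i j := by rw [gap_reverseOrder]; exact h.radius₁_lt i j
  of_radius₂_le i j := by rw [gap_reverseOrder]; exact h.of_radius₂_le i j
  radius₂_le i j := by rw [gap_reverseOrder]; exact h.radius₂_le i j
  of_radius₃_le i j := by rw [gap_reverseOrder]; exact h.of_radius₃_le i j
  pos := h.pos
  mono := h.mono
  small := h.small

/-- Links do not jump over `i`: linked vertices are closer to each other than one of them is
to `i`. -/
lemma Resolves.adj_same_side (h : Resolves D δ₁ δ₂ δ₃ y ρ₁ ρ₂ ρ₃) {i k l : Fin n}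
    (hkl : (bisectionGraph D δ₁ δ₂ i).Adj k l) : (y k < y i ↔ y l < y i) := by
  have key : ∀ k l, Linked D δ₁ δ₂ i k l → (y k < y i ↔ y l < y i) := by
    rintro k l ⟨hk, hl, h1, h2⟩
    have a := h.le_radius₁ k l h1
    have b : ρ₁ < gap y i k ∨ ρ₁ < gap y i l :=
      (le_max_iff.1 h2).imp (h.radius₁_lt i k) (h.radius₁_lt i l)
    have := position_ne y hk
    have := position_ne y hl
    unfold gap at a b
    rw [Fin.lt_def, Fin.lt_def]
    omega
  rcases ((SimpleGraph.fromRel_adj _ _ _).1 hkl).2 with h | h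
  · exact key _ _ h
  · exact (key _ _ h).symm

lemma Resolves.reachable_same_side (h : Resolves D δ₁ δ₂ δ₃ y ρ₁ ρ₂ ρ₃) {i k l : Fin n}
    (hkl : (bisectionGraph D δ₁ δ₂ i).Reachable k l) : (y k < y i ↔ y l < y i) := by
  obtain ⟨p⟩ := hkl
  induction p with
  | nil => rfl
  | cons hadj _ ih => exact (h.adj_same_side hadj).trans ih

/-- Far from `i`, consecutive positions are linked. -/
lemma Resolves.reachable_left (h : Resolves D δ₁ δ₂ δ₃ y ρ₁ ρ₂ ρ₃) {i k : Fin n} (m : ℕ) :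
    ∀ l, (y l : ℕ) = y k + m → (y l : ℕ) + ρ₂ ≤ y i →
      (bisectionGraph D δ₁ δ₂ i).Reachable k l := by
  induction m with
  | zero =>
    intro l hl _
    obtain rfl : l = k := y.injective (Fin.ext (by simpa using hl))
    exact SimpleGraph.Reachable.refl _
  | succ m ih =>
    intro l hl hi
    have hp := h.pos
    obtain ⟨l', hl'⟩ := exists_position y (a := y k + m) (by have := (y l).isLt; omega)
    refine (ih l' hl' (by omega)).trans (SimpleGraph.Adj.reachable ?_)
    refine (SimpleGraph.fromRel_adj _ _ _).2 ⟨?_, Or.inl ⟨?_, ?_, ?_, ?_⟩⟩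
    · rintro rfl; omega
    · rintro rfl; omega
    · rintro rfl; omega
    · exact h.le_one _ _ (by unfold gap; omega)
    · exact le_max_of_le_right (h.of_radius₂_le _ _ (by unfold gap; omega))

lemma mem_keptVertices {i k : Fin n} : k ∈ keptVertices D δ₁ δ₂ δ₃ i ↔
    k ≠ i ∧ ∃ l, (bisectionGraph D δ₁ δ₂ i).Reachable k l ∧ δ₃ ≤ D i l := by
  simp only [keptVertices, component, mem_select]

lemma Resolves.isLeftPart_component (h : Resolves D δ₁ δ₂ δ₃ y ρ₁ ρ₂ ρ₃) {i k : Fin n}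
    (hk : k ∈ keptVertices D δ₁ δ₂ δ₃ i) (hki : y k < y i) :
    IsLeftPart y ρ₂ i (component D δ₁ δ₂ i k) := by
  obtain ⟨hne, l, hkl, hl⟩ := mem_keptVertices.1 hk
  have hli := (h.reachable_same_side hkl).1 hki
  have hgap := h.radius₂_le i l hl
  rw [Fin.lt_def] at hli hki
  have hlρ : (y l : ℕ) + ρ₂ ≤ y i := by unfold gap at hgap; omega
  refine ⟨fun m hm => ?_, fun m hm => ?_, by omega⟩
  · have hm' : (bisectionGraph D δ₁ δ₂ i).Reachable k m := by
      simpa [component, mem_select] using hm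
    exact (h.reachable_same_side hm').1 hki
  · have hlm : (bisectionGraph D δ₁ δ₂ i).Reachable l m := by
      rcases le_total (y l : ℕ) (y m) with hle | hle
      · exact h.reachable_left (y m - y l) m (by omega) hm
      · exact (h.reachable_left (y l - y m) l (by omega) hlρ).symm
    simpa [component, mem_select] using hkl.trans hlm

lemma Resolves.isRightPart_component (h : Resolves D δ₁ δ₂ δ₃ y ρ₁ ρ₂ ρ₃) {i k : Fin n}
    (hk : k ∈ keptVertices D δ₁ δ₂ δ₃ i) (hki : y i < y k) :
    IsRightPart y ρ₂ i (component D δ₁ δ₂ i k) := by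
  refine isLeftPart_reversed (h.reversed.isLeftPart_component hk ?_)
  have := (y k).isLt
  rw [Fin.lt_def] at *
  simp only [reverseOrder_val]
  omega

lemma Resolves.mem_keptVertices_of_le (h : Resolves D δ₁ δ₂ δ₃ y ρ₁ ρ₂ ρ₃) {i k : Fin n}
    (hk : ρ₃ ≤ gap y i k) : k ∈ keptVertices D δ₁ δ₂ δ₃ i := by
  refine mem_keptVertices.2 ⟨?_, k, SimpleGraph.Reachable.refl _, h.of_radius₃_le i k hk⟩
  rintro rfl
  have := h.pos
  have := h.mono
  unfold gap at hk
  omega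

lemma largestComponent_eq {i : Fin n} {s : Finset (Fin n)} (hs : s.Nonempty) :
    ∃ k ∈ s, largestComponent D δ₁ δ₂ i s = component D δ₁ δ₂ i k := by
  unfold largestComponent
  rcases h : argmaxOn s fun k => (component D δ₁ δ₂ i k).card with _ | m
  · exact absurd (argmaxOn_eq_none h) hs.ne_empty
  · exact ⟨m, (argmaxOn_eq_some h).1, rfl⟩

lemma largestComponent_empty {i : Fin n} : largestComponent D δ₁ δ₂ i ∅ = ∅ := by
  unfold largestComponent
  rcases h : argmaxOn ∅ fun k => (component D δ₁ δ₂ i k).card with _ | m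
  · rfl
  · exact absurd (argmaxOn_eq_some h).1 (by simp)

/-- If the largest kept component is on the left of `i`, then the second one is on the right; it
is missing only if `i` is close to the right end. -/
lemma Resolves.bisection_of_left (h : Resolves D δ₁ δ₂ δ₃ y ρ₁ ρ₂ ρ₃) {i k : Fin n}
    (hk : k ∈ keptVertices D δ₁ δ₂ δ₃ i) (hki : y k < y i)
    (hG : (bisection D δ₁ δ₂ δ₃ i).1 = component D δ₁ δ₂ i k) :
    IsLeftPart y ρ₂ i (bisection D δ₁ δ₂ δ₃ i).1 ∧
      (IsRightPart y ρ₂ i (bisection D δ₁ δ₂ δ₃ i).2 ∨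
        ((bisection D δ₁ δ₂ δ₃ i).2 = ∅ ∧ n ≤ y i + ρ₃)) := by
  have hL := h.isLeftPart_component hk hki
  refine ⟨hG ▸ hL, ?_⟩
  have hG2 : (bisection D δ₁ δ₂ δ₃ i).2 = largestComponent D δ₁ δ₂ i
      (keptVertices D δ₁ δ₂ δ₃ i \ component D δ₁ δ₂ i k) := by
    rw [← hG]; rfl
  rcases (keptVertices D δ₁ δ₂ δ₃ i \ component D δ₁ δ₂ i k).eq_empty_or_nonempty with he | hne
  · refine Or.inr ⟨by rw [hG2, he, largestComponent_empty], ?_⟩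
    by_contra! hlt
    obtain ⟨l, hl⟩ := exists_position y (a := n - 1) (by omega)
    have hlK : l ∈ keptVertices D δ₁ δ₂ δ₃ i :=
      h.mem_keptVertices_of_le (by unfold gap; omega)
    have hlG : l ∈ component D δ₁ δ₂ i k := by
      by_contra hnot
      exact Finset.notMem_empty l (he ▸ Finset.mem_sdiff.2 ⟨hlK, hnot⟩)
    have := hL.lt l hlG
    omega
  · left
    obtain ⟨l, hl, hlc⟩ := largestComponent_eq (D := D) (δ₁ := δ₁) (δ₂ := δ₂) (i := i) hne
    rw [hG2, hlc]
    obtain ⟨hlK, hlG⟩ := Finset.mem_sdiff.1 hl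
    refine h.isRightPart_component hlK ?_
    by_contra hnot
    have hli : y l < y i := lt_of_le_of_ne (not_lt.1 hnot)
      (fun e => (mem_keptVertices.1 hlK).1 (y.injective e))
    have hL' := h.isLeftPart_component hlK hli
    obtain ⟨z, hz⟩ := exists_position y (a := 0) (by have := (y i).isLt; omega)
    have h1 := hL.mem z (by have := hL.le; omega)
    have h2 := hL'.mem z (by have := hL.le; omega)
    simp only [component, mem_select] at h1 h2 hlG
    exact hlG (h1.trans h2.symm)

lemma Resolves.bisection_cases (h : Resolves D δ₁ δ₂ δ₃ y ρ₁ ρ₂ ρ₃) (i : Fin n) :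
    (IsLeftPart y ρ₂ i (bisection D δ₁ δ₂ δ₃ i).1 ∧
      (IsRightPart y ρ₂ i (bisection D δ₁ δ₂ δ₃ i).2 ∨
        ((bisection D δ₁ δ₂ δ₃ i).2 = ∅ ∧ n ≤ y i + ρ₃))) ∨
    (IsRightPart y ρ₂ i (bisection D δ₁ δ₂ δ₃ i).1 ∧
      (IsLeftPart y ρ₂ i (bisection D δ₁ δ₂ δ₃ i).2 ∨
        ((bisection D δ₁ δ₂ δ₃ i).2 = ∅ ∧ (y i : ℕ) < ρ₃))) := by
  have hsm := h.small
  have hne : (keptVertices D δ₁ δ₂ δ₃ i).Nonempty := by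
    obtain ⟨k, hk⟩ : ∃ k, ρ₃ ≤ gap y i k := by
      rcases le_total ρ₃ (y i) with hi | hi
      · obtain ⟨k, hk⟩ := exists_position y (a := 0) (by omega)
        exact ⟨k, by unfold gap; omega⟩
      · obtain ⟨k, hk⟩ := exists_position y (a := n - 1) (by omega)
        exact ⟨k, by unfold gap; omega⟩
    exact ⟨k, h.mem_keptVertices_of_le hk⟩
  obtain ⟨k, hk, hG⟩ := largestComponent_eq (D := D) (δ₁ := δ₁) (δ₂ := δ₂) (i := i) hne
  rcases lt_trichotomy (y k) (y i) with hlt | heq | hlt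
  · exact Or.inl (h.bisection_of_left hk hlt hG)
  · exact absurd (y.injective heq) (mem_keptVertices.1 hk).1
  · right
    have hlt' : reverseOrder y k < reverseOrder y i := by
      have := (y k).isLt
      rw [Fin.lt_def] at *
      simp only [reverseOrder_val]
      omega
    obtain ⟨h1, h2⟩ := h.reversed.bisection_of_left hk hlt' hG
    refine ⟨isLeftPart_reversed h1, h2.imp isRightPart_reversed fun h2 => ⟨h2.1, ?_⟩⟩
    have h3 := h2.2
    have := (y i).isLt
    simp only [reverseOrder_val] at h3
    omega

lemma IsLeftPart.le_card {i : Fin n} {G : Finset (Fin n)} {ρ : ℕ} (h : IsLeftPart y ρ i G) :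
    (y i : ℕ) - ρ ≤ G.card := by
  rw [← Nat.sub_zero ((y i : ℕ) - ρ), ← card_positions_Ico y (a := 0) (b := y i - ρ)
    (by have := (y i).isLt; omega)]
  refine Finset.card_le_card fun k hk => h.mem k ?_
  simp only [Finset.mem_filter, Finset.mem_univ, true_and] at hk
  omega

lemma IsLeftPart.card_le {i : Fin n} {G : Finset (Fin n)} {ρ : ℕ} (h : IsLeftPart y ρ i G) :
    G.card ≤ y i := by
  have := card_positions_Ico y (a := 0) (b := y i) (by have := (y i).isLt; omega)
  rw [Nat.sub_zero] at this
  rw [← this]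
  exact Finset.card_le_card fun k hk => by simpa using h.lt k hk

lemma IsRightPart.le_card {i : Fin n} {G : Finset (Fin n)} {ρ : ℕ} (h : IsRightPart y ρ i G) :
    n - (y i + 1) - ρ ≤ G.card := by
  simpa only [reverseOrder_val] using h.reversed.le_card

lemma IsRightPart.card_le {i : Fin n} {G : Finset (Fin n)} {ρ : ℕ} (h : IsRightPart y ρ i G) :
    G.card ≤ n - (y i + 1) := by
  simpa only [reverseOrder_val] using h.reversed.card_le

/-- Given a centre `c` with bisection oriented along `y`, all bisections get oriented along `y`. -/
lemma Resolves.orientation_of_center (h : Resolves D δ₁ δ₂ δ₃ y ρ₁ ρ₂ ρ₃) {c : Fin n}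
    (hc : argmaxOn Finset.univ (fun i => min (bisection D δ₁ δ₂ δ₃ i).1.card
      (bisection D δ₁ δ₂ δ₃ i).2.card) = some c)
    (hL : IsLeftPart y ρ₂ c (bisection D δ₁ δ₂ δ₃ c).1)
    (hR : IsRightPart y ρ₂ c (bisection D δ₁ δ₂ δ₃ c).2)
    (hc1 : ρ₂ + ρ₃ ≤ y c) (hc2 : (y c : ℕ) + ρ₃ < n) (i : Fin n) :
    (∀ k ∈ (orientation (bisection D δ₁ δ₂ δ₃) i).1, (y k : ℕ) < y i) ∧
    (∀ k ∈ (orientation (bisection D δ₁ δ₂ δ₃) i).2, (y i : ℕ) < y k) ∧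
    (∀ k, (y k : ℕ) + ρ₃ ≤ y i → k ∈ (orientation (bisection D δ₁ δ₂ δ₃) i).1) ∧
    (∀ k, (y i : ℕ) + ρ₃ ≤ y k → k ∈ (orientation (bisection D δ₁ δ₂ δ₃) i).2) := by
  have hmono := h.mono
  have hpos := h.pos
  have both : ∀ L R : Finset (Fin n), IsLeftPart y ρ₂ i L → IsRightPart y ρ₂ i R →
      (∀ k ∈ L, (y k : ℕ) < y i) ∧ (∀ k ∈ R, (y i : ℕ) < y k) ∧
      (∀ k, (y k : ℕ) + ρ₃ ≤ y i → k ∈ L) ∧ (∀ k, (y i : ℕ) + ρ₃ ≤ y k → k ∈ R) :=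
    fun L R h1 h2 => ⟨h1.lt, h2.lt, fun k hk => h1.mem k (by omega),
      fun k hk => h2.mem k (by omega)⟩
  have zero : ∃ z, (y z : ℕ) = 0 := exists_position y (by omega)
  have last : ∃ z, (y z : ℕ) = n - 1 := exists_position y (by omega)
  obtain ⟨z, hz⟩ := zero
  obtain ⟨t, ht⟩ := last
  simp only [orientation, hc]
  by_cases hic : i = c
  · subst hic
    rw [if_pos rfl]
    exact both _ _ hL hR
  rw [if_neg hic]
  have hneL : ∀ {G}, IsLeftPart y ρ₂ i G → G ≠ ∅ := fun hG =>
    Finset.ne_empty_of_mem (hG.mem z (by have := hG.le; omega))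
  have hneR : ∀ {G}, IsRightPart y ρ₂ i G → G ≠ ∅ := fun hG =>
    Finset.ne_empty_of_mem (hG.mem t (by have := hG.le; omega))
  rcases h.bisection_cases i with ⟨h1, h2 | ⟨h2, h3⟩⟩ | ⟨h1, h2 | ⟨h2, h3⟩⟩
  · rw [if_neg (hneR h2), if_neg]
    · exact both _ _ h1 h2
    · push Not
      refine ⟨⟨z, Finset.mem_inter.2 ⟨h1.mem z ?_, hL.mem z ?_⟩⟩,
        ⟨t, Finset.mem_inter.2 ⟨h2.mem t ?_, hR.mem t ?_⟩⟩⟩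
      · have := h1.le; omega
      · have := hL.le; omega
      · have := h2.le; omega
      · have := hR.le; omega
  -- A missing second part means that `i` is near an end; the left part of the centre tells which.
  · have hi : i ∉ (bisection D δ₁ δ₂ δ₃ c).1 := fun hi => by have := hL.lt i hi; omega
    rw [if_pos h2, if_neg hi]
    refine ⟨h1.lt, by simp, fun k hk => h1.mem k (by omega), fun k hk => ?_⟩
    have := (y k).isLt
    omega
  · rw [if_neg (hneL h2), if_pos]
    · exact both _ _ h2 h1
    · rcases le_total (y i : ℕ) (y c) with hle | hle
      · right
        refine Finset.eq_empty_of_forall_notMem fun k hk => ?_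
        have a := h2.lt k (Finset.mem_inter.1 hk).1
        have b := hR.lt k (Finset.mem_inter.1 hk).2
        omega
      · left
        refine Finset.eq_empty_of_forall_notMem fun k hk => ?_
        have a := h1.lt k (Finset.mem_inter.1 hk).1
        have b := hL.lt k (Finset.mem_inter.1 hk).2
        omega
  · have hi : i ∈ (bisection D δ₁ δ₂ δ₃ c).1 := hL.mem i (by omega)
    rw [if_pos h2, if_pos hi]
    refine ⟨by simp, h1.lt, fun k hk => ?_, fun k hk => h1.mem k (by omega)⟩
    omega

/-- The comparisons `H` are never wrong for the order `y`, and decide all pairs at distance at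
least `ρ`. -/
structure IsSound (H : Fin n → Fin n → ℤ) (y : Equiv.Perm (Fin n)) (ρ : ℕ) : Prop where
  sound : ∀ i j, H i j = 0 ∨ H i j = orderSign y i j
  complete : ∀ i j, ρ ≤ gap y i j → H i j = orderSign y i j
  undecided_symm : ∀ i j, H i j = 0 → H j i = 0

lemma Resolves.isSound_of_center (h : Resolves D δ₁ δ₂ δ₃ y ρ₁ ρ₂ ρ₃) {c : Fin n}
    (hc : argmaxOn Finset.univ (fun i => min (bisection D δ₁ δ₂ δ₃ i).1.card
      (bisection D δ₁ δ₂ δ₃ i).2.card) = some c)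
    (hL : IsLeftPart y ρ₂ c (bisection D δ₁ δ₂ δ₃ c).1)
    (hR : IsRightPart y ρ₂ c (bisection D δ₁ δ₂ δ₃ c).2)
    (hc1 : ρ₂ + ρ₃ ≤ y c) (hc2 : (y c : ℕ) + ρ₃ < n) :
    IsSound (aggregateBisections D δ₁ δ₂ δ₃) y ρ₃ := by
  have ho := h.orientation_of_center hc hL hR hc1 hc2
  have hpos := h.pos
  have hmono := h.mono
  have hsm := h.small
  set LR := orientation (bisection D δ₁ δ₂ δ₃) with hLR
  have hne : ∀ i, LR i ≠ (∅, ∅) := by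
    intro i hi
    obtain ⟨-, -, h3, h4⟩ := ho i
    rw [hi] at h3 h4
    rcases le_total ρ₃ (y i) with hle | hle
    · obtain ⟨z, hz⟩ := exists_position y (a := 0) (by omega)
      exact Finset.notMem_empty z (h3 z (by omega))
    · obtain ⟨t, ht⟩ := exists_position y (a := n - 1) (by omega)
      exact Finset.notMem_empty t (h4 t (by omega))
  have hval : ∀ i j, aggregateBisections D δ₁ δ₂ δ₃ i j =
      if i = j then 0 else if i ∈ (LR j).1 ∨ j ∈ (LR i).2 then -1
        else if i ∈ (LR j).2 ∨ j ∈ (LR i).1 then 1 else 0 := by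
    intro i j
    simp only [aggregateBisections, comparisons, ← hLR, hne, or_false]
  have hlt : ∀ i j, i ∈ (LR j).1 ∨ j ∈ (LR i).2 → y i < y j := by
    rintro i j (hij | hij)
    · exact (ho j).1 i hij
    · exact (ho i).2.1 j hij
  have hgt : ∀ i j, i ∈ (LR j).2 ∨ j ∈ (LR i).1 → y j < y i := by
    rintro i j (hij | hij)
    · exact (ho j).2.1 i hij
    · exact (ho i).1 j hij
  constructor
  · intro i j
    rw [hval]
    split_ifs with h1 h2 h3
    · exact Or.inl rfl
    · right; rw [orderSign, if_pos (hlt i j h2)]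
    · right; rw [orderSign, if_neg (not_lt.2 (hgt i j h3).le), if_pos (hgt i j h3)]
    · exact Or.inl rfl
  · intro i j hij
    have hne' : i ≠ j := by
      rintro rfl
      unfold gap at hij; omega
    rw [hval, if_neg hne']
    rcases lt_or_gt_of_ne (position_ne y hne') with hlt' | hlt'
    · have hmem : j ∈ (LR i).2 := (ho i).2.2.2 j (by unfold gap at hij; omega)
      rw [if_pos (Or.inr hmem), orderSign, if_pos (hlt i j (Or.inr hmem))]
    · have hmem : j ∈ (LR i).1 := (ho i).2.2.1 j (by unfold gap at hij; omega)
      have hg := hgt i j (Or.inr hmem)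
      rw [if_neg (fun hc => absurd (hlt i j hc) (not_lt.2 hg.le)), if_pos (Or.inr hmem), orderSign,
        if_neg (not_lt.2 hg.le), if_pos hg]
  · intro i j hij
    rw [hval] at hij ⊢
    by_cases h1 : i = j
    · rw [if_pos h1.symm]
    · rw [if_neg h1] at hij
      have h2 : ¬ (i ∈ (LR j).1 ∨ j ∈ (LR i).2) := fun h => by
        rw [if_pos h] at hij; exact absurd hij (by norm_num)
      have h3 : ¬ (i ∈ (LR j).2 ∨ j ∈ (LR i).1) := fun h => by
        rw [if_neg h2, if_pos h] at hij; exact absurd hij (by norm_num)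
      have h2' : ¬ (j ∈ (LR i).1 ∨ i ∈ (LR j).2) := fun h => h3 h.symm
      have h3' : ¬ (j ∈ (LR i).2 ∨ i ∈ (LR j).1) := fun h => h2 h.symm
      rw [if_neg (Ne.symm h1), if_neg h2', if_neg h3']

/-- The first seriation recovers the order up to reversal, except for pairs at distance less
than `ρ₃`, which it may leave undecided. -/
theorem Resolves.isSound (h : Resolves D δ₁ δ₂ δ₃ y ρ₁ ρ₂ ρ₃) :
    IsSound (aggregateBisections D δ₁ δ₂ δ₃) y ρ₃ ∨
      IsSound (aggregateBisections D δ₁ δ₂ δ₃) (reverseOrder y) ρ₃ := by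
  have hsm := h.small
  -- The middle index has two large parts, hence so has the maximising centre `c`, which is
  -- therefore far from both ends.
  obtain ⟨i₀, hi₀⟩ := exists_position y (a := n / 2) (by omega)
  have hmid : n / 2 - ρ₂ - 1 ≤
      min (bisection D δ₁ δ₂ δ₃ i₀).1.card (bisection D δ₁ δ₂ δ₃ i₀).2.card := by
    rcases h.bisection_cases i₀ with ⟨h1, h2 | ⟨h2, h3⟩⟩ | ⟨h1, h2 | ⟨h2, h3⟩⟩
    · have := h1.le_card; have := h2.le_card; omega
    · omega
    · have := h1.le_card; have := h2.le_card; omega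
    · omega
  rcases hc : argmaxOn Finset.univ (fun i => min (bisection D δ₁ δ₂ δ₃ i).1.card
      (bisection D δ₁ δ₂ δ₃ i).2.card) with _ | c
  · exact absurd (argmaxOn_eq_none hc) (Finset.ne_empty_of_mem (Finset.mem_univ i₀))
  have hcmid := hmid.trans ((argmaxOn_eq_some hc).2 i₀ (Finset.mem_univ _))
  have hcn := (y c).isLt
  rcases h.bisection_cases c with ⟨h1, h2 | ⟨h2, h3⟩⟩ | ⟨h1, h2 | ⟨h2, h3⟩⟩
  · have := h1.card_le; have := h2.card_le
    exact Or.inl (h.isSound_of_center hc h1 h2 (by omega) (by omega))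
  · rw [h2, Finset.card_empty, Nat.min_zero] at hcmid; omega
  · have := h1.card_le; have := h2.card_le
    exact Or.inr (h.reversed.isSound_of_center hc h1.reversed h2.reversed
      (by rw [reverseOrder_val]; omega) (by rw [reverseOrder_val]; omega))
  · rw [h2, Finset.card_empty, Nat.min_zero] at hcmid; omega

end Bisection

/-! ### Accuracy of the distance estimates -/

lemma maxOn_le {s : Finset (Fin n)} {f : Fin n → ℝ} {c : ℝ} (hc : 0 ≤ c)
    (h : ∀ k ∈ s, f k ≤ c) : maxOn s f ≤ c :=
  (Finset.fold_max_le c).2 ⟨hc, h⟩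

lemma le_maxOn {s : Finset (Fin n)} {f : Fin n → ℝ} {k : Fin n} (hk : k ∈ s) :
    f k ≤ maxOn s f :=
  (Finset.le_fold_max _).2 (Or.inr ⟨k, hk, le_rfl⟩)

lemma restrict_dotProduct (A : Fin n → Fin n → ℝ) {S : Finset (Fin n)} {i j : Fin n}
    (hi : i ∈ S) (hj : j ∈ S) :
    restrict A S i ⬝ᵥ restrict A S j = ∑ l ∈ S, A i l * A j l := by
  unfold dotProduct restrict
  rw [← Finset.sum_subset (Finset.subset_univ S)]
  · exact Finset.sum_congr rfl fun l hl => by rw [if_pos ⟨hi, hl⟩, if_pos ⟨hj, hl⟩]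
  · intro l _ hl
    rw [if_neg (fun h => hl h.2), zero_mul]

/-- Every window of `w` consecutive positions of the order `y` contains an element of `S`. -/
def MeetsWindows (y : Equiv.Perm (Fin n)) (S : Finset (Fin n)) (w : ℕ) : Prop :=
  ∀ a, a + w ≤ n → ∃ k ∈ S, a ≤ (y k : ℕ) ∧ (y k : ℕ) < a + w

lemma meetsWindows_univ (y : Equiv.Perm (Fin n)) : MeetsWindows y Finset.univ 1 := fun a ha => by
  obtain ⟨k, hk⟩ := exists_position y (a := a) (by omega)
  exact ⟨k, Finset.mem_univ k, by omega, by omega⟩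

lemma MeetsWindows.reverseOrder {y : Equiv.Perm (Fin n)} {S : Finset (Fin n)} {w : ℕ}
    (h : MeetsWindows y S w) : MeetsWindows (reverseOrder y) S w := fun a ha => by
  obtain ⟨k, hk, h1, h2⟩ := h (n - a - w) (by omega)
  have := (y k).isLt
  exact ⟨k, hk, by rw [reverseOrder_val]; omega, by rw [reverseOrder_val]; omega⟩

/-- A window of length `m * w` consists of `m` windows of length `w`. -/
lemma MeetsWindows.le_card {y : Equiv.Perm (Fin n)} {S : Finset (Fin n)} {w : ℕ}
    (h : MeetsWindows y S w) (a m : ℕ) (ham : a + m * w ≤ n) :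
    m ≤ (S.filter fun k => a ≤ (y k : ℕ) ∧ (y k : ℕ) < a + m * w).card := by
  induction m with
  | zero => simp
  | succ m ih =>
    have hsucc : (m + 1) * w = m * w + w := by ring
    obtain ⟨k, hk, h1, h2⟩ := h (a + m * w) (by omega)
    have hlt : (S.filter fun k => a ≤ (y k : ℕ) ∧ (y k : ℕ) < a + m * w).card <
        (S.filter fun k => a ≤ (y k : ℕ) ∧ (y k : ℕ) < a + (m + 1) * w).card := by
      refine Finset.card_lt_card ((Finset.ssubset_iff_of_subset fun l hl => ?_).2 ⟨k, ?_, ?_⟩)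
      · simp only [Finset.mem_filter] at hl ⊢
        exact ⟨hl.1, hl.2.1, by omega⟩
      · simp only [Finset.mem_filter]
        exact ⟨hk, by omega, by omega⟩
      · simp only [Finset.mem_filter]
        omega
    have := ih (by omega)
    omega

/-- Close to each index there are elements of `S` that avoid two given indices. -/
lemma MeetsWindows.exists_near {y : Equiv.Perm (Fin n)} {S : Finset (Fin n)} {w : ℕ}
    (h : MeetsWindows y S w) (hw : 3 * w ≤ n) (i m : Fin n) :
    ∃ k ∈ S, k ≠ i ∧ k ≠ m ∧ gap y i k ≤ 3 * w := by
  classical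
  have hi := (y i).isLt
  obtain ⟨a, ha1, ha2, ha3⟩ : ∃ a, a + 3 * w ≤ n ∧ a ≤ y i ∧ (y i : ℕ) ≤ a + 3 * w :=
    ⟨min (y i) (n - 3 * w), by omega, by omega, by omega⟩
  have hcard := h.le_card a 3 ha1
  have hpair : ({i, m} : Finset (Fin n)).card ≤ 2 := Finset.card_le_two
  obtain ⟨k, hk, hk'⟩ := Finset.exists_mem_notMem_of_card_lt_card
    (lt_of_le_of_lt hpair (lt_of_lt_of_le (by norm_num) hcard))
  simp only [Finset.mem_filter, Finset.mem_insert, Finset.mem_singleton, not_or] at hk hk'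
  exact ⟨k, hk.1, hk'.1, hk'.2, by unfold gap; omega⟩

lemma cast_gap (y : Equiv.Perm (Fin n)) (i j : Fin n) :
    (gap y i j : ℝ) = |((y i : ℕ) : ℝ) - ((y j : ℕ) : ℝ)| := by
  unfold gap
  rcases le_total (y i : ℕ) (y j) with h | h
  · rw [abs_sub_comm, abs_of_nonneg (sub_nonneg.2 (by exact_mod_cast h)), Nat.sub_eq_zero_of_le h,
      zero_add, Nat.cast_sub h]
  · rw [abs_of_nonneg (sub_nonneg.2 (by exact_mod_cast h)), Nat.sub_eq_zero_of_le h,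
      add_zero, Nat.cast_sub h]

section Signal

variable {α β : ℝ} {F : Matrix (Fin n) (Fin n) ℝ} {y : Equiv.Perm (Fin n)}

lemma IsBiLipschitz.abs_sub_le (hF : IsBiLipschitz α β F) (hβ : 0 ≤ β) (i j k : Fin n) :
    |F (y i) k - F (y j) k| ≤ β * (gap y i j / n) := by
  rw [cast_gap]
  rcases lt_trichotomy (y i) (y j) with h | h | h
  · exact hF.upper _ _ h k
  · rw [h, sub_self, abs_zero]; positivity
  · rw [abs_sub_comm, abs_sub_comm ((y i : ℕ) : ℝ)]
    exact hF.upper _ _ h k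

lemma IsBiLipschitz.abs_entry_le (hF : IsBiLipschitz α β F) (i j : Fin n) : |F i j| ≤ 1 := by
  obtain ⟨h1, h2⟩ := hF.mem_Icc i j
  rw [abs_of_nonneg h1]; exact h2

lemma IsBiLipschitz.abs_sub_le_one (hF : IsBiLipschitz α β F) (i j k l : Fin n) :
    |F i j - F k l| ≤ 1 := by
  obtain ⟨h1, h2⟩ := hF.mem_Icc i j
  obtain ⟨h3, h4⟩ := hF.mem_Icc k l
  rw [abs_le]; constructor <;> linarith

lemma abs_sum_mul_le {S : Finset (Fin n)} {u v : Fin n → ℝ} {c : ℝ} (hc : 0 ≤ c)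
    (hu : ∀ l, |u l| ≤ c / n) (hv : ∀ l, |v l| ≤ 1) : |∑ l ∈ S, u l * v l| ≤ c := by
  have hn : (0 : ℝ) ≤ n := Nat.cast_nonneg n
  calc |∑ l ∈ S, u l * v l| ≤ ∑ l ∈ S, |u l * v l| := Finset.abs_sum_le_sum_abs _ _
    _ ≤ ∑ _l ∈ S, c / n := Finset.sum_le_sum fun l _ => by
        rw [abs_mul]
        calc |u l| * |v l| ≤ c / n * 1 :=
              mul_le_mul (hu l) (hv l) (abs_nonneg _) (by positivity)
          _ = c / n := mul_one _
    _ = S.card * (c / n) := by rw [Finset.sum_const, nsmul_eq_mul]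
    _ ≤ n * (c / n) := by
        refine mul_le_mul_of_nonneg_right ?_ (by positivity)
        have := Finset.card_le_univ S
        rw [Fintype.card_fin] at this
        exact_mod_cast this
    _ ≤ c := by
        rcases hn.eq_or_lt with h | h
        · rw [← h]; simpa using hc
        · rw [mul_div_cancel₀ _ h.ne']

/-- The Gram matrix of the signal, restricted to the columns in `S`. -/
noncomputable def signalGram (F : Matrix (Fin n) (Fin n) ℝ) (y : Equiv.Perm (Fin n))
    (S : Finset (Fin n)) (i j : Fin n) : ℝ :=
  ∑ l ∈ S, F (y i) (y l) * F (y j) (y l)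

lemma signalGram_sub_le (hF : IsBiLipschitz α β F) (hβ : 0 ≤ β) (S : Finset (Fin n))
    (k i j : Fin n) : |signalGram F y S k i - signalGram F y S k j| ≤ β * gap y i j := by
  unfold signalGram
  rw [← Finset.sum_sub_distrib]
  have : ∀ l ∈ S, F (y k) (y l) * F (y i) (y l) - F (y k) (y l) * F (y j) (y l) =
      (F (y i) (y l) - F (y j) (y l)) * F (y k) (y l) := fun l _ => by ring
  rw [Finset.sum_congr rfl this]
  refine abs_sum_mul_le (by positivity) (fun l => ?_) (fun l => hF.abs_entry_le _ _)
  rw [mul_div_assoc]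
  exact hF.abs_sub_le hβ i j (y l)

/-- Replacing `i` by a nearby index `k` in the first argument changes `⟨F_i, F_i - F_m⟩` little; the
diagonal entry of the Gram matrix is thereby related to off-diagonal ones. -/
lemma signalGram_self_sub_le (hF : IsBiLipschitz α β F) (hβ : 0 ≤ β) (S : Finset (Fin n))
    (i m k : Fin n) : |(signalGram F y S i i - signalGram F y S i m) -
      (signalGram F y S k i - signalGram F y S k m)| ≤ β * gap y i k := by
  unfold signalGram
  rw [← Finset.sum_sub_distrib, ← Finset.sum_sub_distrib, ← Finset.sum_sub_distrib]
  have : ∀ l ∈ S, (F (y i) (y l) * F (y i) (y l) - F (y i) (y l) * F (y m) (y l)) -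
      (F (y k) (y l) * F (y i) (y l) - F (y k) (y l) * F (y m) (y l)) =
      (F (y i) (y l) - F (y k) (y l)) * (F (y i) (y l) - F (y m) (y l)) := fun l _ => by ring
  rw [Finset.sum_congr rfl this]
  refine abs_sum_mul_le (by positivity) (fun l => ?_) (fun l => hF.abs_sub_le_one _ _ _ _)
  rw [mul_div_assoc]
  exact hF.abs_sub_le hβ i k (y l)

/-- The squared distance of two signal rows, restricted to the columns in `S`. -/
lemma signalGram_dist (S : Finset (Fin n)) (i j : Fin n) :
    signalGram F y S i i + signalGram F y S j j - 2 * signalGram F y S i j =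
      ∑ l ∈ S, (F (y i) (y l) - F (y j) (y l)) ^ 2 := by
  unfold signalGram
  rw [Finset.mul_sum, ← Finset.sum_add_distrib, ← Finset.sum_sub_distrib]
  exact Finset.sum_congr rfl fun l _ => by ring

lemma signal_dist_le (hF : IsBiLipschitz α β F) (hβ : 0 ≤ β) (S : Finset (Fin n))
    (i j : Fin n) : n * ∑ l ∈ S, (F (y i) (y l) - F (y j) (y l)) ^ 2 ≤ (β * gap y i j) ^ 2 := by
  have hn : (0 : ℝ) ≤ n := Nat.cast_nonneg n
  rcases hn.eq_or_lt with h | h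
  · rw [← h, zero_mul]; positivity
  have hS : (S.card : ℝ) ≤ n := by
    have := Finset.card_le_univ S
    rw [Fintype.card_fin] at this
    exact_mod_cast this
  calc n * ∑ l ∈ S, (F (y i) (y l) - F (y j) (y l)) ^ 2
      ≤ n * ∑ _l ∈ S, (β * (gap y i j / n)) ^ 2 := by
        refine mul_le_mul_of_nonneg_left (Finset.sum_le_sum fun l _ => ?_) hn
        rw [← sq_abs]
        exact pow_le_pow_left₀ (abs_nonneg _) (hF.abs_sub_le hβ i j (y l)) 2
    _ = n * (S.card * (β * (gap y i j / n)) ^ 2) := by rw [Finset.sum_const, nsmul_eq_mul]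
    _ ≤ n * (n * (β * (gap y i j / n)) ^ 2) := by gcongr
    _ = (β * gap y i j) ^ 2 := by field_simp

/-- Two rows of the signal differ by at least half of `α * gap / n` in the columns left of both, in
those right of both, and in the columns slightly to the right of the smaller index. -/
lemma IsBiLipschitz.le_abs_sub (hF : IsBiLipschitz α β F) (hα : 0 < α)
    {i j l : Fin n} (hij : y i < y j)
    (hl : y l ≤ y i ∨ y j ≤ y l ∨ (y i ≤ y l ∧ y l < y j ∧
      (α + β) * ((y l : ℝ) - (y i : ℝ)) ≤ α / 2 * gap y i j)) :
    α / 2 * (gap y i j / n) ≤ |F (y i) (y l) - F (y j) (y l)| := by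
  have hn : (0 : ℝ) < n := by
    have := (y i).isLt
    exact_mod_cast (show 0 < n by omega)
  have hg : (0 : ℝ) ≤ gap y i j / n := by positivity
  have hgap : (gap y i j : ℝ) = (y j : ℝ) - (y i : ℝ) := by
    rw [cast_gap, abs_sub_comm, abs_of_nonneg]
    have : (y i : ℕ) ≤ y j := hij.le
    exact sub_nonneg.2 (by exact_mod_cast this)
  rcases hl with hl | hl | ⟨h1, h2, h3⟩
  · have := hF.lower_left _ _ hij _ hl
    rw [← cast_gap] at this
    refine le_trans ?_ (le_abs_self _)
    nlinarith
  · have := hF.lower_right _ _ hij _ hl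
    rw [← cast_gap] at this
    rw [abs_sub_comm]
    refine le_trans ?_ (le_abs_self _)
    nlinarith
  · have a := hF.lower_left _ _ h2 _ le_rfl
    have b : |F (y i) (y l) - F (y l) (y l)| ≤ β * (|((y i : ℕ) : ℝ) - ((y l : ℕ) : ℝ)| / n) := by
      rcases h1.lt_or_eq with h | h
      · exact hF.upper _ _ h _
      · rw [h]; simp
    have h1' : (y i : ℝ) ≤ (y l : ℝ) := by exact_mod_cast (show (y i : ℕ) ≤ y l from h1)
    have h2' : (y l : ℝ) ≤ (y j : ℝ) := by exact_mod_cast (show (y l : ℕ) ≤ y j from h2.le)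
    rw [abs_sub_comm ((y l : ℕ) : ℝ), abs_of_nonneg (sub_nonneg.2 h2')] at a
    rw [abs_sub_comm ((y i : ℕ) : ℝ), abs_of_nonneg (sub_nonneg.2 h1')] at b
    have b' := (abs_le.1 b).1
    refine le_trans ?_ (le_abs_self _)
    rw [hgap] at h3 ⊢
    have key : α / 2 * (((y j : ℝ) - (y i : ℝ)) / n) ≤
        α * (((y j : ℝ) - (y l : ℝ)) / n) - β * (((y l : ℝ) - (y i : ℝ)) / n) := by
      rw [← mul_div_assoc, ← mul_div_assoc, ← mul_div_assoc, ← sub_div]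
      refine div_le_div_of_nonneg_right ?_ hn.le
      nlinarith
    linarith

/-- The fraction of the positions, next to an index, in which its row is well separated from
distant rows. -/
noncomputable def nearFraction (α β : ℝ) : ℝ := α / (2 * (α + β))

lemma nearFraction_pos (hα : 0 < α) (hβ : 0 < β) : 0 < nearFraction α β := by
  unfold nearFraction; positivity

lemma nearFraction_le (hα : 0 < α) (hβ : 0 < β) : nearFraction α β ≤ 1 / 2 := by
  unfold nearFraction
  rw [div_le_div_iff₀ (by positivity) (by norm_num)]
  linarith

/-- The rows of `i` and `j` are separated on a window of `m * w` columns, of which at least `m`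
belong to `S`. -/
lemma signal_dist_ge_of_lt (hF : IsBiLipschitz α β F) (hα : 0 < α) (hβ : 0 < β)
    {S : Finset (Fin n)} {w : ℕ} (hS : MeetsWindows y S w) {m : ℕ}
    (hm : 2 * (m * w : ℝ) ≤ nearFraction α β * n) {i j : Fin n} (hij : y i < y j) :
    m * (α / 2 * (gap y i j / n)) ^ 2 ≤ ∑ l ∈ S, (F (y i) (y l) - F (y j) (y l)) ^ 2 := by
  have hij' : (y i : ℕ) < y j := hij
  have hjn := (y j).isLt
  have hq : 4 * (m * w) ≤ n := by
    have h1 := nearFraction_le hα hβ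
    have h2 : (0 : ℝ) ≤ n := Nat.cast_nonneg n
    have : (4 : ℝ) * (m * w) ≤ n := by nlinarith
    exact_mod_cast this
  have hgap : gap y i j = (y j : ℕ) - y i := by unfold gap; omega
  obtain ⟨a, ha, hsep⟩ : ∃ a, a + m * w ≤ n ∧ ∀ l : Fin n, a ≤ (y l : ℕ) → (y l : ℕ) < a + m * w →
      (y l ≤ y i ∨ y j ≤ y l ∨ (y i ≤ y l ∧ y l < y j ∧
        (α + β) * ((y l : ℝ) - (y i : ℝ)) ≤ α / 2 * gap y i j)) := by
    by_cases hd : 2 * gap y i j ≤ n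
    -- A gap of at most `n / 2` leaves room for the window on one side of both indices; for a larger
    -- gap the window starts at the smaller index.
    · by_cases hi : m * w ≤ y i + 1
      · exact ⟨0, by omega, fun l _ h2 => Or.inl (by rw [Fin.le_def]; omega)⟩
      · exact ⟨n - m * w, by omega, fun l h1 _ => Or.inr (Or.inl (by rw [Fin.le_def]; omega))⟩
    · refine ⟨y i, by omega, fun l h1 h2 => Or.inr (Or.inr ⟨h1, by rw [Fin.lt_def]; omega, ?_⟩)⟩
      have hl : (y l : ℝ) - (y i : ℝ) ≤ m * w := by
        have : (y l : ℕ) ≤ y i + m * w := by omega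
        have : ((y l : ℕ) : ℝ) ≤ (y i : ℕ) + m * w := by exact_mod_cast this
        linarith
      have hgn : (n : ℝ) ≤ 2 * gap y i j := by exact_mod_cast (by omega : n ≤ 2 * gap y i j)
      have hθ := nearFraction_pos hα hβ
      have hmw : (m * w : ℝ) ≤ nearFraction α β * gap y i j := by nlinarith
      calc (α + β) * ((y l : ℝ) - (y i : ℝ))
          ≤ (α + β) * (nearFraction α β * gap y i j) := by gcongr; exact hl.trans hmw
        _ = α / 2 * gap y i j := by unfold nearFraction; field_simp
  have hcard := hS.le_card a m ha
  calc m * (α / 2 * (gap y i j / n)) ^ 2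
      ≤ (S.filter fun k => a ≤ (y k : ℕ) ∧ (y k : ℕ) < a + m * w).card *
          (α / 2 * (gap y i j / n)) ^ 2 := by gcongr
    _ = ∑ _l ∈ S.filter fun k => a ≤ (y k : ℕ) ∧ (y k : ℕ) < a + m * w,
          (α / 2 * (gap y i j / n)) ^ 2 := by rw [Finset.sum_const, nsmul_eq_mul]
    _ ≤ ∑ l ∈ S.filter fun k => a ≤ (y k : ℕ) ∧ (y k : ℕ) < a + m * w,
          (F (y i) (y l) - F (y j) (y l)) ^ 2 := by
        refine Finset.sum_le_sum fun l hl => ?_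
        obtain ⟨-, h1, h2⟩ := Finset.mem_filter.1 hl
        rw [← sq_abs (F (y i) (y l) - _)]
        exact pow_le_pow_left₀ (by positivity) (hF.le_abs_sub hα hij (hsep l h1 h2)) 2
    _ ≤ _ := Finset.sum_le_sum_of_subset_of_nonneg (Finset.filter_subset _ _)
        fun l _ _ => sq_nonneg _

/-- The rate at which the distances of rows grow with the gaps, when all columns are used. -/
noncomputable def separationRate (α β : ℝ) : ℝ := α * √(nearFraction α β) / 4

lemma separationRate_pos (hα : 0 < α) (hβ : 0 < β) : 0 < separationRate α β := by
  have := Real.sqrt_pos.2 (nearFraction_pos hα hβ)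
  unfold separationRate; positivity

lemma signal_dist_ge (hF : IsBiLipschitz α β F) (hα : 0 < α) (hβ : 0 < β)
    {S : Finset (Fin n)} {w : ℕ} (hw : 1 ≤ w) (hS : MeetsWindows y S w)
    (hwn : 2 * (w : ℝ) ≤ nearFraction α β * n) (i j : Fin n) :
    (separationRate α β / √w * gap y i j) ^ 2 ≤
      n * ∑ l ∈ S, (F (y i) (y l) - F (y j) (y l)) ^ 2 := by
  have hθ := nearFraction_pos hα hβ
  have hn : (0 : ℝ) < n := by
    have := (y i).isLt
    exact_mod_cast (show 0 < n by omega)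
  have hw0 : (0 : ℝ) < w := by exact_mod_cast hw
  set x : ℝ := nearFraction α β * n / (2 * w) with hx
  have hx1 : 1 ≤ x := by rw [hx, le_div_iff₀ (by positivity)]; linarith
  have hm1 : (⌊x⌋₊ : ℝ) ≤ x := Nat.floor_le (by linarith)
  have hm2 : x / 2 ≤ ⌊x⌋₊ := by
    have h1 := Nat.lt_floor_add_one x
    have h2 : (1 : ℝ) ≤ ⌊x⌋₊ := by exact_mod_cast Nat.one_le_floor_iff x |>.2 hx1
    linarith
  have hm : 2 * ((⌊x⌋₊ : ℕ) * w : ℝ) ≤ nearFraction α β * n := by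
    have : x * (2 * w) = nearFraction α β * n := by rw [hx]; field_simp
    nlinarith
  have hfin : (separationRate α β / √w * gap y i j) ^ 2 ≤
      n * ((⌊x⌋₊ : ℕ) * (α / 2 * (gap y i j / n)) ^ 2) := by
    calc (separationRate α β / √w * gap y i j) ^ 2
        = n * (x / 2 * (α / 2 * (gap y i j / n)) ^ 2) := by
          rw [hx]; unfold separationRate
          rw [mul_pow, div_pow, div_pow, mul_pow, Real.sq_sqrt hθ.le, Real.sq_sqrt hw0.le]
          field_simp
          ring
      _ ≤ _ := by gcongr
  refine hfin.trans (mul_le_mul_of_nonneg_left ?_ hn.le)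
  rcases lt_trichotomy (y i) (y j) with h | h | h
  · exact signal_dist_ge_of_lt hF hα hβ hS hm h
  · have : gap y i j = 0 := by unfold gap; omega
    rw [this]
    simp only [Nat.cast_zero, zero_div, mul_zero]
    have : ∀ l ∈ S, 0 ≤ (F (y i) (y l) - F (y j) (y l)) ^ 2 := fun l _ => sq_nonneg _
    simpa using Finset.sum_nonneg this
  · have := signal_dist_ge_of_lt hF hα hβ hS hm h
    rw [gap_comm] at this
    refine this.trans (le_of_eq (Finset.sum_congr rfl fun l _ => by ring))

/-- The nearest-neighbour proxy estimates the squared norm of a signal row. -/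
lemma proxy_accuracy (hF : IsBiLipschitz α β F) (hβ : 0 ≤ β) {A : Fin n → Fin n → ℝ}
    {S : Finset (Fin n)} {w : ℕ} (hS : MeetsWindows y S w) (hw : 3 * w ≤ n) {η : ℝ} (hη : 0 ≤ η)
    (hA : ∀ i ∈ S, ∀ j ∈ S, i ≠ j →
      |∑ l ∈ S, A i l * A j l - signalGram F y S i j| ≤ η) {i : Fin n} (hi : i ∈ S) :
    |restrict A S i ⬝ᵥ restrict A S (proxy A S i) - signalGram F y S i i| ≤
      6 * w * β + 5 * η := by
  set m := proxy A S i with hm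
  have gapβ : ∀ k, gap y i k ≤ 3 * w → β * gap y i k ≤ 3 * w * β := fun k hk => by
    have : (gap y i k : ℝ) ≤ 3 * w := by exact_mod_cast hk
    nlinarith
  have hscore : ∀ k ∈ S, ∀ j ∈ S, k ≠ i → k ≠ j →
      |restrict A S k ⬝ᵥ (restrict A S i - restrict A S j) -
        (signalGram F y S k i - signalGram F y S k j)| ≤ 2 * η := by
    intro k hk j hj hki hkj
    rw [restrict_dotProduct_sub, restrict_dotProduct A hk hi, restrict_dotProduct A hk hj]
    have a := abs_le.1 (hA k hk i hi hki)
    have b := abs_le.1 (hA k hk j hj hkj)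
    rw [abs_le]; constructor <;> linarith [a.1, a.2, b.1, b.2]
  -- A neighbour `j₀` of `i` bounds the minimal score, which the minimiser `m` attains; the score of
  -- `m` is then tested against a neighbour `k` of `i`, which acts as a copy of `i`.
  obtain ⟨j₀, hj₀, hj₀i, -, hj₀g⟩ := hS.exists_near hw i i
  have hmin := argminOn_getD (s := S.erase i) ⟨j₀, Finset.mem_erase.2 ⟨hj₀i, hj₀⟩⟩
    (proxyScore A S i) i
  obtain ⟨hmS, hmle⟩ := hmin
  change m ∈ _ at hmS
  obtain ⟨hmi, hmS⟩ := Finset.mem_erase.1 hmS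
  have h1 : proxyScore A S i m ≤ 3 * w * β + 2 * η := by
    refine (hmle j₀ (Finset.mem_erase.2 ⟨hj₀i, hj₀⟩)).trans (maxOn_le (by positivity) ?_)
    intro k hk
    simp only [Finset.mem_erase] at hk
    have a := abs_le.1 (hscore k hk.2.2 j₀ hj₀ hk.2.1 hk.1)
    have b := abs_le.1 ((signalGram_sub_le hF hβ S k i j₀).trans (gapβ j₀ hj₀g))
    rw [abs_le]; constructor <;> linarith [a.1, a.2, b.1, b.2]
  obtain ⟨k, hk, hki, hkm, hkg⟩ := hS.exists_near hw i m
  have h2 := abs_le.1 ((le_maxOn (f := fun k =>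
    |restrict A S k ⬝ᵥ (restrict A S i - restrict A S m)|)
    (Finset.mem_erase.2 ⟨hkm, Finset.mem_erase.2 ⟨hki, hk⟩⟩)).trans h1)
  have h3 := abs_le.1 (hscore k hk m hmS hki hkm)
  have h4 := abs_le.1 ((signalGram_self_sub_le hF hβ S i m k).trans (gapβ k hkg))
  have h5 := abs_le.1 (hA i hi m hmS (Ne.symm hmi))
  rw [restrict_dotProduct A hi hmS]
  rw [abs_le]
  constructor <;> linarith [h2.1, h2.2, h3.1, h3.2, h4.1, h4.2, h5.1, h5.2]

/-- The distance estimates are of the order of the gaps, if the off-diagonal entries of the Gram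
matrix of the data are close to those of the signal. -/
theorem estimateDistance_bounds (hF : IsBiLipschitz α β F) (hα : 0 < α) (hβ : 0 < β)
    {A : Fin n → Fin n → ℝ} {S : Finset (Fin n)} {w : ℕ} (hw : 1 ≤ w)
    (hS : MeetsWindows y S w) (hwn : 3 * w ≤ n) (hwn' : 2 * (w : ℝ) ≤ nearFraction α β * n)
    {η ε : ℝ} (hη : 0 ≤ η) (hε : 0 ≤ ε)
    (hA : ∀ i ∈ S, ∀ j ∈ S, i ≠ j →
      |∑ l ∈ S, A i l * A j l - signalGram F y S i j| ≤ η)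
    (hηε : n * (12 * w * β + 12 * η) ≤ ε ^ 2) {i j : Fin n} (hi : i ∈ S) (hj : j ∈ S) :
    separationRate α β / √w * gap y i j - ε ≤ estimateDistance A S i j ∧
      estimateDistance A S i j ≤ β * gap y i j + ε := by
  unfold estimateDistance
  by_cases hij : i = j
  · subst hij
    have : gap y i i = 0 := by unfold gap; omega
    simp [this, hε]
  rw [if_pos ⟨hi, hj, hij⟩]
  have hn : (0 : ℝ) ≤ n := Nat.cast_nonneg n
  have h1 := abs_le.1 (proxy_accuracy hF hβ.le hS hwn hη hA hi)
  have h2 := abs_le.1 (proxy_accuracy hF hβ.le hS hwn hη hA hj)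
  have h3 := abs_le.1 (hA i hi j hj hij)
  rw [restrict_dotProduct A hi hj]
  set X := restrict A S i ⬝ᵥ restrict A S (proxy A S i) +
    restrict A S j ⬝ᵥ restrict A S (proxy A S j) - 2 * ∑ l ∈ S, A i l * A j l with hX
  have hd := signalGram_dist (F := F) (y := y) S i j
  set Y := ∑ l ∈ S, (F (y i) (y l) - F (y j) (y l)) ^ 2 with hY
  have hX1 : n * X ≤ n * Y + ε ^ 2 := by
    have : X ≤ Y + (12 * w * β + 12 * η) := by linarith [h1.2, h2.2, h3.1]
    nlinarith
  have hX2 : n * Y - ε ^ 2 ≤ n * X := by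
    have : Y - (12 * w * β + 12 * η) ≤ X := by linarith [h1.1, h2.1, h3.2]
    nlinarith
  have hlow := signal_dist_ge hF hα hβ hw hS hwn' i j
  have hup := signal_dist_le (y := y) hF hβ.le S i j
  rw [← hY] at hlow hup
  have hr : 0 ≤ separationRate α β / √w * gap y i j := by
    have := (separationRate_pos hα hβ).le
    positivity
  set g := separationRate α β / √w * gap y i j
  constructor
  · by_cases hge : g ≤ ε
    · exact (sub_nonpos.2 hge).trans (Real.sqrt_nonneg _)
    · push Not at hge
      refine Real.le_sqrt_of_sq_le ?_
      nlinarith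
  · have hg : 0 ≤ β * gap y i j := by positivity
    refine Real.sqrt_le_iff.2 ⟨by positivity, ?_⟩
    nlinarith

end Signal

/-! ### Refined seriation -/

/-- If the statistics `l`, `r` are within the threshold of signals `u ≥ 0 ≥ v`, the decision cannot
be `1`, and it is `0` only if both signals are small. -/
lemma decisionRule_of_nonneg {τ l r u v : ℝ} (hl : |l - u| < τ) (hr : |r - v| < τ)
    (hu : 0 ≤ u) (hv : v ≤ 0) :
    decisionRule τ l r = -1 ∨ (decisionRule τ l r = 0 ∧ u - v < 4 * τ) := by
  rw [abs_lt] at hl hr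
  have hτ : 0 < τ := by linarith
  unfold decisionRule
  split_ifs with h1 h2
  · left
    have : 0 < l := by
      rcases le_abs.1 h1 with h | h <;> linarith
    rw [sign_pos this]; rfl
  · left
    have : r < 0 := by
      rcases le_abs.1 h2 with h | h <;> linarith
    rw [sign_neg this]; rfl
  · right
    rw [not_le, abs_lt] at h1 h2
    exact ⟨rfl, by linarith⟩

lemma decisionRule_neg (τ l r : ℝ) : decisionRule τ (-l) (-r) = -decisionRule τ l r := by
  unfold decisionRule
  simp only [abs_neg, Left.sign_neg]
  split_ifs
  · simp
  · simp
  · simp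

lemma decisionRule_of_nonpos {τ l r u v : ℝ} (hl : |l - u| < τ) (hr : |r - v| < τ)
    (hu : u ≤ 0) (hv : 0 ≤ v) :
    decisionRule τ l r = 1 ∨ (decisionRule τ l r = 0 ∧ v - u < 4 * τ) := by
  have hl' : |-l - -u| < τ := by rwa [neg_sub_neg, abs_sub_comm]
  have hr' : |-r - -v| < τ := by rwa [neg_sub_neg, abs_sub_comm]
  have := decisionRule_of_nonneg hl' hr' (neg_nonneg.2 hu) (neg_nonpos.2 hv)
  rw [decisionRule_neg] at this
  refine this.imp (fun h => by omega) fun h => ⟨by omega, by linarith [h.2]⟩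

lemma mem_block {s : Fin n → Fin 3} {t : Fin 3} {k : Fin n} : k ∈ block s t ↔ s k = t :=
  mem_select _ _

lemma notMem_freeBlock (s : Fin n → Fin 3) (i j : Fin n) :
    i ∉ block s (freeBlock s i j) ∧ j ∉ block s (freeBlock s i j) := by
  rw [mem_block, mem_block]
  unfold freeBlock
  have h : ∀ a b : Fin 3, a ≠ (if a ≠ 0 ∧ b ≠ 0 then 0 else if a ≠ 1 ∧ b ≠ 1 then 1 else 2) ∧
      b ≠ (if a ≠ 0 ∧ b ≠ 0 then 0 else if a ≠ 1 ∧ b ≠ 1 then 1 else 2) := by decide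
  exact h (s i) (s j)

/-- The elements of `S` to the left of `i` that are far from `p` according to the estimates `D`. -/
noncomputable def farLeft (y : Equiv.Perm (Fin n)) (S : Finset (Fin n)) (D : Fin n → Fin n → ℝ)
    (δ : ℝ) (p i : Fin n) : Finset (Fin n) :=
  select fun k => k ∈ S ∧ y k < y i ∧ δ ≤ D p k

/-- The elements of `S` to the right of `i` that are far from `p` according to the estimates
`D`. -/
noncomputable def farRight (y : Equiv.Perm (Fin n)) (S : Finset (Fin n)) (D : Fin n → Fin n → ℝ)
    (δ : ℝ) (p i : Fin n) : Finset (Fin n) :=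
  select fun k => k ∈ S ∧ y i < y k ∧ δ ≤ D p k

lemma farLeft_reverseOrder (y : Equiv.Perm (Fin n)) (S : Finset (Fin n)) (D : Fin n → Fin n → ℝ)
    (δ : ℝ) (p i : Fin n) : farLeft (reverseOrder y) S D δ p i = farRight y S D δ p i := by
  ext k
  simp [farLeft, farRight, mem_select, reverseOrder]

lemma farRight_reverseOrder (y : Equiv.Perm (Fin n)) (S : Finset (Fin n)) (D : Fin n → Fin n → ℝ)
    (δ : ℝ) (p i : Fin n) : farRight (reverseOrder y) S D δ p i = farLeft y S D δ p i := by
  ext k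
  simp [farLeft, farRight, mem_select, reverseOrder]

/-- What the refined seriation needs: the anchors are close to the items; on each block, which has
roughly `n / 3` elements, the distance estimates resolve the order at the scale `δ`; and the noise
sums over the comparison sets are small. -/
structure RefinedSetting (D : Fin n → Fin n → ℝ) (A e : Fin n → Fin n → ℝ) (δ : ℝ)
    (s : Fin n → Fin 3) (y : Equiv.Perm (Fin n)) (ρ₁ ρ₃ ρ₅ : ℕ) : Prop where
  anchor_mem : ∀ i j, anchor D s i j ∈ block s (freeBlock s i j)
  anchor_near : ∀ i j, gap y i (anchor D s i j) ≤ ρ₁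
  far_of_le : ∀ t, ∀ p ∈ block s t, ∀ k ∈ block s t, δ ≤ estimateDistance A (block s t) p k →
    ρ₁ + 2 * ρ₃ ≤ gap y p k
  le_of_far : ∀ t, ∀ p ∈ block s t, ∀ k ∈ block s t, ρ₅ ≤ gap y p k →
    δ ≤ estimateDistance A (block s t) p k
  card_block : ∀ t, n ≤ 4 * ((block s t).card - 2 * ρ₅)
  noise_left : ∀ t, ∀ p ∈ block s t, ∀ i ∉ block s t,
    |∑ k ∈ farLeft y (block s t) (estimateDistance A (block s t)) δ p i, e i k| <
      5 / 2 * √(n * Real.log n)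
  noise_right : ∀ t, ∀ p ∈ block s t, ∀ i ∉ block s t,
    |∑ k ∈ farRight y (block s t) (estimateDistance A (block s t)) δ p i, e i k| <
      5 / 2 * √(n * Real.log n)

section Refined

variable {α β σ δ : ℝ} {F : Matrix (Fin n) (Fin n) ℝ} {y : Equiv.Perm (Fin n)}
  {A e D : Fin n → Fin n → ℝ} {s : Fin n → Fin 3} {H : Fin n → Fin n → ℤ} {ρ₁ ρ₃ ρ₅ : ℕ}

lemma orderSign_eq_one {i j : Fin n} : orderSign y i j = 1 ↔ y j < y i := by
  unfold orderSign
  split_ifs with h1 h2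
  · simp [not_lt.2 h1.le]
  · simp [h2]
  · simp [h2]

lemma orderSign_eq_neg_one {i j : Fin n} : orderSign y i j = -1 ↔ y i < y j := by
  unfold orderSign
  split_ifs with h1 h2
  · simp [h1]
  · simp [h1]
  · simp [h1]

/-- For an undecided pair the comparison sets depend on the noise only through the block: they are
the parts left and right of `i`, and also left and right of `j`, of the elements far from the
anchor. -/
lemma RefinedSetting.comparisonSet_eq (h : RefinedSetting D A e δ s y ρ₁ ρ₃ ρ₅)
    (hH : IsSound H y ρ₃) (hρ : 1 ≤ ρ₃) {i j : Fin n} (hij : H i j = 0) :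
    (comparisonSet H D A δ s 1 i j = farLeft y (block s (freeBlock s i j))
      (estimateDistance A (block s (freeBlock s i j))) δ (anchor D s i j) i ∧
    comparisonSet H D A δ s 1 i j = farLeft y (block s (freeBlock s i j))
      (estimateDistance A (block s (freeBlock s i j))) δ (anchor D s i j) j) ∧
    (comparisonSet H D A δ s (-1) i j = farRight y (block s (freeBlock s i j))
      (estimateDistance A (block s (freeBlock s i j))) δ (anchor D s i j) i ∧
    comparisonSet H D A δ s (-1) i j = farRight y (block s (freeBlock s i j))
      (estimateDistance A (block s (freeBlock s i j))) δ (anchor D s i j) j) := by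
  have hgap : gap y i j < ρ₃ := by
    by_contra! hge
    have h1 := hH.complete i j hge
    rw [hij] at h1
    unfold orderSign at h1
    unfold gap at hge
    simp only [Fin.lt_def] at h1
    split_ifs at h1 <;> omega
  have ha := h.anchor_near i j
  have key : ∀ k ∈ block s (freeBlock s i j),
      δ ≤ estimateDistance A (block s (freeBlock s i j)) (anchor D s i j) k →
      H i k = orderSign y i k ∧ H j k = orderSign y j k ∧ (y k < y i ↔ y k < y j) ∧
        (y i < y k ↔ y j < y k) := by
    intro k hk hd
    have hf := h.far_of_le _ _ (h.anchor_mem i j) k hk hd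
    refine ⟨hH.complete i k ?_, hH.complete j k ?_, ?_, ?_⟩
    · unfold gap at *; omega
    · unfold gap at *; omega
    · rw [Fin.lt_def, Fin.lt_def]; unfold gap at *; omega
    · rw [Fin.lt_def, Fin.lt_def]; unfold gap at *; omega
  refine ⟨⟨?_, ?_⟩, ⟨?_, ?_⟩⟩ <;>
  · ext k
    simp only [comparisonSet, farLeft, farRight, mem_select]
    refine and_congr_right fun hk => ?_
    constructor
    · rintro ⟨h1, h2, h3⟩
      obtain ⟨k1, k2, k3, k4⟩ := key k hk h3
      rw [k1] at h1
      rw [k2] at h2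
      first
      | exact ⟨orderSign_eq_one.1 h1, h3⟩
      | exact ⟨orderSign_eq_one.1 h2, h3⟩
      | exact ⟨orderSign_eq_neg_one.1 h1, h3⟩
      | exact ⟨orderSign_eq_neg_one.1 h2, h3⟩
    · rintro ⟨h1, h3⟩
      obtain ⟨k1, k2, k3, k4⟩ := key k hk h3
      rw [k1, k2]
      simp only [orderSign_eq_one, orderSign_eq_neg_one]
      tauto

lemma card_gap_lt (y : Equiv.Perm (Fin n)) (p : Fin n) (ρ : ℕ) :
    (Finset.univ.filter fun k => gap y p k < ρ).card ≤ 2 * ρ := by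
  have hp := (y p).isLt
  refine (Finset.card_le_card (t := Finset.univ.filter fun k =>
    y p + 1 - ρ ≤ (y k : ℕ) ∧ (y k : ℕ) < min (y p + ρ) n) fun k hk => ?_).trans ?_
  · simp only [Finset.mem_filter, Finset.mem_univ, true_and] at hk ⊢
    have := (y k).isLt
    unfold gap at hk
    omega
  · rw [card_positions_Ico y (by omega)]
    omega

lemma RefinedSetting.le_card (h : RefinedSetting D A e δ s y ρ₁ ρ₃ ρ₅) (hρ : 1 ≤ ρ₃)
    {t : Fin 3} {p i : Fin n} (hp : p ∈ block s t) (hip : gap y i p ≤ ρ₁) :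
    n ≤ 4 * ((farLeft y (block s t) (estimateDistance A (block s t)) δ p i).card +
      (farRight y (block s t) (estimateDistance A (block s t)) δ p i).card) := by
  classical
  have hsub : block s t ⊆ (farLeft y (block s t) (estimateDistance A (block s t)) δ p i ∪
      farRight y (block s t) (estimateDistance A (block s t)) δ p i) ∪
      Finset.univ.filter fun k => gap y p k < ρ₅ := by
    intro k hk
    simp only [Finset.mem_union, farLeft, farRight, mem_select, Finset.mem_filter,
      Finset.mem_univ, true_and]
    by_cases hg : gap y p k < ρ₅
    · exact Or.inr hg
    · left
      have hd := h.le_of_far t p hp k hk (not_lt.1 hg)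
      have hf := h.far_of_le t p hp k hk hd
      rcases lt_trichotomy (y k) (y i) with hlt | heq | hlt
      · exact Or.inl ⟨hk, hlt, hd⟩
      · rw [Fin.ext_iff] at heq
        unfold gap at *
        omega
      · exact Or.inr ⟨hk, hlt, hd⟩
  have h1 := (Finset.card_le_card hsub).trans (Finset.card_union_le _ _)
  have h2 := Finset.card_union_le
    (farLeft y (block s t) (estimateDistance A (block s t)) δ p i)
    (farRight y (block s t) (estimateDistance A (block s t)) δ p i)
  have h3 := card_gap_lt y p ρ₅
  have h4 := h.card_block t
  omega

/-- The values given to undecided pairs are never wrong, and a pair remains undecided only if it is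
close. -/
lemma RefinedSetting.reevaluate_correct (h : RefinedSetting D A e δ s y ρ₁ ρ₃ ρ₅)
    (hH : IsSound H y ρ₃) (hρ : 1 ≤ ρ₃) (hF : IsBiLipschitz α β F) (hα : 0 < α) (hσ : 0 < σ)
    (hA : ∀ i k, A i k = F (y i) (y k) + σ * e i k) {i j : Fin n} (hne : i ≠ j)
    (hij : H i j = 0) :
    reevaluate H D A σ δ s i j = orderSign y i j ∨ (reevaluate H D A σ δ s i j = 0 ∧
      (gap y i j : ℝ) ≤ 80 * (σ / α) * √(n * Real.log n)) := by
  obtain ⟨⟨hLi, hLj⟩, ⟨hRi, hRj⟩⟩ := h.comparisonSet_eq hH hρ hij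
  obtain ⟨hi, hj⟩ := notMem_freeBlock s i j
  have hp := h.anchor_mem i j
  set t := freeBlock s i j
  set p := anchor D s i j
  set L := comparisonSet H D A δ s 1 i j with hL
  set R := comparisonSet H D A δ s (-1) i j with hR
  have hn : (0 : ℝ) < n := by
    have := i.isLt
    exact_mod_cast (show 0 < n by omega)
  have noise : ∀ S : Finset (Fin n), |∑ k ∈ S, e i k| < 5 / 2 * √(n * Real.log n) →
      |∑ k ∈ S, e j k| < 5 / 2 * √(n * Real.log n) →
      |∑ k ∈ S, (A i k - A j k) - ∑ k ∈ S, (F (y i) (y k) - F (y j) (y k))| <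
        noiseThreshold n σ := by
    intro S h1 h2
    have : ∑ k ∈ S, (A i k - A j k) - ∑ k ∈ S, (F (y i) (y k) - F (y j) (y k)) =
        σ * (∑ k ∈ S, e i k - ∑ k ∈ S, e j k) := by
      rw [← Finset.sum_sub_distrib, ← Finset.sum_sub_distrib, Finset.mul_sum]
      exact Finset.sum_congr rfl fun k _ => by rw [hA, hA]; ring
    rw [this, abs_mul, abs_of_pos hσ]
    have h3 : |∑ k ∈ S, e i k - ∑ k ∈ S, e j k| < 5 * √(n * Real.log n) := by
      rw [abs_lt] at *
      constructor <;> linarith [h1.1, h1.2, h2.1, h2.2]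
    unfold noiseThreshold
    nlinarith
  have hnL := noise L (hLi ▸ h.noise_left t p hp i hi) (hLj ▸ h.noise_left t p hp j hj)
  have hnR := noise R (hRi ▸ h.noise_right t p hp i hi) (hRj ▸ h.noise_right t p hp j hj)
  have hcard : (n : ℝ) ≤ 4 * (L.card + R.card) := by
    have := h.le_card hρ hp (h.anchor_near i j)
    rw [← hLi, ← hRi] at this
    exact_mod_cast this
  have memL : ∀ k ∈ L, y k < y i ∧ y k < y j := fun k hk => by
    have h1 := hLi ▸ hk
    have h2 := hLj ▸ hk
    rw [farLeft, mem_select] at h1 h2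
    exact ⟨h1.2.1, h2.2.1⟩
  have memR : ∀ k ∈ R, y i < y k ∧ y j < y k := fun k hk => by
    have h1 := hRi ▸ hk
    have h2 := hRj ▸ hk
    rw [farRight, mem_select] at h1 h2
    exact ⟨h1.2.1, h2.2.1⟩
  set g : ℝ := α * (gap y i j / n) with hg
  have hg0 : 0 ≤ g := by positivity
  have bound : ∀ (S : Finset (Fin n)) (f : Fin n → ℝ), (∀ k ∈ S, g ≤ f k) →
      S.card * g ≤ ∑ k ∈ S, f k := fun S f hf => by
    rw [← nsmul_eq_mul]; exact Finset.card_nsmul_le_sum S f g hf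
  -- The constant is `80 = 4 * 4 * 5`: at least `n / 4` elements are compared, the signals sum to
  -- less than four thresholds, and a threshold is `5 * σ * √(n * log n)`.
  have final : (L.card : ℝ) * g + R.card * g < 4 * noiseThreshold n σ →
      (gap y i j : ℝ) ≤ 80 * (σ / α) * √(n * Real.log n) := by
    intro hlt
    have h1 : n * g ≤ 4 * (4 * noiseThreshold n σ) := by nlinarith
    have h2 : n * g = α * gap y i j := by rw [hg]; field_simp
    rw [h2] at h1
    unfold noiseThreshold at h1
    have h3 : 80 * (σ / α) * √(n * Real.log n) = (80 * σ * √(n * Real.log n)) / α := by ring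
    rw [h3, le_div_iff₀ hα]
    linarith
  have hre : reevaluate H D A σ δ s i j = decisionRule (noiseThreshold n σ)
      (∑ k ∈ L, (A i k - A j k)) (∑ k ∈ R, (A i k - A j k)) := rfl
  rw [hre]
  rcases lt_or_gt_of_ne (fun e => hne (y.injective e)) with hlt | hlt
  · have hu := bound L (fun k => F (y i) (y k) - F (y j) (y k)) fun k hk => by
      have := hF.lower_left _ _ hlt _ (memL k hk).1.le
      rwa [← cast_gap] at this
    have hv := bound R (fun k => F (y j) (y k) - F (y i) (y k)) fun k hk => by
      have := hF.lower_right _ _ hlt _ (memR k hk).2.le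
      rwa [← cast_gap] at this
    have hv' : ∑ k ∈ R, (F (y j) (y k) - F (y i) (y k)) =
        -∑ k ∈ R, (F (y i) (y k) - F (y j) (y k)) := by
      rw [← Finset.sum_neg_distrib]; exact Finset.sum_congr rfl fun k _ => by ring
    rw [hv'] at hv
    have hu0 : 0 ≤ (L.card : ℝ) * g := by positivity
    have hv0 : 0 ≤ (R.card : ℝ) * g := by positivity
    rw [orderSign_eq_neg_one.2 hlt]
    exact (decisionRule_of_nonneg hnL hnR (by linarith) (by linarith)).imp id
      fun ⟨h1, h2⟩ => ⟨h1, final (by linarith)⟩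
  · have hgapc := gap_comm y i j
    have hu := bound L (fun k => F (y j) (y k) - F (y i) (y k)) fun k hk => by
      have := hF.lower_left _ _ hlt _ (memL k hk).2.le
      rwa [← cast_gap, ← hgapc] at this
    have hv := bound R (fun k => F (y i) (y k) - F (y j) (y k)) fun k hk => by
      have := hF.lower_right _ _ hlt _ (memR k hk).1.le
      rwa [← cast_gap, ← hgapc] at this
    have hu' : ∑ k ∈ L, (F (y j) (y k) - F (y i) (y k)) =
        -∑ k ∈ L, (F (y i) (y k) - F (y j) (y k)) := by
      rw [← Finset.sum_neg_distrib]; exact Finset.sum_congr rfl fun k _ => by ring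
    rw [hu'] at hu
    have hu0 : 0 ≤ (L.card : ℝ) * g := by positivity
    have hv0 : 0 ≤ (R.card : ℝ) * g := by positivity
    rw [orderSign_eq_one.2 hlt]
    exact (decisionRule_of_nonpos hnL hnR (by linarith) (by linarith)).imp id
      fun ⟨h1, h2⟩ => ⟨h1, final (by linarith)⟩

lemma orderSign_swap (i j : Fin n) : orderSign y j i = -orderSign y i j := by
  unfold orderSign
  rcases lt_trichotomy (y i) (y j) with h | h | h
  · simp [h, not_lt.2 h.le]
  · simp [h]
  · simp [h, not_lt.2 h.le]

lemma RefinedSetting.reevaluateComparisons_correct (h : RefinedSetting D A e δ s y ρ₁ ρ₃ ρ₅)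
    (hH : IsSound H y ρ₃) (hρ : 1 ≤ ρ₃) (hF : IsBiLipschitz α β F) (hα : 0 < α) (hσ : 0 < σ)
    (hA : ∀ i k, A i k = F (y i) (y k) + σ * e i k) (i j : Fin n) :
    reevaluateComparisons H D A σ δ s i j = orderSign y i j ∨
      (i ≠ j ∧ reevaluateComparisons H D A σ δ s i j = 0 ∧
        (gap y i j : ℝ) ≤ 80 * (σ / α) * √(n * Real.log n)) := by
  unfold reevaluateComparisons
  rcases lt_trichotomy i j with hij | rfl | hij
  · by_cases h0 : H i j = 0
    · rw [if_pos ⟨hij, h0⟩, h0, zero_add]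
      exact (h.reevaluate_correct hH hρ hF hα hσ hA hij.ne h0).imp id fun h => ⟨hij.ne, h⟩
    · rw [if_neg (by tauto), if_neg (fun h => absurd hij (not_lt.2 h.1.le)), add_zero]
      exact Or.inl ((hH.sound i j).resolve_left h0)
  · rw [if_neg (fun h => lt_irrefl _ h.1), if_neg (fun h => lt_irrefl _ h.1), add_zero]
    have h0 : orderSign y i i = 0 := by simp [orderSign]
    rcases hH.sound i i with h1 | h1
    · exact Or.inl (h1.trans h0.symm)
    · exact Or.inl h1
  · rw [if_neg (fun h => absurd hij (not_lt.2 h.1.le))]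
    by_cases h0 : H j i = 0
    · rw [if_pos ⟨hij, h0⟩, hH.undecided_symm j i h0, zero_add, orderSign_swap, neg_inj, neg_eq_zero,
        gap_comm]
      exact (h.reevaluate_correct hH hρ hF hα hσ hA hij.ne h0).imp id fun h => ⟨hij.ne', h⟩
    · rw [if_neg (by tauto), add_zero]
      exact Or.inl ((hH.sound i j).resolve_left fun h => h0 (hH.undecided_symm i j h))

/-- The position is determined by the sum of the comparisons. -/
lemma sum_orderSign (y : Equiv.Perm (Fin n)) (i : Fin n) :
    ∑ j, orderSign y i j = 2 * (y i : ℕ) + 1 - n := by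
  have hi := (y i).isLt
  have h1 : ∀ j, orderSign y i j = (if 0 ≤ (y j : ℕ) ∧ (y j : ℕ) < y i then 1 else 0) -
      (if (y i : ℕ) + 1 ≤ y j ∧ (y j : ℕ) < n then 1 else 0) := by
    intro j
    have hj := (y j).isLt
    unfold orderSign
    simp only [Fin.lt_def]
    split_ifs <;> omega
  rw [Finset.sum_congr rfl fun j _ => h1 j, Finset.sum_sub_distrib, Finset.sum_boole,
    Finset.sum_boole, card_positions_Ico y hi.le, card_positions_Ico y le_rfl]
  omega

lemma card_gap_le (y : Equiv.Perm (Fin n)) (i : Fin n) {B : ℝ} (hB : 0 ≤ B) :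
    ((Finset.univ.filter fun j => i ≠ j ∧ (gap y i j : ℝ) ≤ B).card : ℝ) ≤ 2 * B := by
  classical
  have hi := (y i).isLt
  set b := ⌊B⌋₊
  have hsub : (Finset.univ.filter fun j => i ≠ j ∧ (gap y i j : ℝ) ≤ B) ⊆
      (Finset.univ.filter fun j => y i - b ≤ (y j : ℕ) ∧ (y j : ℕ) < y i) ∪
      Finset.univ.filter fun j => (y i : ℕ) + 1 ≤ y j ∧ (y j : ℕ) < min (y i + 1 + b) n := by
    intro j hj
    simp only [Finset.mem_filter, Finset.mem_univ, true_and, Finset.mem_union] at hj ⊢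
    have h1 := position_ne y hj.1
    have h2 : gap y i j ≤ b := Nat.le_floor hj.2
    have := (y j).isLt
    unfold gap at h2
    omega
  have hcard := (Finset.card_le_card hsub).trans (Finset.card_union_le _ _)
  rw [card_positions_Ico y hi.le, card_positions_Ico y (min_le_right _ _)] at hcard
  have hb : (b : ℝ) ≤ B := Nat.floor_le hB
  have : (Finset.univ.filter fun j => i ≠ j ∧ (gap y i j : ℝ) ≤ B).card ≤ 2 * b := by omega
  have : ((Finset.univ.filter fun j => i ≠ j ∧ (gap y i j : ℝ) ≤ B).card : ℝ) ≤ 2 * b := by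
    exact_mod_cast this
  linarith

/-- The refined positions are accurate. -/
lemma RefinedSetting.position_error_le (h : RefinedSetting D A e δ s y ρ₁ ρ₃ ρ₅)
    (hH : IsSound H y ρ₃) (hρ : 1 ≤ ρ₃) (hF : IsBiLipschitz α β F) (hα : 0 < α) (hσ : 0 < σ)
    (hA : ∀ i k, A i k = F (y i) (y k) + σ * e i k) (i : Fin n) :
    |(((∑ j, reevaluateComparisons H D A σ δ s i j : ℤ) : ℝ) + n + 1) / 2 - ((y i : ℕ) + 1 : ℝ)| ≤
      80 * (σ / α) * √(n * Real.log n) := by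
  set B := 80 * (σ / α) * √(n * Real.log n)
  have hB : 0 ≤ B := by positivity
  have hdiff : |∑ j, reevaluateComparisons H D A σ δ s i j - ∑ j, orderSign y i j| ≤
      ((Finset.univ.filter fun j => i ≠ j ∧ (gap y i j : ℝ) ≤ B).card : ℤ) := by
    rw [← Finset.sum_sub_distrib, ← Finset.sum_boole]
    refine (Finset.abs_sum_le_sum_abs _ _).trans (Finset.sum_le_sum fun j _ => ?_)
    rcases h.reevaluateComparisons_correct hH hρ hF hα hσ hA i j with h1 | ⟨h1, h2, h3⟩
    · rw [h1, sub_self, abs_zero]; split_ifs <;> norm_num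
    · rw [if_pos ⟨h1, h3⟩, h2, zero_sub, abs_neg]
      unfold orderSign
      split_ifs <;> norm_num
  rw [sum_orderSign] at hdiff
  have hcast : |((∑ j, reevaluateComparisons H D A σ δ s i j : ℤ) : ℝ) - (2 * (y i : ℕ) + 1 - n)| ≤
      ((Finset.univ.filter fun j => i ≠ j ∧ (gap y i j : ℝ) ≤ B).card : ℝ) := by
    exact_mod_cast hdiff
  have := abs_le.1 (hcast.trans (card_gap_le y i hB))
  rw [abs_le]
  constructor <;> linarith [this.1, this.2]

end Refined

lemma maxLoss_le (hn : 1 ≤ n) (p : Fin n → ℝ) (π : Equiv.Perm (Fin n)) {B : ℝ}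
    (h : (∀ i, |p i - ((π i : ℕ) + 1 : ℝ)| ≤ B) ∨
      ∀ i, |p i - ((reverseOrder π i : ℕ) + 1 : ℝ)| ≤ B) :
    maxLoss p π ≤ 1 / n * B := by
  have : Nonempty (Fin n) := ⟨⟨0, hn⟩⟩
  unfold maxLoss
  refine mul_le_mul_of_nonneg_left ?_ (by positivity)
  rcases h with h | h
  · exact (min_le_left _ _).trans (ciSup_le fun i => h i)
  · refine (min_le_right _ _).trans (ciSup_le fun i => ?_)
    have hi := (π i).isLt
    have h1 := h i
    rw [reverseOrder_val, Nat.cast_sub (by omega)] at h1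
    unfold position
    push_cast at h1
    have h2 : (n : ℝ) + 1 - (((π i : ℕ) : ℝ) + 1) = n - (((π i : ℕ) : ℝ) + 1) + 1 := by ring
    rwa [h2]

/-! ### Tail bounds for row sums of the noise -/

section Tail

variable {Ω : Type*} [MeasurableSpace Ω] {μ : Measure Ω}

lemma hasSubgaussianMGF_mono {X : Ω → ℝ} {c d : NNReal} (h : HasSubgaussianMGF X c μ)
    (hcd : c ≤ d) : HasSubgaussianMGF X d μ where
  integrable_exp_mul := h.integrable_exp_mul
  mgf_le t := (h.mgf_le t).trans (Real.exp_le_exp.2 (by gcongr))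

lemma measure_le_abs_of_subgaussian [IsProbabilityMeasure μ] {X : Ω → ℝ} {c : NNReal}
    (h : HasSubgaussianMGF X c μ) {t : ℝ} (ht : 0 ≤ t) :
    μ {ω | t ≤ |X ω|} ≤ ENNReal.ofReal (2 * Real.exp (-t ^ 2 / (2 * c))) := by
  have hsub : {ω | t ≤ |X ω|} ⊆ {ω | t ≤ X ω} ∪ {ω | t ≤ (-X) ω} := fun ω hω => by
    simpa [le_abs] using hω
  refine (measure_mono hsub).trans ((measure_union_le _ _).trans ?_)
  rw [two_mul, ENNReal.ofReal_add (Real.exp_nonneg _) (Real.exp_nonneg _)]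
  refine add_le_add ?_ ?_
  · rw [← ofReal_measureReal]
    exact ENNReal.ofReal_le_ofReal (h.measure_ge_le ht)
  · rw [← ofReal_measureReal]
    exact ENNReal.ofReal_le_ofReal (h.neg.measure_ge_le ht)

/-- If a bound holds conditionally on each value of an independent random variable, then it holds
unconditionally. -/
lemma measure_le_of_indepFun [IsProbabilityMeasure μ] {𝒳 𝒴 : Type*} [MeasurableSpace 𝒳]
    [MeasurableSpace 𝒴] {X : Ω → 𝒳} {Y : Ω → 𝒴} (hX : Measurable X) (hY : Measurable Y)
    (hXY : IndepFun Y X μ) {B : Set (𝒴 × 𝒳)} (hB : MeasurableSet B) {p : ENNReal}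
    (h : ∀ b, μ {ω | (b, X ω) ∈ B} ≤ p) : μ {ω | (Y ω, X ω) ∈ B} ≤ p := by
  have h1 : μ {ω | (Y ω, X ω) ∈ B} = μ.map (fun ω => (Y ω, X ω)) B :=
    (Measure.map_apply (hY.prodMk hX) hB).symm
  have : IsProbabilityMeasure (μ.map Y) := Measure.isProbabilityMeasure_map hY.aemeasurable
  have : IsProbabilityMeasure (μ.map X) := Measure.isProbabilityMeasure_map hX.aemeasurable
  rw [h1, hXY.map_prod_eq_prod_map_map hY.aemeasurable hX.aemeasurable, Measure.prod_apply hB]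
  calc ∫⁻ b, (μ.map X) (Prod.mk b ⁻¹' B) ∂(μ.map Y) ≤ ∫⁻ _, p ∂(μ.map Y) := by
        refine lintegral_mono fun b => ?_
        rw [Measure.map_apply hX (measurable_prodMk_left hB)]
        exact h b
    _ = p := by simp

lemma measure_exists_le {ι : Type*} [Fintype ι] {P : ι → Ω → Prop} {p : ENNReal}
    (h : ∀ x, μ {ω | P x ω} ≤ p) : μ {ω | ∃ x, P x ω} ≤ Fintype.card ι * p := by
  have : {ω | ∃ x, P x ω} = ⋃ x, {ω | P x ω} := by ext ω; simp
  rw [this]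
  refine (measure_iUnion_fintype_le μ _).trans ((Finset.sum_le_sum fun x _ => h x).trans ?_)
  rw [Finset.sum_const, Finset.card_univ, nsmul_eq_mul]

variable {E : Fin n → Fin n → Ω → ℝ}

/-- The ordered pair formed by two indices. -/
def upperPair (p q : Fin n) : {p : Fin n × Fin n // p.1 ≤ p.2} :=
  ⟨(min p q, max p q), min_le_max⟩

lemma IsNoise.upperPair_eq (hE : IsNoise μ E) (p q : Fin n) :
    E (upperPair p q).1.1 (upperPair p q).1.2 = E p q := by
  unfold upperPair
  rcases le_total p q with h | h
  · simp [h]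
  · funext ω
    simp only [min_eq_right h, max_eq_left h]
    exact hE.symm q p ω

lemma upperPair_eq_iff {p q p' q' : Fin n} :
    upperPair p q = upperPair p' q' ↔ (p = p' ∧ q = q') ∨ (p = q' ∧ q = p') := by
  unfold upperPair
  simp only [Subtype.mk.injEq, Prod.mk.injEq]
  constructor
  · rintro ⟨h1, h2⟩
    rcases le_total p q with h | h <;> rcases le_total p' q' with h' | h' <;>
      simp_all
  · rintro (⟨rfl, rfl⟩ | ⟨rfl, rfl⟩)
    · simp
    · exact ⟨min_comm _ _, max_comm _ _⟩

lemma IsNoise.subGaussian_entry (hE : IsNoise μ E) (i j : Fin n) :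
    HasSubgaussianMGF (E i j) 1 μ := by
  rw [← hE.upperPair_eq]
  exact hE.subGaussian _ _ (upperPair i j).2

lemma IsNoise.iIndepFun_row (hE : IsNoise μ E) (i : Fin n) : iIndepFun (fun k => E i k) μ := by
  have h := hE.indep.precomp (g := fun k => upperPair i k) (fun k l hkl => by
    rcases upperPair_eq_iff.1 hkl with h | h
    · exact h.2
    · rw [h.2, ← h.1])
  simpa only [hE.upperPair_eq] using h

lemma IsNoise.row_sum_tail [IsProbabilityMeasure μ] (hE : IsNoise μ E) (i : Fin n)
    (K : Finset (Fin n)) (a : Fin n → ℝ) {V t : ℝ} (hV : ∑ k ∈ K, a k ^ 2 ≤ V) (ht : 0 ≤ t) :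
    μ {ω | t ≤ |∑ k ∈ K, a k * E i k ω|} ≤
      ENNReal.ofReal (2 * Real.exp (-t ^ 2 / (2 * V))) := by
  have hind : iIndepFun (fun k ω => a k * E i k ω) μ :=
    (hE.iIndepFun_row i).comp (fun k x => a k * x) fun k => measurable_const.mul measurable_id
  have hV0 : 0 ≤ V := (Finset.sum_nonneg fun k _ => sq_nonneg (a k)).trans hV
  have hterm : ∀ k, HasSubgaussianMGF (fun ω => a k * E i k ω) (a k ^ 2).toNNReal μ := fun k => by
    have h := (hE.subGaussian_entry i k).const_mul (a k)
    exact hasSubgaussianMGF_mono h (le_of_eq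
      ((mul_one _).trans (Real.toNNReal_of_nonneg (sq_nonneg (a k))).symm))
  have hsum := HasSubgaussianMGF.sum_of_iIndepFun hind (s := K) fun k _ => hterm k
  have hmono := hasSubgaussianMGF_mono hsum (d := V.toNNReal) (by
    rw [← Real.toNNReal_sum_of_nonneg fun k _ => sq_nonneg (a k)]
    exact Real.toNNReal_le_toNNReal hV)
  have key := measure_le_abs_of_subgaussian hmono ht
  rwa [Real.coe_toNNReal V hV0] at key

/-- The noise matrix in which the entries `(i, k)` and `(k, i)`, for `k ∈ K`, are erased. -/
def eraseRow (i : Fin n) (K : Finset (Fin n)) (e : Fin n → Fin n → ℝ) (p q : Fin n) : ℝ :=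
  if (p = i ∧ q ∈ K) ∨ (q = i ∧ p ∈ K) then 0 else e p q

lemma eraseRow_of_ne {i p q : Fin n} (K : Finset (Fin n)) (e : Fin n → Fin n → ℝ)
    (hp : p ≠ i) (hq : q ≠ i) : eraseRow i K e p q = e p q := by
  unfold eraseRow
  rw [if_neg (by tauto)]

lemma measurable_eraseRow (i : Fin n) (K : Finset (Fin n)) : Measurable (eraseRow i K) := by
  refine measurable_pi_iff.2 fun p => measurable_pi_iff.2 fun q => ?_
  unfold eraseRow
  split_ifs
  · exact measurable_const
  · fun_prop

/-- The entries of row `i` in the columns `K` are independent of all other entries, where by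
symmetry column `i` has to be erased as well. -/
lemma IsNoise.indepFun_row_eraseRow (hE : IsNoise μ E) (i : Fin n) (K : Finset (Fin n)) :
    IndepFun (fun ω => eraseRow i K fun p q => E p q ω)
      (fun ω k => if k ∈ K then E i k ω else 0) μ := by
  classical
  let T : Finset {p : Fin n × Fin n // p.1 ≤ p.2} := K.image (upperPair i)
  have h := hE.indep.indepFun_finset Tᶜ T disjoint_compl_left fun p => hE.measurable _ _
  have hT : ∀ p q, upperPair p q ∈ T ↔ (p = i ∧ q ∈ K) ∨ (q = i ∧ p ∈ K) := by
    intro p q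
    simp only [T, Finset.mem_image, upperPair_eq_iff]
    constructor
    · rintro ⟨k, hk, ⟨rfl, rfl⟩ | ⟨rfl, rfl⟩⟩ <;> tauto
    · rintro (⟨rfl, hq⟩ | ⟨rfl, hp⟩)
      · exact ⟨q, hq, Or.inl ⟨rfl, rfl⟩⟩
      · exact ⟨p, hp, Or.inr ⟨rfl, rfl⟩⟩
  let ψ : (↥(Tᶜ) → ℝ) → Fin n → Fin n → ℝ := fun v p q =>
    if hpq : upperPair p q ∈ Tᶜ then v ⟨upperPair p q, hpq⟩ else 0
  let φ : (↥T → ℝ) → Fin n → ℝ := fun v k =>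
    if hk : upperPair i k ∈ T then v ⟨upperPair i k, hk⟩ else 0
  have hψ : Measurable ψ := by
    refine measurable_pi_iff.2 fun p => measurable_pi_iff.2 fun q => ?_
    simp only [ψ]
    split_ifs
    · exact measurable_pi_apply _
    · exact measurable_const
  have hφ : Measurable φ := by
    refine measurable_pi_iff.2 fun k => ?_
    simp only [φ]
    split_ifs
    · exact measurable_pi_apply _
    · exact measurable_const
  have h' := h.comp hψ hφ
  convert h' using 1
  · funext ω p q
    simp only [ψ, Function.comp_apply, eraseRow, Finset.mem_compl, hT]
    split_ifs with h1
    · rfl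
    · rw [hE.upperPair_eq]
  · funext ω k
    simp only [φ, Function.comp_apply, hT]
    by_cases hk : k ∈ K
    · rw [if_pos hk, dif_pos (Or.inl ⟨trivial, hk⟩), hE.upperPair_eq]
    · rw [if_neg hk, dif_neg (by rintro (h | ⟨rfl, h⟩) <;> tauto)]

/-- Tail bound for a weighted sum of entries of row `i` whose weights depend on the other entries
of the noise. -/
lemma IsNoise.weighted_row_sum_tail [IsProbabilityMeasure μ] (hE : IsNoise μ E) (i : Fin n)
    (K : Finset (Fin n)) {a : (Fin n → Fin n → ℝ) → Fin n → ℝ}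
    (ha : ∀ k, Measurable fun e => a e k) {V t : ℝ} (hV : ∀ e, ∑ k ∈ K, a e k ^ 2 ≤ V)
    (ht : 0 ≤ t) :
    μ {ω | t ≤ |∑ k ∈ K, a (eraseRow i K fun p q => E p q ω) k * E i k ω|} ≤
      ENNReal.ofReal (2 * Real.exp (-t ^ 2 / (2 * V))) := by
  have hEm : Measurable fun ω p q => E p q ω :=
    measurable_pi_iff.2 fun p => measurable_pi_iff.2 fun q => hE.measurable p q
  have hX : Measurable fun ω k => if k ∈ K then E i k ω else 0 := by
    refine measurable_pi_iff.2 fun k => ?_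
    split_ifs
    · exact hE.measurable i k
    · exact measurable_const
  have hB : MeasurableSet {z : (Fin n → Fin n → ℝ) × (Fin n → ℝ) |
      t ≤ |∑ k ∈ K, a z.1 k * z.2 k|} := by
    refine measurableSet_le measurable_const (Measurable.abs ?_)
    refine Finset.measurable_sum _ fun k _ => ?_
    exact ((ha k).comp measurable_fst).mul ((measurable_pi_apply k).comp measurable_snd)
  have hsum : ∀ (b : Fin n → ℝ) ω, ∑ k ∈ K, b k * (if k ∈ K then E i k ω else 0) =
      ∑ k ∈ K, b k * E i k ω := fun b ω =>
    Finset.sum_congr rfl fun k hk => by rw [if_pos hk]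
  have key := measure_le_of_indepFun hX ((measurable_eraseRow i K).comp hEm)
    (hE.indepFun_row_eraseRow i K) hB
    (p := ENNReal.ofReal (2 * Real.exp (-t ^ 2 / (2 * V)))) (fun e => by
      simp only [Set.mem_ofPred_eq, hsum]
      exact hE.row_sum_tail i K (a e) (hV e) ht)
  simpa only [Set.mem_ofPred_eq, hsum, Function.comp_apply] using key

end Tail

/-! ### Measurability of the distance estimates -/

section Measurability

variable {𝒳 : Type*} [MeasurableSpace 𝒳]

lemma measurableSet_argmin_eq {f : 𝒳 → Fin n → ℝ} (hf : ∀ k, Measurable fun x => f x k)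
    (l : List (Fin n)) : ∀ o : Option (Fin n), MeasurableSet {x | l.argmin (f x) = o} := by
  induction l using List.reverseRecOn with
  | nil => intro o; simp only [List.argmin_nil]; exact MeasurableSet.const _
  | append_singleton l a ih =>
    intro o
    have : {x | (l ++ [a]).argmin (f x) = o} = ⋃ o', ({x | l.argmin (f x) = o'} ∩
        {x | (Option.casesOn o' (some a) fun c => if f x a < f x c then some a else some c :
          Option (Fin n)) = o}) := by
      ext x
      simp only [Set.mem_ofPred_eq, Set.mem_iUnion, Set.mem_inter_iff, List.argmin_concat]
      constructor
      · intro h; exact ⟨_, rfl, h⟩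
      · rintro ⟨o', rfl, h⟩; exact h
    rw [this]
    refine MeasurableSet.iUnion fun o' => (ih o').inter ?_
    rcases o' with _ | c
    · exact MeasurableSet.const (some a = o)
    · have hlt : MeasurableSet {x | f x a < f x c} := measurableSet_lt (hf a) (hf c)
      have : {x | (if f x a < f x c then some a else some c) = o} =
          ({x | f x a < f x c} ∩ {_x | some a = o}) ∪ ({x | f x a < f x c}ᶜ ∩ {_x | some c = o}) := by
        ext x
        by_cases h : f x a < f x c <;> simp [h]
      change MeasurableSet {x | (if f x a < f x c then some a else some c) = o}
      rw [this]
      exact (hlt.inter (MeasurableSet.const _)).union (hlt.compl.inter (MeasurableSet.const _))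

lemma measurable_apply_of_finite {p : 𝒳 → Fin n} (hp : ∀ m, MeasurableSet {x | p x = m})
    {g : Fin n → 𝒳 → ℝ} (hg : ∀ m, Measurable (g m)) : Measurable fun x => g (p x) x := by
  intro s hs
  have : (fun x => g (p x) x) ⁻¹' s = ⋃ m, ({x | p x = m} ∩ g m ⁻¹' s) := by
    ext x; simp
  rw [this]
  exact MeasurableSet.iUnion fun m => (hp m).inter (hg m hs)

lemma measurable_maxOn {f : 𝒳 → Fin n → ℝ} (hf : ∀ k, Measurable fun x => f x k)
    (s : Finset (Fin n)) : Measurable fun x => maxOn s (f x) := by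
  classical
  unfold maxOn
  induction s using Finset.induction_on with
  | empty => simp only [Finset.fold_empty]; exact measurable_const
  | insert a s ha ih =>
    simp only [Finset.fold_insert ha]
    exact (hf a).max ih

lemma measurable_estimateDistance {A : 𝒳 → Fin n → Fin n → ℝ}
    (hA : ∀ i j, Measurable fun x => A x i j) (S : Finset (Fin n)) (i j : Fin n) :
    Measurable fun x => estimateDistance (A x) S i j := by
  have hr : ∀ i j, Measurable fun x => restrict (A x) S i j := fun i j => by
    unfold restrict
    split_ifs
    · exact hA i j
    · exact measurable_const
  have hdot : ∀ i j, Measurable fun x => restrict (A x) S i ⬝ᵥ restrict (A x) S j := fun i j => by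
    unfold dotProduct
    exact Finset.measurable_sum _ fun k _ => (hr i k).mul (hr j k)
  have hscore : ∀ i j, Measurable fun x => proxyScore (A x) S i j := fun i j => by
    unfold proxyScore
    refine measurable_maxOn (fun k => Measurable.abs ?_) _
    simp only [restrict_dotProduct_sub]
    exact (hdot k i).sub (hdot k j)
  have hproxy : ∀ i m, MeasurableSet {x | proxy (A x) S i = m} := fun i m => by
    have : {x | proxy (A x) S i = m} = ⋃ o : Option (Fin n),
        ({x | argminOn (S.erase i) (proxyScore (A x) S i) = o} ∩ {_x | o.getD i = m}) := by
      ext x; simp [proxy]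
    rw [this]
    exact MeasurableSet.iUnion fun o =>
      (measurableSet_argmin_eq (fun k => hscore i k) _ o).inter (MeasurableSet.const _)
  have hd : ∀ i, Measurable fun x => restrict (A x) S i ⬝ᵥ restrict (A x) S (proxy (A x) S i) :=
    fun i => measurable_apply_of_finite (g := fun m x =>
      restrict (A x) S i ⬝ᵥ restrict (A x) S m) (hproxy i) fun m => hdot i m
  unfold estimateDistance
  split_ifs
  · exact (measurable_const.mul (((hd i).add (hd j)).sub
      (measurable_const.mul (hdot i j)))).sqrt
  · exact measurable_const

end Measurability

/-- The distance estimates on `S` depend only on the entries in `S × S`. -/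
lemma estimateDistance_congr {A A' : Fin n → Fin n → ℝ} {S : Finset (Fin n)}
    (h : ∀ i ∈ S, ∀ j ∈ S, A i j = A' i j) : estimateDistance A S = estimateDistance A' S := by
  have hr : restrict A S = restrict A' S := by
    funext i j
    unfold restrict
    split_ifs with hij
    · exact h i hij.1 j hij.2
    · rfl
  unfold estimateDistance proxy proxyScore
  rw [hr]

/-! ### The event on which the noise is small -/

/-- The sets of columns used by the algorithm: all columns, and the three blocks. -/
noncomputable def columnSet (s : Fin n → Fin 3) : Option (Fin 3) → Finset (Fin n)
  | none => Finset.univ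
  | some t => block s t

/-- The truncation of `x` to zero outside `[-M, M]`. -/
noncomputable def truncated (M x : ℝ) : ℝ := if |x| ≤ M then x else 0

/-- The data matrix for the noise matrix `e`. -/
def dataMatrix (F : Matrix (Fin n) (Fin n) ℝ) (y : Equiv.Perm (Fin n)) (σ : ℝ)
    (e : Fin n → Fin n → ℝ) (i j : Fin n) : ℝ :=
  F (y i) (y j) + σ * e i j

/-- The distance estimates on block `t`. -/
noncomputable def blockDistance (F : Matrix (Fin n) (Fin n) ℝ) (y : Equiv.Perm (Fin n)) (σ : ℝ)
    (s : Fin n → Fin 3) (e : Fin n → Fin n → ℝ) (t : Fin 3) : Fin n → Fin n → ℝ :=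
  estimateDistance (dataMatrix F y σ e) (block s t)

/-- The noise matrix `e` is small in all the sums that matter: single entries, correlations with
rows of the signal, correlations of two different noise rows (of which one is truncated so that
its size is under control for any noise), and sums of the entries of a row over those elements of a
block that are on one side of the row and far from an anchor in the block. -/
structure GoodNoise (F : Matrix (Fin n) (Fin n) ℝ) (y : Equiv.Perm (Fin n)) (σ δ : ℝ)
    (s : Fin n → Fin 3) (e : Fin n → Fin n → ℝ) : Prop where
  entry : ∀ x : Fin n × Fin n, |e x.1 x.2| < 4 * √(Real.log n)
  linear : ∀ x : Option (Fin 3) × Fin n × Fin n,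
    |∑ k ∈ columnSet s x.1, F (y x.2.1) (y k) * e x.2.2 k| < 4 * √(n * Real.log n)
  bilinear : ∀ x : Option (Fin 3) × Fin n × Fin n, x.2.1 ≠ x.2.2 →
    |∑ k ∈ (columnSet s x.1).filter fun k => k ≠ x.2.1 ∧ k ≠ x.2.2,
      truncated (4 * √(Real.log n)) (e x.2.2 k) * e x.2.1 k| < 16 * √n * Real.log n
  left : ∀ x : Fin 3 × Fin n × Fin n, x.2.1 ∈ block s x.1 → x.2.2 ∉ block s x.1 →
    |∑ k ∈ farLeft y (block s x.1) (blockDistance F y σ s e x.1) δ x.2.1 x.2.2, e x.2.2 k| <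
      5 / 2 * √(n * Real.log n)
  right : ∀ x : Fin 3 × Fin n × Fin n, x.2.1 ∈ block s x.1 → x.2.2 ∉ block s x.1 →
    |∑ k ∈ farRight y (block s x.1) (blockDistance F y σ s e x.1) δ x.2.1 x.2.2, e x.2.2 k| <
      5 / 2 * √(n * Real.log n)

/-- Reversing the order and the signal gives the same data, and exchanges left and right. -/
lemma GoodNoise.reverseOrder {F : Matrix (Fin n) (Fin n) ℝ} {y : Equiv.Perm (Fin n)} {σ δ : ℝ}
    {s : Fin n → Fin 3} {e : Fin n → Fin n → ℝ} (h : GoodNoise F y σ δ s e) :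
    GoodNoise (F.submatrix Fin.rev Fin.rev) (reverseOrder y) σ δ s e := by
  have hF : ∀ i j, F.submatrix Fin.rev Fin.rev (Seriation.reverseOrder y i)
      (Seriation.reverseOrder y j) = F (y i) (y j) := fun i j => by
    simp [Seriation.reverseOrder, Matrix.submatrix_apply]
  have hd : blockDistance (F.submatrix Fin.rev Fin.rev) (Seriation.reverseOrder y) σ s e =
      blockDistance F y σ s e := by
    unfold blockDistance dataMatrix; simp only [hF]
  refine ⟨h.entry, ?_, h.bilinear, ?_, ?_⟩
  · simp only [hF]; exact h.linear
  · simp only [hd, farLeft_reverseOrder]; exact h.right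
  · simp only [hd, farRight_reverseOrder]; exact h.left

section Measurable

variable {F : Matrix (Fin n) (Fin n) ℝ} {y : Equiv.Perm (Fin n)} {σ δ : ℝ} {s : Fin n → Fin 3}

lemma measurable_entry (i j : Fin n) : Measurable fun e : Fin n → Fin n → ℝ => e i j :=
  (measurable_pi_apply j).comp (measurable_pi_apply i)

lemma measurable_truncated (M : ℝ) : Measurable (truncated M) := by
  unfold truncated
  exact Measurable.ite (measurableSet_le measurable_id.abs measurable_const) measurable_id
    measurable_const

open Classical in
/-- Indicator of a set of indices. -/
noncomputable def indicatorOf (T : Finset (Fin n)) (k : Fin n) : ℝ := if k ∈ T then 1 else 0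

lemma sum_indicatorOf_mul {S T : Finset (Fin n)} (hT : T ⊆ S) (f : Fin n → ℝ) :
    ∑ k ∈ S, indicatorOf T k * f k = ∑ k ∈ T, f k := by
  classical
  unfold indicatorOf
  simp only [ite_mul, one_mul, zero_mul]
  rw [← Finset.sum_filter, Finset.filter_mem_eq_inter, Finset.inter_eq_right.2 hT]

lemma sum_indicatorOf_sq_le (S T : Finset (Fin n)) :
    ∑ k ∈ S, indicatorOf T k ^ 2 ≤ S.card := by
  calc ∑ k ∈ S, indicatorOf T k ^ 2 ≤ ∑ _k ∈ S, (1 : ℝ) := Finset.sum_le_sum fun k _ => by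
        unfold indicatorOf; split_ifs <;> norm_num
    _ = S.card := by simp

lemma farLeft_subset (S : Finset (Fin n)) (D : Fin n → Fin n → ℝ) (p i : Fin n) :
    farLeft y S D δ p i ⊆ S := fun k hk => ((mem_select _ k).1 hk).1

lemma farRight_subset (S : Finset (Fin n)) (D : Fin n → Fin n → ℝ) (p i : Fin n) :
    farRight y S D δ p i ⊆ S := fun k hk => ((mem_select _ k).1 hk).1

lemma measurable_blockDistance (t : Fin 3) (p k : Fin n) :
    Measurable fun e => blockDistance F y σ s e t p k :=
  measurable_estimateDistance (fun i j => measurable_const.add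
    (measurable_const.mul (measurable_entry i j))) _ p k

lemma measurable_indicatorOf_farLeft (t : Fin 3) (p i k : Fin n) : Measurable fun e =>
    indicatorOf (farLeft y (block s t) (blockDistance F y σ s e t) δ p i) k := by
  classical
  unfold indicatorOf
  refine Measurable.ite ?_ measurable_const measurable_const
  simp only [farLeft, mem_select]
  exact (MeasurableSet.const _).inter ((MeasurableSet.const _).inter
    (measurableSet_le measurable_const (measurable_blockDistance t p k)))

lemma measurable_indicatorOf_farRight (t : Fin 3) (p i k : Fin n) : Measurable fun e =>
    indicatorOf (farRight y (block s t) (blockDistance F y σ s e t) δ p i) k := by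
  classical
  unfold indicatorOf
  refine Measurable.ite ?_ measurable_const measurable_const
  simp only [farRight, mem_select]
  exact (MeasurableSet.const _).inter ((MeasurableSet.const _).inter
    (measurableSet_le measurable_const (measurable_blockDistance t p k)))

lemma measurableSet_goodNoise : MeasurableSet {e | GoodNoise F y σ δ s e} := by
  have hset : {e | GoodNoise F y σ δ s e} =
      {e | (∀ x : Fin n × Fin n, |e x.1 x.2| < 4 * √(Real.log n)) ∧
      (∀ x : Option (Fin 3) × Fin n × Fin n,
        |∑ k ∈ columnSet s x.1, F (y x.2.1) (y k) * e x.2.2 k| < 4 * √(n * Real.log n)) ∧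
      (∀ x : Option (Fin 3) × Fin n × Fin n, x.2.1 ≠ x.2.2 →
        |∑ k ∈ (columnSet s x.1).filter fun k => k ≠ x.2.1 ∧ k ≠ x.2.2,
          truncated (4 * √(Real.log n)) (e x.2.2 k) * e x.2.1 k| < 16 * √n * Real.log n) ∧
      (∀ x : Fin 3 × Fin n × Fin n, x.2.1 ∈ block s x.1 → x.2.2 ∉ block s x.1 →
        |∑ k ∈ block s x.1, indicatorOf (farLeft y (block s x.1)
          (blockDistance F y σ s e x.1) δ x.2.1 x.2.2) k * e x.2.2 k| <
          5 / 2 * √(n * Real.log n)) ∧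
      (∀ x : Fin 3 × Fin n × Fin n, x.2.1 ∈ block s x.1 → x.2.2 ∉ block s x.1 →
        |∑ k ∈ block s x.1, indicatorOf (farRight y (block s x.1)
          (blockDistance F y σ s e x.1) δ x.2.1 x.2.2) k * e x.2.2 k| <
          5 / 2 * √(n * Real.log n))} := by
    ext e
    simp only [Set.mem_ofPred_eq, sum_indicatorOf_mul (farLeft_subset _ _ _ _),
      sum_indicatorOf_mul (farRight_subset _ _ _ _)]
    exact ⟨fun h => ⟨h.1, h.2, h.3, h.4, h.5⟩, fun h => ⟨h.1, h.2.1, h.2.2.1, h.2.2.2.1, h.2.2.2.2⟩⟩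
  rw [hset]
  have imp : ∀ {P : Prop} {Q : (Fin n → Fin n → ℝ) → Prop}, MeasurableSet {e | Q e} →
      MeasurableSet {e | P → Q e} := by
    intro P Q hQ
    by_cases hP : P
    · simpa [hP] using hQ
    · simp [hP]
  have all : ∀ {ι : Type} [Finite ι] {Q : ι → (Fin n → Fin n → ℝ) → Prop},
      (∀ x, MeasurableSet {e | Q x e}) → MeasurableSet {e | ∀ x, Q x e} := by
    intro ι _ Q hQ
    have : {e | ∀ x, Q x e} = ⋂ x, {e | Q x e} := by ext e; simp
    rw [this]
    exact MeasurableSet.iInter hQ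
  refine (all fun x => ?_).inter ((all fun x => ?_).inter ((all fun x => imp ?_).inter
    ((all fun x => imp (imp ?_)).inter (all fun x => imp (imp ?_)))))
  · exact measurableSet_lt (measurable_entry _ _).abs measurable_const
  · exact measurableSet_lt (Finset.measurable_sum _ fun k _ =>
      measurable_const.mul (measurable_entry _ _)).abs measurable_const
  · exact measurableSet_lt (Finset.measurable_sum _ fun k _ =>
      ((measurable_truncated _).comp (measurable_entry _ _)).mul (measurable_entry _ _)).abs
      measurable_const
  · exact measurableSet_lt (Finset.measurable_sum _ fun k _ =>
      (measurable_indicatorOf_farLeft _ _ _ _).mul (measurable_entry _ _)).abs measurable_const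
  · exact measurableSet_lt (Finset.measurable_sum _ fun k _ =>
      (measurable_indicatorOf_farRight _ _ _ _).mul (measurable_entry _ _)).abs measurable_const

end Measurable

/-- The distance estimates on a block do not involve the rows outside the block. -/
lemma blockDistance_eraseRow {F : Matrix (Fin n) (Fin n) ℝ} {y : Equiv.Perm (Fin n)} {σ : ℝ}
    {s : Fin n → Fin 3} {t : Fin 3} {i : Fin n} (hi : i ∉ block s t) (K : Finset (Fin n))
    (e : Fin n → Fin n → ℝ) :
    blockDistance F y σ s (eraseRow i K e) t = blockDistance F y σ s e t :=
  estimateDistance_congr fun p hp q hq => by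
    unfold dataMatrix
    rw [eraseRow_of_ne K e (p := p) (q := q) (by rintro rfl; exact hi hp)
      (by rintro rfl; exact hi hq)]

section Probability

variable {Ω : Type*} [MeasurableSpace Ω] {μ : Measure Ω} [IsProbabilityMeasure μ]
  {E : Fin n → Fin n → Ω → ℝ} {F : Matrix (Fin n) (Fin n) ℝ} {y : Equiv.Perm (Fin n)} {σ δ α β : ℝ}
  {s : Fin n → Fin 3}

/-- The sub-Gaussian bound at the level `√(12 * V * log n)`. The exponent `6` leaves `n ^ (-4)`
after a union bound over the roughly `n ^ 2` sums that are considered. -/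
lemma tail_le (hn : 1 ≤ n) {V t : ℝ} (hV : 0 < V) (h : 6 * Real.log n * (2 * V) ≤ t ^ 2) :
    ENNReal.ofReal (2 * Real.exp (-t ^ 2 / (2 * V))) ≤ ENNReal.ofReal (2 / (n : ℝ) ^ 6) := by
  have hn0 : (0 : ℝ) < n := by exact_mod_cast hn
  refine ENNReal.ofReal_le_ofReal ?_
  rw [div_eq_mul_inv 2 ((n : ℝ) ^ 6)]
  refine mul_le_mul_of_nonneg_left ?_ (by norm_num)
  have h1 : ((n : ℝ) ^ 6)⁻¹ = Real.exp (-(6 * Real.log n)) := by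
    rw [Real.exp_neg, mul_comm, Real.exp_mul, Real.exp_log hn0]
    norm_cast
  rw [h1, Real.exp_le_exp, div_le_iff₀ (by positivity)]
  linarith

/-- The noise is good with high probability. -/
lemma IsNoise.measure_not_goodNoise_le (hE : IsNoise μ E) (hF : IsBiLipschitz α β F)
    (hn : 2 ≤ n) (hs : ∀ t, 2 * (block s t).card ≤ n) :
    μ {ω | ¬ GoodNoise F y σ δ s fun i j => E i j ω} ≤ ENNReal.ofReal (30 / (n : ℝ) ^ 4) := by
  classical
  have hn0 : (0 : ℝ) < n := by exact_mod_cast (show 0 < n by omega)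
  have hL : 0 < Real.log n := Real.log_pos (by exact_mod_cast (show 1 < n by omega))
  set p := ENNReal.ofReal (2 / (n : ℝ) ^ 6) with hp
  have hcard : ∀ T, ((columnSet s T).card : ℝ) ≤ n := fun T => by
    have := Finset.card_le_univ (columnSet s T)
    rw [Fintype.card_fin] at this
    exact_mod_cast this
  have h1 : μ {ω | ∃ x : Fin n × Fin n, 4 * √(Real.log n) ≤ |E x.1 x.2 ω|} ≤
      Fintype.card (Fin n × Fin n) * p := by
    refine measure_exists_le fun x => ?_
    have := hE.row_sum_tail x.1 {x.2} (fun _ => 1) (V := 1) (t := 4 * √(Real.log n)) (by simp)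
      (by positivity)
    simp only [Finset.sum_singleton, one_mul] at this
    refine this.trans (tail_le (by omega) one_pos ?_)
    rw [mul_pow, Real.sq_sqrt hL.le]
    linarith
  have h2 : μ {ω | ∃ x : Option (Fin 3) × Fin n × Fin n, 4 * √(n * Real.log n) ≤
      |∑ k ∈ columnSet s x.1, F (y x.2.1) (y k) * E x.2.2 k ω|} ≤
      Fintype.card (Option (Fin 3) × Fin n × Fin n) * p := by
    refine measure_exists_le fun x => ?_
    refine (hE.row_sum_tail x.2.2 (columnSet s x.1) (fun k => F (y x.2.1) (y k)) (V := n) ?_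
      (by positivity)).trans (tail_le (by omega) hn0 ?_)
    · calc ∑ k ∈ columnSet s x.1, F (y x.2.1) (y k) ^ 2 ≤ ∑ _k ∈ columnSet s x.1, (1 : ℝ) :=
            Finset.sum_le_sum fun k _ => (sq_le_one_iff_abs_le_one _).2 (hF.abs_entry_le _ _)
        _ = (columnSet s x.1).card := by simp
        _ ≤ n := hcard _
    · rw [mul_pow, Real.sq_sqrt (by positivity)]
      nlinarith [mul_pos hn0 hL]
  have h3 : μ {ω | ∃ x : Option (Fin 3) × Fin n × Fin n, x.2.1 ≠ x.2.2 ∧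
      16 * √n * Real.log n ≤ |∑ k ∈ (columnSet s x.1).filter fun k => k ≠ x.2.1 ∧ k ≠ x.2.2,
        truncated (4 * √(Real.log n)) (E x.2.2 k ω) * E x.2.1 k ω|} ≤
      Fintype.card (Option (Fin 3) × Fin n × Fin n) * p := by
    refine measure_exists_le fun x => ?_
    obtain ⟨T, i, j⟩ := x
    by_cases hij : i = j
    · simp [hij]
    simp only [ne_eq, hij, not_false_eq_true, true_and]
    set K := (columnSet s T).filter fun k => ¬ k = i ∧ ¬ k = j with hK
    have htail := hE.weighted_row_sum_tail i K
      (a := fun e k => truncated (4 * √(Real.log n)) (e j k)) (V := n * (16 * Real.log n))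
      (t := 16 * √n * Real.log n)
      (fun k => (measurable_truncated _).comp (measurable_entry j k)) (fun e => by
        calc ∑ k ∈ K, truncated (4 * √(Real.log n)) (e j k) ^ 2
            ≤ ∑ _k ∈ K, 16 * Real.log n := Finset.sum_le_sum fun k _ => by
              unfold truncated
              split_ifs with h
              · rw [← sq_abs]
                calc |e j k| ^ 2 ≤ (4 * √(Real.log n)) ^ 2 := pow_le_pow_left₀ (abs_nonneg _) h 2
                  _ = 16 * Real.log n := by rw [mul_pow, Real.sq_sqrt hL.le]; norm_num
              · rw [zero_pow two_ne_zero]; positivity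
          _ = K.card * (16 * Real.log n) := by rw [Finset.sum_const, nsmul_eq_mul]
          _ ≤ n * (16 * Real.log n) := by
              refine mul_le_mul_of_nonneg_right ?_ (by positivity)
              exact (Nat.cast_le.2 (Finset.card_filter_le _ _)).trans (hcard T)) (by positivity)
    have heq : ∀ ω, ∑ k ∈ K, truncated (4 * √(Real.log n))
        (eraseRow i K (fun p q => E p q ω) j k) * E i k ω =
        ∑ k ∈ K, truncated (4 * √(Real.log n)) (E j k ω) * E i k ω := fun ω =>
      Finset.sum_congr rfl fun k hk => by
        rw [eraseRow_of_ne K _ (Ne.symm hij) (Finset.mem_filter.1 hk).2.1]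
    simp only [heq] at htail
    refine htail.trans (tail_le (by omega) (by positivity) ?_)
    rw [mul_pow, mul_pow, Real.sq_sqrt hn0.le]
    nlinarith [mul_pos hn0 (mul_pos hL hL)]
  have hV : ∀ t, ((block s t).card : ℝ) ≤ n / 2 := fun t => by
    have : (2 * (block s t).card : ℝ) ≤ n := by exact_mod_cast hs t
    linarith
  have hside : 6 * Real.log n * (2 * (n / 2)) ≤ (5 / 2 * √(n * Real.log n)) ^ 2 := by
    rw [mul_pow, Real.sq_sqrt (by positivity)]
    nlinarith [mul_pos hn0 hL]
  have h4 : μ {ω | ∃ x : Fin 3 × Fin n × Fin n, (x.2.1 ∈ block s x.1 ∧ x.2.2 ∉ block s x.1) ∧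
      5 / 2 * √(n * Real.log n) ≤ |∑ k ∈ farLeft y (block s x.1)
        (blockDistance F y σ s (fun i j => E i j ω) x.1) δ x.2.1 x.2.2, E x.2.2 k ω|} ≤
      Fintype.card (Fin 3 × Fin n × Fin n) * p := by
    refine measure_exists_le fun x => ?_
    obtain ⟨t, q, i⟩ := x
    by_cases hi : i ∈ block s t
    · simp [hi]
    refine (measure_mono fun ω hω => ?_).trans ((hE.weighted_row_sum_tail i (block s t)
      (a := fun e k => indicatorOf (farLeft y (block s t) (blockDistance F y σ s e t) δ q i) k)
      (fun k => measurable_indicatorOf_farLeft t q i k)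
      (fun e => (sum_indicatorOf_sq_le _ _).trans (hV t)) (t := 5 / 2 * √(n * Real.log n))
      (by positivity)).trans (tail_le (by omega) (by positivity) hside))
    simp only [Set.mem_ofPred_eq, blockDistance_eraseRow hi,
      sum_indicatorOf_mul (farLeft_subset _ _ _ _)] at hω ⊢
    exact hω.2
  have h5 : μ {ω | ∃ x : Fin 3 × Fin n × Fin n, (x.2.1 ∈ block s x.1 ∧ x.2.2 ∉ block s x.1) ∧
      5 / 2 * √(n * Real.log n) ≤ |∑ k ∈ farRight y (block s x.1)
        (blockDistance F y σ s (fun i j => E i j ω) x.1) δ x.2.1 x.2.2, E x.2.2 k ω|} ≤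
      Fintype.card (Fin 3 × Fin n × Fin n) * p := by
    refine measure_exists_le fun x => ?_
    obtain ⟨t, q, i⟩ := x
    by_cases hi : i ∈ block s t
    · simp [hi]
    refine (measure_mono fun ω hω => ?_).trans ((hE.weighted_row_sum_tail i (block s t)
      (a := fun e k => indicatorOf (farRight y (block s t) (blockDistance F y σ s e t) δ q i) k)
      (fun k => measurable_indicatorOf_farRight t q i k)
      (fun e => (sum_indicatorOf_sq_le _ _).trans (hV t)) (t := 5 / 2 * √(n * Real.log n))
      (by positivity)).trans (tail_le (by omega) (by positivity) hside))
    simp only [Set.mem_ofPred_eq, blockDistance_eraseRow hi,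
      sum_indicatorOf_mul (farRight_subset _ _ _ _)] at hω ⊢
    exact hω.2
  have hcover : {ω | ¬ GoodNoise F y σ δ s fun i j => E i j ω} ⊆
      {ω | ∃ x : Fin n × Fin n, 4 * √(Real.log n) ≤ |E x.1 x.2 ω|} ∪
      ({ω | ∃ x : Option (Fin 3) × Fin n × Fin n, 4 * √(n * Real.log n) ≤
        |∑ k ∈ columnSet s x.1, F (y x.2.1) (y k) * E x.2.2 k ω|} ∪
      ({ω | ∃ x : Option (Fin 3) × Fin n × Fin n, x.2.1 ≠ x.2.2 ∧
        16 * √n * Real.log n ≤ |∑ k ∈ (columnSet s x.1).filter fun k => k ≠ x.2.1 ∧ k ≠ x.2.2,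
          truncated (4 * √(Real.log n)) (E x.2.2 k ω) * E x.2.1 k ω|} ∪
      ({ω | ∃ x : Fin 3 × Fin n × Fin n, (x.2.1 ∈ block s x.1 ∧ x.2.2 ∉ block s x.1) ∧
        5 / 2 * √(n * Real.log n) ≤ |∑ k ∈ farLeft y (block s x.1)
          (blockDistance F y σ s (fun i j => E i j ω) x.1) δ x.2.1 x.2.2, E x.2.2 k ω|} ∪
      {ω | ∃ x : Fin 3 × Fin n × Fin n, (x.2.1 ∈ block s x.1 ∧ x.2.2 ∉ block s x.1) ∧
        5 / 2 * √(n * Real.log n) ≤ |∑ k ∈ farRight y (block s x.1)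
          (blockDistance F y σ s (fun i j => E i j ω) x.1) δ x.2.1 x.2.2, E x.2.2 k ω|}))) := by
    intro ω hω
    by_contra hnot
    simp only [Set.mem_union, Set.mem_ofPred_eq, not_or, not_exists, not_and, not_le] at hnot
    obtain ⟨k1, k2, k3, k4, k5⟩ := hnot
    exact hω ⟨k1, k2, k3, fun x ha hb => k4 x ⟨ha, hb⟩, fun x ha hb => k5 x ⟨ha, hb⟩⟩
  have htotal : (Fintype.card (Fin n × Fin n) * p +
      (Fintype.card (Option (Fin 3) × Fin n × Fin n) * p +
      (Fintype.card (Option (Fin 3) × Fin n × Fin n) * p +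
      (Fintype.card (Fin 3 × Fin n × Fin n) * p + Fintype.card (Fin 3 × Fin n × Fin n) * p)))) =
      ENNReal.ofReal (30 / (n : ℝ) ^ 4) := by
    simp only [Fintype.card_prod, Fintype.card_option, Fintype.card_fin]
    rw [← add_mul, ← add_mul, ← add_mul, ← add_mul]
    have hN : ((n * n : ℕ) : ENNReal) + (((3 + 1) * (n * n) : ℕ) + (((3 + 1) * (n * n) : ℕ) +
        ((3 * (n * n) : ℕ) + (3 * (n * n) : ℕ)))) = ENNReal.ofReal (15 * (n : ℝ) ^ 2) := by
      have : (15 * (n : ℝ) ^ 2) = ((15 * n ^ 2 : ℕ) : ℝ) := by push_cast; ring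
      rw [this, ENNReal.ofReal_natCast]
      norm_cast
      ring
    rw [hN, hp, ← ENNReal.ofReal_mul (by positivity)]
    congr 1
    field_simp
    norm_num
  refine (measure_mono hcover).trans ?_
  rw [← htotal]
  exact (measure_union_le _ _).trans (add_le_add h1 ((measure_union_le _ _).trans (add_le_add h2
    ((measure_union_le _ _).trans (add_le_add h3 ((measure_union_le _ _).trans
      (add_le_add h4 h5)))))))

/-- For a good noise the off-diagonal entries of the Gram matrices of the data are close to those
of the signal. -/
lemma GoodNoise.gram_accuracy {e : Fin n → Fin n → ℝ} (h : GoodNoise F y σ δ s e)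
    (hσ : 0 < σ) (hn : 1 ≤ n) (hL : 1 ≤ Real.log n) (T : Option (Fin 3)) {i j : Fin n}
    (hij : i ≠ j) :
    |∑ l ∈ columnSet s T, dataMatrix F y σ e i l * dataMatrix F y σ e j l -
      signalGram F y (columnSet s T) i j| ≤ (8 * σ + 48 * σ ^ 2) * (√n * Real.log n) := by
  classical
  have hn1 : 1 ≤ √(n : ℝ) := Real.one_le_sqrt.2 (by exact_mod_cast hn)
  set X := √(n : ℝ) * Real.log n with hX
  have hLX : Real.log n ≤ X := by rw [hX]; nlinarith
  have hsq : √(n * Real.log n) ≤ X := by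
    rw [Real.sqrt_mul (Nat.cast_nonneg n), hX]
    have : √(Real.log n) ≤ Real.log n := by
      rw [Real.sqrt_le_left (by linarith)]; nlinarith
    gcongr
  have hlin1 := (h.linear (T, i, j)).le.trans (mul_le_mul_of_nonneg_left hsq (by norm_num))
  have hlin2 := (h.linear (T, j, i)).le.trans (mul_le_mul_of_nonneg_left hsq (by norm_num))
  have hprod : ∀ a b c d : Fin n, |e a b * e c d| ≤ 16 * X := fun a b c d => by
    rw [abs_mul]
    calc |e a b| * |e c d| ≤ (4 * √(Real.log n)) * (4 * √(Real.log n)) :=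
          mul_le_mul (h.entry (a, b)).le (h.entry (c, d)).le (abs_nonneg _) (by positivity)
      _ = 16 * (√(Real.log n) * √(Real.log n)) := by ring
      _ = 16 * Real.log n := by rw [Real.mul_self_sqrt (by linarith)]
      _ ≤ 16 * X := by linarith
  have hbil : |∑ l ∈ columnSet s T, e i l * e j l| ≤ 48 * X := by
    have hb := (h.bilinear (T, i, j) hij).le
    have htr : ∀ k, truncated (4 * √(Real.log n)) (e j k) = e j k := fun k => by
      unfold truncated; rw [if_pos (h.entry (j, k)).le]
    simp only [htr] at hb
    have hrest : |∑ l ∈ (columnSet s T).filter fun k => ¬ (k ≠ i ∧ k ≠ j), e i l * e j l| ≤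
        32 * X := by
      have hsub : ((columnSet s T).filter fun k => ¬ (k ≠ i ∧ k ≠ j)) ⊆ {i, j} := by
        intro k hk
        simp only [Finset.mem_filter, not_and_or, not_not] at hk
        simpa using hk.2
      have hc : ((((columnSet s T).filter fun k => ¬ (k ≠ i ∧ k ≠ j)).card : ℕ) : ℝ) ≤ 2 := by
        exact_mod_cast (Finset.card_le_card hsub).trans Finset.card_le_two
      calc |∑ l ∈ (columnSet s T).filter fun k => ¬ (k ≠ i ∧ k ≠ j), e i l * e j l|
          ≤ ∑ l ∈ (columnSet s T).filter fun k => ¬ (k ≠ i ∧ k ≠ j), |e i l * e j l| :=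
            Finset.abs_sum_le_sum_abs _ _
        _ ≤ ∑ _l ∈ (columnSet s T).filter fun k => ¬ (k ≠ i ∧ k ≠ j), 16 * X :=
            Finset.sum_le_sum fun l _ => hprod _ _ _ _
        _ = ((columnSet s T).filter fun k => ¬ (k ≠ i ∧ k ≠ j)).card * (16 * X) := by
            rw [Finset.sum_const, nsmul_eq_mul]
        _ ≤ 2 * (16 * X) := by gcongr
        _ = 32 * X := by ring
    rw [← Finset.sum_filter_add_sum_filter_not (columnSet s T) (fun k => k ≠ i ∧ k ≠ j)]
    refine (abs_add_le _ _).trans ?_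
    have hcomm : ∑ l ∈ (columnSet s T).filter fun k => k ≠ i ∧ k ≠ j, e i l * e j l =
        ∑ k ∈ (columnSet s T).filter fun k => k ≠ i ∧ k ≠ j, e j k * e i k :=
      Finset.sum_congr rfl fun k _ => mul_comm _ _
    rw [hcomm]
    have : 16 * √n * Real.log n = 16 * X := by rw [hX]; ring
    rw [this] at hb
    linarith
  have hexp : ∑ l ∈ columnSet s T, dataMatrix F y σ e i l * dataMatrix F y σ e j l -
      signalGram F y (columnSet s T) i j =
      σ * ∑ l ∈ columnSet s T, F (y i) (y l) * e j l +
      σ * ∑ l ∈ columnSet s T, F (y j) (y l) * e i l +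
      σ ^ 2 * ∑ l ∈ columnSet s T, e i l * e j l := by
    unfold signalGram dataMatrix
    rw [Finset.mul_sum, Finset.mul_sum, Finset.mul_sum, ← Finset.sum_sub_distrib,
      ← Finset.sum_add_distrib, ← Finset.sum_add_distrib]
    exact Finset.sum_congr rfl fun l _ => by ring
  rw [hexp]
  refine (abs_add_three _ _ _).trans ?_
  rw [abs_mul, abs_mul, abs_mul, abs_of_pos hσ, abs_of_pos (pow_pos hσ 2)]
  have a := mul_le_mul_of_nonneg_left hlin1 hσ.le
  have b := mul_le_mul_of_nonneg_left hlin2 hσ.le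
  have c := mul_le_mul_of_nonneg_left hbil (pow_pos hσ 2).le
  linarith

end Probability

/-! ### The random partition -/

lemma block_eq_filter (s : Fin n → Fin 3) (t : Fin 3) :
    block s t = Finset.univ.filter fun i => s i = t := by
  ext i; simp [mem_block]

lemma mem_balancedPartitions {s : Fin n → Fin 3} : s ∈ balancedPartitions n ↔
    ∀ t, n / 3 ≤ (block s t).card ∧ (block s t).card ≤ (n + 2) / 3 := by
  simp only [balancedPartitions, block_eq_filter, Finset.mem_filter, Finset.mem_univ, true_and]

lemma card_block_comp (s : Fin n → Fin 3) (τ : Equiv.Perm (Fin n)) (t : Fin 3) :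
    (block (s ∘ τ) t).card = (block s t).card :=
  Finset.card_equiv τ fun i => by simp [mem_block]

/-- The balanced partitions whose block `t` avoids `W`. -/
def avoidingPartitions (t : Fin 3) (W : Finset (Fin n)) : Finset (Fin n → Fin 3) :=
  (balancedPartitions n).filter fun s => ∀ x ∈ W, s x ≠ t

lemma mem_avoidingPartitions {t : Fin 3} {W : Finset (Fin n)} {s : Fin n → Fin 3} :
    s ∈ avoidingPartitions t W ↔ s ∈ balancedPartitions n ∧ ∀ x ∈ W, s x ≠ t :=
  Finset.mem_filter

/-- By exchangeability, all indices outside `W` are equally likely to be in block `t`. -/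
lemma card_avoidingPartitions_filter (t : Fin 3) {W : Finset (Fin n)} {x z : Fin n}
    (hx : x ∉ W) (hz : z ∉ W) :
    ((avoidingPartitions t W).filter fun s => s x = t).card =
      ((avoidingPartitions t W).filter fun s => s z = t).card := by
  refine Finset.card_equiv ((Equiv.swap x z).arrowCongr (Equiv.refl (Fin 3))) fun s => ?_
  have hs : ((Equiv.swap x z).arrowCongr (Equiv.refl (Fin 3))) s = s ∘ Equiv.swap x z := by
    funext i; simp [Equiv.arrowCongr]
  rw [hs]
  simp only [Finset.mem_filter, mem_avoidingPartitions, mem_balancedPartitions, card_block_comp,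
    Function.comp_apply, Equiv.swap_apply_right]
  have : (∀ i ∈ W, s (Equiv.swap x z i) ≠ t) ↔ ∀ i ∈ W, s i ≠ t := by
    refine forall₂_congr fun i hi => ?_
    rw [Equiv.swap_apply_of_ne_of_ne (by rintro rfl; exact hx hi) (by rintro rfl; exact hz hi)]
  rw [this]

/-- Each further index is in block `t` with probability at least `1 / 4`. -/
lemma card_avoidingPartitions_insert (hn : 8 ≤ n) (t : Fin 3) {W : Finset (Fin n)} {x : Fin n}
    (hx : x ∉ W) :
    4 * (avoidingPartitions t (insert x W)).card ≤ 3 * (avoidingPartitions t W).card := by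
  classical
  set q := ((avoidingPartitions t W).filter fun s => s x = t).card with hq
  have hsplit : (avoidingPartitions t (insert x W)).card + q = (avoidingPartitions t W).card := by
    rw [← Finset.card_filter_add_card_filter_not (s := avoidingPartitions t W) fun s => s x = t,
      add_comm, ← hq]
    congr 2
    ext s
    simp only [Finset.mem_filter, mem_avoidingPartitions, Finset.mem_insert, forall_eq_or_imp]
    tauto
  have hdouble : ∑ z ∈ Wᶜ, ((avoidingPartitions t W).filter fun s => s z = t).card =
      ∑ s ∈ avoidingPartitions t W, (block s t).card := by
    simp only [Finset.card_filter]
    rw [Finset.sum_comm]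
    refine Finset.sum_congr rfl fun s hs => ?_
    rw [← Finset.card_filter]
    congr 1
    ext z
    simp only [Finset.mem_filter, Finset.mem_compl, mem_block]
    exact ⟨fun h => h.2, fun h => ⟨fun hz => (mem_avoidingPartitions.1 hs).2 z hz h, h⟩⟩
  have hleft : ∑ z ∈ Wᶜ, ((avoidingPartitions t W).filter fun s => s z = t).card ≤ n * q := by
    rw [Finset.sum_congr rfl fun z hz =>
      (card_avoidingPartitions_filter t hx (Finset.mem_compl.1 hz)).symm, Finset.sum_const,
      smul_eq_mul]
    refine Nat.mul_le_mul_right _ ((Finset.card_le_univ _).trans ?_)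
    rw [Fintype.card_fin]
  have hright : (avoidingPartitions t W).card * (n / 3) ≤
      ∑ s ∈ avoidingPartitions t W, (block s t).card := by
    rw [← smul_eq_mul]
    exact Finset.card_nsmul_le_sum _ _ _ fun s hs =>
      (mem_balancedPartitions.1 (mem_avoidingPartitions.1 hs).1 t).1
  have h1 : (avoidingPartitions t W).card * (n / 3) ≤ n * q := hright.trans (hdouble ▸ hleft)
  have h2 : n ≤ 4 * (n / 3) := by omega
  have h3 : (avoidingPartitions t W).card * n ≤ 4 * q * n := by nlinarith
  have h4 := Nat.le_of_mul_le_mul_right h3 (by omega)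
  omega

/-- A random balanced partition has block `t` avoid `W` with probability at most `(3 / 4) ^ |W|`. -/
lemma card_avoidingPartitions_le (hn : 8 ≤ n) (t : Fin 3) (W : Finset (Fin n)) :
    4 ^ W.card * (avoidingPartitions t W).card ≤ 3 ^ W.card * (balancedPartitions n).card := by
  classical
  induction W using Finset.induction_on with
  | empty => simp [avoidingPartitions]
  | insert x W hx ih =>
    rw [Finset.card_insert_of_notMem hx, pow_succ, pow_succ]
    have := card_avoidingPartitions_insert hn t hx
    calc 4 ^ W.card * 4 * (avoidingPartitions t (insert x W)).card
        = 4 ^ W.card * (4 * (avoidingPartitions t (insert x W)).card) := by ring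
      _ ≤ 4 ^ W.card * (3 * (avoidingPartitions t W).card) := Nat.mul_le_mul_left _ this
      _ = 3 * (4 ^ W.card * (avoidingPartitions t W).card) := by ring
      _ ≤ 3 * (3 ^ W.card * (balancedPartitions n).card) := Nat.mul_le_mul_left _ ih
      _ = 3 ^ W.card * 3 * (balancedPartitions n).card := by ring

/-- The partition is balanced and each of its blocks meets all windows of length `w`. -/
structure GoodPartition (y : Equiv.Perm (Fin n)) (w : ℕ) (s : Fin n → Fin 3) : Prop where
  balanced : s ∈ balancedPartitions n
  meetsWindows : ∀ t, MeetsWindows y (block s t) w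

open Classical in
lemma card_not_goodPartition_le (hn : 8 ≤ n) {w : ℕ} (hw : 1 ≤ w) (y : Equiv.Perm (Fin n)) :
    4 ^ w * ((balancedPartitions n).filter fun s => ¬ GoodPartition y w s).card ≤
      3 * n * 3 ^ w * (balancedPartitions n).card := by
  let W : ℕ → Finset (Fin n) := fun a =>
    Finset.univ.filter fun k => a ≤ (y k : ℕ) ∧ (y k : ℕ) < a + w
  have hsub : ((balancedPartitions n).filter fun s => ¬ GoodPartition y w s) ⊆
      (Finset.univ : Finset (Fin 3)).biUnion fun t => (Finset.range (n + 1 - w)).biUnion fun a =>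
        avoidingPartitions t (W a) := by
    intro s hs
    obtain ⟨hs, hbad⟩ := Finset.mem_filter.1 hs
    have : ¬ ∀ t, MeetsWindows y (block s t) w := fun h => hbad ⟨hs, h⟩
    simp only [MeetsWindows] at this
    push Not at this
    obtain ⟨t, a, ha, hW⟩ := this
    simp only [Finset.mem_biUnion, Finset.mem_univ, true_and, Finset.mem_range]
    refine ⟨t, a, by omega, mem_avoidingPartitions.2 ⟨hs, fun x hx hxt => ?_⟩⟩
    simp only [W, Finset.mem_filter, Finset.mem_univ, true_and] at hx
    have := hW x (mem_block.2 hxt) hx.1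
    omega
  have hterm : ∀ t, ∀ a ∈ Finset.range (n + 1 - w), 4 ^ w * (avoidingPartitions t (W a)).card ≤
      3 ^ w * (balancedPartitions n).card := by
    intro t a ha
    have h := card_avoidingPartitions_le hn t (W a)
    have hc : (W a).card = w := by
      rw [card_positions_Ico y (by have := Finset.mem_range.1 ha; omega)]; omega
    rwa [hc] at h
  calc 4 ^ w * ((balancedPartitions n).filter fun s => ¬ GoodPartition y w s).card
      ≤ 4 ^ w * ∑ t : Fin 3, ∑ a ∈ Finset.range (n + 1 - w), (avoidingPartitions t (W a)).card := by
        refine Nat.mul_le_mul_left _ ((Finset.card_le_card hsub).trans ?_)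
        exact Finset.card_biUnion_le.trans (Finset.sum_le_sum fun t _ => Finset.card_biUnion_le)
    _ = ∑ t : Fin 3, ∑ a ∈ Finset.range (n + 1 - w),
          4 ^ w * (avoidingPartitions t (W a)).card := by
        simp only [Finset.mul_sum]
    _ ≤ ∑ _t : Fin 3, ∑ _a ∈ Finset.range (n + 1 - w), 3 ^ w * (balancedPartitions n).card :=
        Finset.sum_le_sum fun t _ => Finset.sum_le_sum fun a ha => hterm t a ha
    _ = 3 * (n + 1 - w) * (3 ^ w * (balancedPartitions n).card) := by simp; ring
    _ ≤ 3 * n * (3 ^ w * (balancedPartitions n).card) :=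
        Nat.mul_le_mul_right _ (by omega)
    _ = 3 * n * 3 ^ w * (balancedPartitions n).card := by ring

section Probability

variable {Ω : Type*} [MeasurableSpace Ω] {μ : Measure Ω} {S : Ω → Fin n → Fin 3}

lemma measure_not_goodPartition_le (hn : 8 ≤ n) {w : ℕ} (hw : 1 ≤ w) (y : Equiv.Perm (Fin n))
    (hS : Measurable S)
    (hSμ : μ.map S = uniformOn (balancedPartitions n : Set (Fin n → Fin 3))) :
    μ {ω | ¬ GoodPartition y w (S ω)} ≤ ENNReal.ofReal (3 * n * (3 / 4) ^ w) := by
  classical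
  have hms : ∀ B : Set (Fin n → Fin 3), MeasurableSet B := fun B => B.toFinite.measurableSet
  have h1 : μ {ω | ¬ GoodPartition y w (S ω)} = μ.map S {s | ¬ GoodPartition y w s} :=
    by rw [Measure.map_apply hS (hms _)]; rfl
  have h2 : (balancedPartitions n : Set (Fin n → Fin 3)) ∩ {s | ¬ GoodPartition y w s} =
      ((balancedPartitions n).filter fun s => ¬ GoodPartition y w s : Finset _) := by
    ext s; simp
  rw [h1, hSμ, uniformOn, cond_apply (hms _), h2, Measure.count_apply_finset,
    Measure.count_apply_finset, mul_comm, ← div_eq_mul_inv]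
  refine ENNReal.div_le_of_le_mul ?_
  have hcard := card_not_goodPartition_le hn hw y
  set f := ((balancedPartitions n).filter fun s => ¬ GoodPartition y w s).card
  set c := (balancedPartitions n).card
  rw [← ENNReal.ofReal_natCast f, ← ENNReal.ofReal_natCast c, ← ENNReal.ofReal_mul (by positivity)]
  refine ENNReal.ofReal_le_ofReal ?_
  have hreal : (4 : ℝ) ^ w * f ≤ 3 * n * 3 ^ w * c := by exact_mod_cast hcard
  rw [div_pow]
  have : 3 * (n : ℝ) * (3 ^ w / 4 ^ w) * c = 3 * n * 3 ^ w * c / 4 ^ w := by ring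
  rw [this, le_div_iff₀ (by positivity)]
  linarith

/-- Partition and noise are simultaneously good with high probability: for each good partition the
noise is good with high probability, and the two are independent. -/
lemma measure_not_good_le [IsProbabilityMeasure μ] {E : Fin n → Fin n → Ω → ℝ}
    {F : Matrix (Fin n) (Fin n) ℝ}
    {y : Equiv.Perm (Fin n)} {σ δ α β : ℝ} (hn : 8 ≤ n) {w : ℕ} (hw : 1 ≤ w)
    (hE : IsNoise μ E) (hF : IsBiLipschitz α β F) (hS : Measurable S)
    (hSμ : μ.map S = uniformOn (balancedPartitions n : Set (Fin n → Fin 3)))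
    (hSE : IndepFun S (fun ω i j => E i j ω) μ) :
    μ {ω | ¬ (GoodPartition y w (S ω) ∧ GoodNoise F y σ δ (S ω) fun i j => E i j ω)} ≤
      ENNReal.ofReal (3 * n * (3 / 4) ^ w + 30 / (n : ℝ) ^ 4) := by
  have hEm : Measurable fun ω i j => E i j ω :=
    measurable_pi_iff.2 fun p => measurable_pi_iff.2 fun q => hE.measurable p q
  let B : Set ((Fin n → Fin 3) × (Fin n → Fin n → ℝ)) :=
    {z | GoodPartition y w z.1 ∧ ¬ GoodNoise F y σ δ z.1 z.2}
  have hB : MeasurableSet B := by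
    have : B = ⋃ s, ({s} ×ˢ {e | GoodPartition y w s ∧ ¬ GoodNoise F y σ δ s e}) := by
      ext z
      simp only [B, Set.mem_ofPred_eq, Set.mem_iUnion, Set.mem_prod, Set.mem_singleton_iff]
      exact ⟨fun h => ⟨z.1, rfl, h⟩, by rintro ⟨s, rfl, h⟩; exact h⟩
    rw [this]
    exact MeasurableSet.iUnion fun s => (measurableSet_singleton s).prod
      ((MeasurableSet.const _).inter measurableSet_goodNoise.compl)
  have hnoise : μ {ω | (S ω, fun i j => E i j ω) ∈ B} ≤ ENNReal.ofReal (30 / (n : ℝ) ^ 4) := by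
    refine measure_le_of_indepFun hEm hS hSE hB fun s => ?_
    by_cases hs : GoodPartition y w s
    · refine (measure_mono fun ω hω => ?_).trans (hE.measure_not_goodNoise_le (y := y) (σ := σ)
        (δ := δ) (s := s) hF (by omega) fun t => ?_)
      · simp only [B, Set.mem_ofPred_eq] at hω ⊢
        exact hω.2
      · have := (mem_balancedPartitions.1 hs.balanced t).2
        omega
    · simp [B, hs]
  have hcover : {ω | ¬ (GoodPartition y w (S ω) ∧ GoodNoise F y σ δ (S ω) fun i j => E i j ω)} ⊆
      {ω | ¬ GoodPartition y w (S ω)} ∪ {ω | (S ω, fun i j => E i j ω) ∈ B} := by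
    intro ω hω
    simp only [B, Set.mem_ofPred_eq, Set.mem_union] at hω ⊢
    tauto
  refine (measure_mono hcover).trans ((measure_union_le _ _).trans ?_)
  rw [ENNReal.ofReal_add (by positivity) (by positivity)]
  exact add_le_add (measure_not_goodPartition_le hn hw y hS hSμ) hnoise

end Probability

/-! ### Conclusion for large `n` -/

/-- The length of the windows that the blocks of the partition have to meet. It is large enough for
`(3 / 4) ^ w` to be negligible, and small enough for the distance estimates on the blocks to have
an error of smaller order than `n`. -/
noncomputable def windowLength (n : ℕ) : ℕ := ⌈(n : ℝ) ^ (1 / 4 : ℝ)⌉₊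

/-- The lower bound on `log n` used in the analysis. -/
noncomputable def logConstant (α β σ : ℝ) : ℝ :=
  4 * (24 * β + 12 * (8 * σ + 48 * σ ^ 2)) + 20 * β + 6 * (β / separationRate α β) + 4

/-- The factor by which `n` has to exceed `n ^ (7 / 8) * (log n) ^ 4` in the analysis. -/
noncomputable def sizeConstant (α β : ℝ) : ℝ :=
  96 / separationRate α β + 32 + 4 / nearFraction α β

/-- `n` is large in terms of `α`, `β`, `σ`. -/
structure IsLarge (α β σ : ℝ) (n : ℕ) : Prop where
  log_ge : logConstant α β σ ≤ Real.log n
  size : sizeConstant α β * ((n : ℝ) ^ (7 / 8 : ℝ) * Real.log n ^ 4) ≤ n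
  prob : 6 * (n : ℝ) ^ 3 * (3 / 4) ^ windowLength n ≤ 1
  eight_le : 8 ≤ n

lemma eventually_prob : ∀ᶠ n : ℕ in Filter.atTop,
    6 * (n : ℝ) ^ 3 * (3 / 4) ^ windowLength n ≤ 1 := by
  have h1 : Filter.Tendsto (fun m : ℕ => 6 * ((m : ℝ) ^ 12 * (3 / 4 : ℝ) ^ m)) Filter.atTop
      (nhds (6 * 0)) :=
    (tendsto_pow_const_mul_const_pow_of_abs_lt_one 12 (by rw [abs_of_pos] <;> norm_num)).const_mul 6
  rw [mul_zero] at h1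
  have h2 : Filter.Tendsto windowLength Filter.atTop Filter.atTop :=
    tendsto_nat_ceil_atTop.comp ((tendsto_rpow_atTop (by norm_num : (0 : ℝ) < 1 / 4)).comp
      tendsto_natCast_atTop_atTop)
  filter_upwards [h2.eventually (h1.eventually (ge_mem_nhds one_pos))] with n hn
  refine le_trans ?_ hn
  have h3 : (n : ℝ) ^ (1 / 4 : ℝ) ≤ windowLength n := Nat.le_ceil _
  have h4 : (n : ℝ) ^ 3 ≤ (windowLength n : ℝ) ^ 12 := by
    calc (n : ℝ) ^ 3 = ((n : ℝ) ^ (1 / 4 : ℝ)) ^ 12 := by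
          rw [← Real.rpow_natCast, ← Real.rpow_natCast, ← Real.rpow_mul (Nat.cast_nonneg n)]
          norm_num
      _ ≤ (windowLength n : ℝ) ^ 12 := pow_le_pow_left₀ (by positivity) h3 12
  rw [mul_assoc]
  gcongr

lemma eventually_size (M : ℝ) : ∀ᶠ n : ℕ in Filter.atTop,
    M * ((n : ℝ) ^ (7 / 8 : ℝ) * Real.log n ^ 4) ≤ n := by
  have h1 := (isLittleO_log_rpow_rpow_atTop 4 (by norm_num : (0 : ℝ) < 1 / 8)).def
    (show (0 : ℝ) < 1 / (|M| + 1) by positivity)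
  filter_upwards [tendsto_natCast_atTop_atTop.eventually h1, Filter.eventually_ge_atTop 1]
    with n hn hn1
  have hn0 : (0 : ℝ) < n := by exact_mod_cast hn1
  have hL : 0 ≤ Real.log n := Real.log_natCast_nonneg n
  rw [Real.norm_of_nonneg (by positivity), Real.norm_of_nonneg (by positivity)] at hn
  have h4 : Real.log n ^ (4 : ℝ) = Real.log n ^ 4 := by norm_cast
  rw [h4] at hn
  calc M * ((n : ℝ) ^ (7 / 8 : ℝ) * Real.log n ^ 4)
      ≤ (|M| + 1) * ((n : ℝ) ^ (7 / 8 : ℝ) * Real.log n ^ 4) :=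
        mul_le_mul_of_nonneg_right (by linarith [le_abs_self M]) (by positivity)
    _ ≤ (|M| + 1) * ((n : ℝ) ^ (7 / 8 : ℝ) * (1 / (|M| + 1) * (n : ℝ) ^ (1 / 8 : ℝ))) := by
        gcongr
    _ = (n : ℝ) ^ (7 / 8 : ℝ) * (n : ℝ) ^ (1 / 8 : ℝ) := by field_simp
    _ = n := by rw [← Real.rpow_add hn0]; norm_num

lemma exists_isLarge (α β σ : ℝ) : ∃ C : ℝ, ∀ n : ℕ, C ≤ n → IsLarge α β σ n := by
  have hlog : ∀ᶠ n : ℕ in Filter.atTop, logConstant α β σ ≤ Real.log n :=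
    (Real.tendsto_log_atTop.comp tendsto_natCast_atTop_atTop).eventually_ge_atTop _
  have h : ∀ᶠ n : ℕ in Filter.atTop, IsLarge α β σ n := by
    filter_upwards [hlog, eventually_size (sizeConstant α β), eventually_prob,
      Filter.eventually_ge_atTop 8] with n h1 h2 h3 h4
    exact ⟨h1, h2, h3, h4⟩
  obtain ⟨N, hN⟩ := Filter.eventually_atTop.1 h
  exact ⟨N, fun n hn => hN n (by exact_mod_cast hn)⟩

lemma tuning_succ (n k : ℕ) : tuning n (k + 1) = tuning n k * Real.log n := by
  unfold tuning; ring

/-- The gap beyond which the distance estimates, growing at rate `κ`, exceed `δ`. -/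
noncomputable def radius (κ δ : ℝ) : ℕ := ⌈2 * δ / κ⌉₊

lemma le_radius (κ δ : ℝ) : 2 * δ / κ ≤ radius κ δ := Nat.le_ceil _

lemma radius_lt {κ δ : ℝ} (hκ : 0 < κ) (hδ : 0 ≤ δ) : (radius κ δ : ℝ) < 2 * δ / κ + 1 :=
  Nat.ceil_lt_add_one (by positivity)

section Large

variable {α β σ : ℝ}

set_option maxHeartbeats 1000000 in
/-- The numerical consequences of `IsLarge` used below. -/
lemma IsLarge.facts (h : IsLarge α β σ n) (hα : 0 < α) (hβ : 0 < β) (hσ : 0 < σ) :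
    1 ≤ Real.log n ∧ 1 ≤ tuning n 1 ∧ 1 ≤ windowLength n ∧
    (windowLength n : ℝ) ≤ 2 * (n : ℝ) ^ (1 / 4 : ℝ) ∧
    (n : ℝ) * (12 * windowLength n * β + 12 * ((8 * σ + 48 * σ ^ 2) * (√n * Real.log n))) ≤
      (tuning n 1 / 2) ^ 2 ∧
    6 * windowLength n * β ≤ tuning n 1 ∧ 3 * windowLength n ≤ n ∧
    2 * (windowLength n : ℝ) ≤ nearFraction α β * n ∧
    4 * (4 * tuning n 3 / separationRate α β + 3) ≤ n ∧
    24 * (2 * (tuning n 4 * √(windowLength n)) / separationRate α β + 1) + 8 ≤ n := by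
  have hκ := separationRate_pos hα hβ
  have hθ := nearFraction_pos hα hβ
  have hK := h.log_ge
  have hn1 : (1 : ℝ) ≤ n := by exact_mod_cast (show 1 ≤ n by have := h.eight_le; omega)
  have hn0 : (0 : ℝ) < n := by linarith
  unfold logConstant at hK
  set c := 24 * β + 12 * (8 * σ + 48 * σ ^ 2) with hc
  have hc0 : 0 < c := by positivity
  have hβκ : 0 < β / separationRate α β := by positivity
  set Λ := Real.log n with hΛ
  have hL1 : 1 ≤ Λ := by linarith
  set q := (n : ℝ) ^ (3 / 4 : ℝ) with hq
  set r := (n : ℝ) ^ (1 / 4 : ℝ) with hr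
  have hr1 : 1 ≤ r := Real.one_le_rpow hn1 (by norm_num)
  have hqr : q * r = n := by rw [hq, hr, ← Real.rpow_add hn0]; norm_num
  have hrq : r ≤ q := Real.rpow_le_rpow_of_exponent_le hn1 (by norm_num)
  have hsq : √(n : ℝ) = r ^ 2 := by
    rw [Real.sqrt_eq_rpow, hr, ← Real.rpow_natCast, ← Real.rpow_mul hn0.le]; norm_num
  have hq2 : q ^ 2 = n * r ^ 2 := by
    rw [← hsq, hq, Real.sqrt_eq_rpow, ← Real.rpow_natCast, ← Real.rpow_mul hn0.le,
      ← Real.rpow_one_add' hn0.le (by norm_num)]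
    norm_num
  have hw1 : r ≤ windowLength n := Nat.le_ceil _
  have hw1' : 1 ≤ windowLength n := by
    have : (1 : ℝ) ≤ windowLength n := hr1.trans hw1
    exact_mod_cast this
  have hw2 : (windowLength n : ℝ) ≤ 2 * r := by
    have := Nat.ceil_lt_add_one (show 0 ≤ r by linarith)
    change (windowLength n : ℝ) < r + 1 at this
    linarith
  set w : ℝ := (windowLength n : ℝ) with hw
  have hδ1 : tuning n 1 = q * Λ := by unfold tuning; rw [pow_one]
  -- The largest radius, that of the estimates on the blocks, is of the order of `X`:
  -- `n ^ (3 / 4) * (log n) ^ 4` is multiplied by the square root of the window length.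
  set X := (n : ℝ) ^ (7 / 8 : ℝ) * Λ ^ 4 with hX
  have hL4 : 1 ≤ Λ ^ 4 := one_le_pow₀ hL1
  have h78 : 1 ≤ (n : ℝ) ^ (7 / 8 : ℝ) := Real.one_le_rpow hn1 (by norm_num)
  have hX1 : 1 ≤ X := one_le_mul_of_one_le_of_one_le h78 hL4
  have hqX : q * Λ ^ 4 ≤ X := by
    have : q ≤ (n : ℝ) ^ (7 / 8 : ℝ) := Real.rpow_le_rpow_of_exponent_le hn1 (by norm_num)
    rw [hX]; gcongr
  have hrX : r ≤ X := by nlinarith [mul_le_mul hrq hL4 (by norm_num) (by linarith)]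
  have hqw : q * √w ≤ 2 * (n : ℝ) ^ (7 / 8 : ℝ) := by
    have h1 : √w ≤ 2 * (n : ℝ) ^ (1 / 8 : ℝ) := by
      refine Real.sqrt_le_iff.2 ⟨by positivity, hw2.trans ?_⟩
      rw [mul_pow, ← Real.rpow_natCast (_ ^ _), ← Real.rpow_mul hn0.le]
      norm_num
      have h2 : r ≤ 4 * r := by linarith
      simpa [hr] using by linarith
    calc q * √w ≤ q * (2 * (n : ℝ) ^ (1 / 8 : ℝ)) := by gcongr
      _ = 2 * (q * (n : ℝ) ^ (1 / 8 : ℝ)) := by ring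
      _ = 2 * (n : ℝ) ^ (7 / 8 : ℝ) := by rw [hq, ← Real.rpow_add hn0]; norm_num
  have hsize := h.size
  rw [← hX] at hsize
  unfold sizeConstant at hsize
  have hκ0 : 0 < 96 / separationRate α β := by positivity
  have hθ0 : 0 < 4 / nearFraction α β := by positivity
  refine ⟨hL1, ?_, hw1', hw2, ?_, ?_, ?_, ?_, ?_, ?_⟩
  · rw [hδ1]
    exact one_le_mul_of_one_le_of_one_le (hr1.trans hrq) hL1
  · rw [hδ1, div_pow, mul_pow, hq2, hsq]
    have h1 : w * β ≤ 2 * (r ^ 2 * Λ) * β := by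
      refine mul_le_mul_of_nonneg_right ?_ hβ.le
      nlinarith [mul_le_mul hr1 hL1 (by norm_num) (by linarith)]
    have h2 : 12 * w * β + 12 * ((8 * σ + 48 * σ ^ 2) * (r ^ 2 * Λ)) ≤ c * (r ^ 2 * Λ) := by
      rw [hc]; nlinarith
    have h3 : c * (r ^ 2 * Λ) ≤ r ^ 2 * Λ ^ 2 / 4 := by
      have : 4 * c ≤ Λ := by linarith
      have h4 : 0 ≤ r ^ 2 * Λ := by positivity
      nlinarith
    calc (n : ℝ) * (12 * w * β + 12 * ((8 * σ + 48 * σ ^ 2) * (r ^ 2 * Λ)))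
        ≤ n * (r ^ 2 * Λ ^ 2 / 4) := mul_le_mul_of_nonneg_left (h2.trans h3) hn0.le
      _ = n * r ^ 2 * Λ ^ 2 / 2 ^ 2 := by ring
  · rw [hδ1]
    have : 12 * β ≤ Λ := by linarith
    calc 6 * w * β ≤ 6 * (2 * r) * β := by gcongr
      _ = r * (12 * β) := by ring
      _ ≤ q * Λ := by gcongr
  · have : 3 * w ≤ n := by nlinarith
    rw [hw] at this
    exact_mod_cast this
  · have h1 : 4 / nearFraction α β * X ≤ n := by nlinarith
    have h2 : 4 * X ≤ nearFraction α β * n := by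
      rw [div_mul_eq_mul_div, div_le_iff₀ hθ] at h1
      linarith
    linarith
  · have h1 : tuning n 3 ≤ X := by
      refine le_trans ?_ hqX
      unfold tuning
      exact mul_le_mul_of_nonneg_left (pow_le_pow_right₀ hL1 (by norm_num)) (by positivity)
    have h2 : 4 * tuning n 3 / separationRate α β ≤ 4 * X / separationRate α β := by gcongr
    have h3 : 4 * X / separationRate α β = 96 / separationRate α β * X / 24 := by ring
    nlinarith [mul_pos hκ0 (show 0 < X by linarith), mul_pos hθ0 (show 0 < X by linarith)]
  · have h1 : tuning n 4 * √w ≤ 2 * X := by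
      unfold tuning
      rw [hX, ← hq]
      calc q * Λ ^ 4 * √w = q * √w * Λ ^ 4 := by ring
        _ ≤ 2 * (n : ℝ) ^ (7 / 8 : ℝ) * Λ ^ 4 := by gcongr
        _ = _ := by ring
    have h2 : 2 * (tuning n 4 * √w) / separationRate α β ≤
        2 * (2 * X) / separationRate α β := by gcongr
    have h3 : 2 * (2 * X) / separationRate α β = 96 / separationRate α β * X / 24 := by ring
    nlinarith [mul_pos hκ0 (show 0 < X by linarith), mul_pos hθ0 (show 0 < X by linarith)]

variable {F : Matrix (Fin n) (Fin n) ℝ} {y : Equiv.Perm (Fin n)} {s : Fin n → Fin 3}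
  {e : Fin n → Fin n → ℝ} {δ : ℝ}

/-- For a good noise all distance estimates have an error of at most half of the first
threshold. -/
lemma GoodNoise.distance_bounds (h : GoodNoise F y σ δ s e) (hl : IsLarge α β σ n)
    (hF : IsBiLipschitz α β F) (hα : 0 < α) (hβ : 0 < β) (hσ : 0 < σ) (T : Option (Fin 3)) {v : ℕ}
    (hv : 1 ≤ v) (hvw : v ≤ windowLength n) (hT : MeetsWindows y (columnSet s T) v)
    {i j : Fin n} (hi : i ∈ columnSet s T) (hj : j ∈ columnSet s T) :
    separationRate α β / √v * gap y i j - tuning n 1 / 2 ≤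
      estimateDistance (dataMatrix F y σ e) (columnSet s T) i j ∧
    estimateDistance (dataMatrix F y σ e) (columnSet s T) i j ≤
      β * gap y i j + tuning n 1 / 2 := by
  obtain ⟨hL, hδ, hw1, -, hηε, -, h3w, h2w, -, -⟩ := hl.facts hα hβ hσ
  have hvw' : (v : ℝ) ≤ windowLength n := by exact_mod_cast hvw
  refine estimateDistance_bounds hF hα hβ hv hT (by omega) (by linarith)
    (η := (8 * σ + 48 * σ ^ 2) * (√n * Real.log n)) (by positivity) (by linarith)
    (fun i _ j _ hij => h.gram_accuracy hσ (by have := hl.eight_le; omega) hL T hij) ?_ hi hj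
  refine le_trans (mul_le_mul_of_nonneg_left ?_ (Nat.cast_nonneg n)) hηε
  gcongr

/-- The estimates of all distances resolve the order at the scales of the tuning parameters. -/
lemma GoodNoise.resolves (h : GoodNoise F y σ δ s e) (hl : IsLarge α β σ n)
    (hF : IsBiLipschitz α β F) (hα : 0 < α) (hβ : 0 < β) (hσ : 0 < σ) :
    Resolves (estimateDistance (dataMatrix F y σ e) Finset.univ) (tuning n 1) (tuning n 2)
      (tuning n 3) y (radius (separationRate α β) (tuning n 1))
      (radius (separationRate α β) (tuning n 2)) (radius (separationRate α β) (tuning n 3)) := by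
  obtain ⟨hL, hδ1, hw1, -, -, -, -, -, hsmall, -⟩ := hl.facts hα hβ hσ
  have hκ := separationRate_pos hα hβ
  have hb := fun i j => h.distance_bounds hl hF hα hβ hσ none le_rfl hw1
    (meetsWindows_univ y) (i := i) (j := j) (Finset.mem_univ i) (Finset.mem_univ j)
  simp only [columnSet, Nat.cast_one, Real.sqrt_one, div_one] at hb
  set κ := separationRate α β with hκdef
  set D := estimateDistance (dataMatrix F y σ e) Finset.univ
  have h2 : tuning n 2 = tuning n 1 * Real.log n := tuning_succ n 1
  have h3 : tuning n 3 = tuning n 2 * Real.log n := tuning_succ n 2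
  set δ₁ := tuning n 1
  set δ₂ := tuning n 2
  set δ₃ := tuning n 3
  have h12 : δ₁ ≤ δ₂ := by rw [h2]; nlinarith
  have h23 : δ₂ ≤ δ₃ := by rw [h3]; nlinarith
  have hK := hl.log_ge
  unfold logConstant at hK
  rw [← hκdef] at hK
  have hβκ : 0 < β / κ := by positivity
  have hσσ : 0 < 8 * σ + 48 * σ ^ 2 := by positivity
  have low : ∀ (d : ℝ) (i j : Fin n), δ₁ ≤ d → radius κ d ≤ gap y i j → d ≤ D i j := by
    intro d i j hd hg
    have hg' : 2 * d / κ ≤ gap y i j := (le_radius κ d).trans (by exact_mod_cast hg)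
    rw [div_le_iff₀ hκ] at hg'
    linarith [(hb i j).1]
  have high : ∀ (d : ℝ) (i j : Fin n), δ₁ ≤ d → d * Real.log n ≤ D i j →
      radius κ d < gap y i j := by
    intro d i j hd hD
    have hg := (hb i j).2
    have hr := radius_lt hκ (show 0 ≤ d by linarith)
    have hβd : β * (2 * d / κ + 1) = 2 * (β / κ) * d + β := by ring
    have hdd : d * (1 / 2 + 2 * (β / κ) + β) ≤ d * Real.log n :=
      mul_le_mul_of_nonneg_left (by linarith) (by linarith)
    have : β * (2 * d / κ + 1) ≤ β * gap y i j := by nlinarith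
    have := le_of_mul_le_mul_left this hβ
    exact_mod_cast hr.trans_le this
  refine ⟨fun i j hg => ?_, fun i j hD => ?_, fun i j hD => high δ₁ i j le_rfl (h2 ▸ hD),
    fun i j hg => low δ₂ i j h12 hg, fun i j hD => (high δ₂ i j h12 (h3 ▸ hD)).le,
    fun i j hg => low δ₃ i j (h12.trans h23) hg, ?_, ?_, ?_⟩
  · have hg' : (gap y i j : ℝ) ≤ 1 := by exact_mod_cast hg
    have : β * gap y i j ≤ β := by nlinarith
    have h1 : δ₁ = (n : ℝ) ^ (3 / 4 : ℝ) * Real.log n := by simp only [δ₁, tuning, pow_one]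
    have h4 : 1 ≤ (n : ℝ) ^ (3 / 4 : ℝ) := Real.one_le_rpow
      (by exact_mod_cast (show 1 ≤ n by have := hl.eight_le; omega)) (by norm_num)
    have h5 : 2 * β ≤ δ₁ := by rw [h1]; nlinarith
    linarith [(hb i j).2]
  · have h1 : (gap y i j : ℝ) ≤ 2 * δ₁ / κ := by
      rw [le_div_iff₀ hκ]; linarith [(hb i j).1]
    exact_mod_cast h1.trans (le_radius κ δ₁)
  · exact Nat.one_le_ceil_iff.2 (by have : 0 < δ₂ := by linarith
                                    positivity)
  · exact Nat.ceil_mono (by gcongr)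
  · have a := radius_lt hκ (show 0 ≤ δ₂ by linarith)
    have b := radius_lt hκ (show 0 ≤ δ₃ by linarith)
    have c : 2 * δ₂ / κ ≤ 2 * δ₃ / κ := by gcongr
    have d : 4 * δ₃ / κ = 2 * (2 * δ₃ / κ) := by ring
    have : 4 * ((radius κ δ₂ : ℝ) + radius κ δ₃ + 1) ≤ n := by linarith
    exact_mod_cast this

/-- All requirements of the refined seriation hold. -/
lemma GoodNoise.refinedSetting (h : GoodNoise F y σ (tuning n 4) s e) (hl : IsLarge α β σ n)
    (hs : GoodPartition y (windowLength n) s) (hF : IsBiLipschitz α β F) (hα : 0 < α) (hβ : 0 < β)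
    (hσ : 0 < σ) :
    RefinedSetting (estimateDistance (dataMatrix F y σ e) Finset.univ) (dataMatrix F y σ e) e
      (tuning n 4) s y (radius (separationRate α β) (tuning n 1))
      (radius (separationRate α β) (tuning n 3))
      (radius (separationRate α β) (tuning n 4 * √(windowLength n))) := by
  obtain ⟨hL, hδ1, hw1, -, -, h6w, h3w, -, -, hcard⟩ := hl.facts hα hβ hσ
  have hκ := separationRate_pos hα hβ
  have hres := h.resolves hl hF hα hβ hσ
  have hb := fun i j => h.distance_bounds hl hF hα hβ hσ none le_rfl hw1
    (meetsWindows_univ y) (i := i) (j := j) (Finset.mem_univ i) (Finset.mem_univ j)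
  have hbt := fun (t : Fin 3) (i j : Fin n) => h.distance_bounds hl hF hα hβ hσ (some t) hw1 le_rfl
    (hs.meetsWindows t) (i := i) (j := j)
  simp only [columnSet] at hb hbt
  have hK := hl.log_ge
  unfold logConstant at hK
  have hβκ : 0 < β / separationRate α β := by positivity
  have hσσ : 0 < 8 * σ + 48 * σ ^ 2 := by positivity
  have hmono : ∀ k, 1 ≤ tuning n k → tuning n k ≤ tuning n (k + 1) := fun k hk => by
    rw [tuning_succ]; nlinarith
  have h12 := hmono 1 hδ1
  have h23 := hmono 2 (hδ1.trans h12)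
  have h34 := hmono 3 (hδ1.trans (h12.trans h23))
  simp only [Nat.reduceAdd] at h12 h23 h34
  have h4 : tuning n 4 = tuning n 3 * Real.log n := tuning_succ n 3
  have hanchor : ∀ i j, anchor (estimateDistance (dataMatrix F y σ e) Finset.univ) s i j ∈
      block s (freeBlock s i j) ∧ gap y i
        (anchor (estimateDistance (dataMatrix F y σ e) Finset.univ) s i j) ≤
          radius (separationRate α β) (tuning n 1) := by
    intro i j
    obtain ⟨p, hp, -, -, hpg⟩ := (hs.meetsWindows (freeBlock s i j)).exists_near h3w i i
    have hmin := argminOn_getD ⟨p, hp⟩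
      (estimateDistance (dataMatrix F y σ e) Finset.univ i) i
    refine ⟨hmin.1, hres.le_radius₁ _ _ ((hmin.2 p hp).trans ?_)⟩
    have hpg' : (gap y i p : ℝ) ≤ 3 * windowLength n := by exact_mod_cast hpg
    have : β * gap y i p ≤ β * (3 * windowLength n) := mul_le_mul_of_nonneg_left hpg' hβ.le
    linarith [(hb i p).2]
  refine ⟨fun i j => (hanchor i j).1, fun i j => (hanchor i j).2, fun t p hp k hk hd => ?_,
    fun t p hp k hk hg => ?_, fun t => ?_, fun t p hp i hi => h.left (t, p, i) hp hi,
    fun t p hp i hi => h.right (t, p, i) hp hi⟩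
  · have hu := (hbt t p k hp hk).2
    have r1 := radius_lt hκ (show 0 ≤ tuning n 1 by linarith)
    have r3 := radius_lt hκ (show 0 ≤ tuning n 3 by linarith)
    have r13 : 2 * tuning n 1 / separationRate α β ≤ 2 * tuning n 3 / separationRate α β := by
      gcongr; linarith
    have hsum : (radius (separationRate α β) (tuning n 1) : ℝ) +
        2 * radius (separationRate α β) (tuning n 3) ≤
        3 * (2 * tuning n 3 / separationRate α β + 1) := by linarith
    have hβd : β * (3 * (2 * tuning n 3 / separationRate α β + 1)) =
        6 * (β / separationRate α β) * tuning n 3 + 3 * β := by ring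
    have hdd : tuning n 3 * (1 / 2 + 6 * (β / separationRate α β) + 3 * β) ≤
        tuning n 3 * Real.log n := mul_le_mul_of_nonneg_left (by linarith) (by linarith)
    have : β * (3 * (2 * tuning n 3 / separationRate α β + 1)) ≤ β * gap y p k := by nlinarith
    have := le_of_mul_le_mul_left this hβ
    exact_mod_cast hsum.trans this
  · have hlow := (hbt t p k hp hk).1
    have hw0 : 0 < √(windowLength n : ℝ) := Real.sqrt_pos.2 (by exact_mod_cast hw1)
    have hg' : 2 * (tuning n 4 * √(windowLength n)) / separationRate α β ≤ gap y p k :=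
      (le_radius _ _).trans (by exact_mod_cast hg)
    have : 2 * tuning n 4 ≤ separationRate α β / √(windowLength n) * gap y p k := by
      calc 2 * tuning n 4 = separationRate α β / √(windowLength n) *
            (2 * (tuning n 4 * √(windowLength n)) / separationRate α β) := by field_simp
        _ ≤ _ := mul_le_mul_of_nonneg_left hg' (by positivity)
    linarith
  · have hr := radius_lt hκ (show 0 ≤ tuning n 4 * √(windowLength n) by
      have : 0 ≤ tuning n 4 := by linarith
      positivity)
    have : 24 * (radius (separationRate α β) (tuning n 4 * √(windowLength n)) : ℝ) + 8 ≤ n := by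
      linarith
    have h24 : 24 * radius (separationRate α β) (tuning n 4 * √(windowLength n)) + 8 ≤ n := by
      exact_mod_cast this
    have := (mem_balancedPartitions.1 hs.balanced t).1
    omega

/-- The positions are accurate along any order for which the first seriation is sound. -/
lemma GoodNoise.sabre_error_le (h : GoodNoise F y σ (tuning n 4) s e) (hl : IsLarge α β σ n)
    (hs : GoodPartition y (windowLength n) s) (hF : IsBiLipschitz α β F) (hα : 0 < α) (hβ : 0 < β)
    (hσ : 0 < σ)
    (hH : IsSound (aggregateBisections (estimateDistance (dataMatrix F y σ e) Finset.univ)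
      (tuning n 1) (tuning n 2) (tuning n 3)) y (radius (separationRate α β) (tuning n 3)))
    (i : Fin n) :
    |sabre σ (dataMatrix F y σ e) s i - ((y i : ℕ) + 1 : ℝ)| ≤
      80 * (σ / α) * √(n * Real.log n) := by
  have hres := h.resolves hl hF hα hβ hσ
  exact (h.refinedSetting hl hs hF hα hβ hσ).position_error_le hH (hres.pos.trans hres.mono) hF hα hσ
    (fun _ _ => rfl) i

lemma IsBiLipschitz.submatrix_rev (hF : IsBiLipschitz α β F) :
    IsBiLipschitz α β (F.submatrix Fin.rev Fin.rev) := by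
  have habs : ∀ i j : Fin n, |((j.rev : ℕ) : ℝ) - ((i.rev : ℕ) : ℝ)| =
      |((i : ℕ) : ℝ) - ((j : ℕ) : ℝ)| := by
    intro i j
    have hi := i.isLt
    have hj := j.isLt
    rw [Fin.val_rev, Fin.val_rev, Nat.cast_sub (by omega), Nat.cast_sub (by omega)]
    push_cast
    congr 1
    ring
  refine ⟨fun i j => hF.mem_Icc _ _, fun i j hij k => ?_, fun i j hij k hk => ?_,
    fun i j hij k hk => ?_⟩
  · have := hF.upper j.rev i.rev (Fin.rev_lt_rev.2 hij) k.rev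
    rw [habs, abs_sub_comm] at this
    exact this
  · have := hF.lower_right j.rev i.rev (Fin.rev_lt_rev.2 hij) k.rev (Fin.rev_le_rev.2 hk)
    rw [habs] at this
    exact this
  · have := hF.lower_left j.rev i.rev (Fin.rev_lt_rev.2 hij) k.rev (Fin.rev_le_rev.2 hk)
    rw [habs] at this
    exact this

/-- For a good noise and a good partition SABRE is accurate. -/
lemma GoodNoise.maxLoss_sabre_le (h : GoodNoise F y σ (tuning n 4) s e) (hl : IsLarge α β σ n)
    (hs : GoodPartition y (windowLength n) s) (hF : IsBiLipschitz α β F) (hα : 0 < α) (hβ : 0 < β)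
    (hσ : 0 < σ) :
    maxLoss (sabre σ (dataMatrix F y σ e) s) y ≤ 160 * (σ / α) * √(Real.log n / n) := by
  have hn : 1 ≤ n := by have := hl.eight_le; omega
  have hn0 : (0 : ℝ) < n := by exact_mod_cast hn
  have hloss : maxLoss (sabre σ (dataMatrix F y σ e) s) y ≤
      1 / n * (80 * (σ / α) * √(n * Real.log n)) := by
    refine maxLoss_le hn _ y ?_
    rcases (h.resolves hl hF hα hβ hσ).isSound with hH | hH
    · exact Or.inl fun i => h.sabre_error_le hl hs hF hα hβ hσ hH i
    · have hdata : dataMatrix (F.submatrix Fin.rev Fin.rev) (Seriation.reverseOrder y) σ e =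
          dataMatrix F y σ e := by
        funext i j
        simp [dataMatrix, Seriation.reverseOrder]
      have hs' : GoodPartition (Seriation.reverseOrder y) (windowLength n) s :=
        ⟨hs.balanced, fun t => (hs.meetsWindows t).reverseOrder⟩
      have herr := h.reverseOrder.sabre_error_le hl hs' hF.submatrix_rev hα hβ hσ
      rw [hdata] at herr
      exact Or.inr (herr hH)
  have hsqrt : √(n * Real.log n) = n * √(Real.log n / n) := by
    rw [show (n : ℝ) * Real.log n = n ^ 2 * (Real.log n / n) by field_simp,
      Real.sqrt_mul (by positivity), Real.sqrt_sq hn0.le]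
  rw [hsqrt] at hloss
  refine hloss.trans ?_
  have h0 : 0 ≤ (σ / α) * √(Real.log n / n) := by positivity
  have h1 : 1 / (n : ℝ) * (80 * (σ / α) * (n * √(Real.log n / n))) =
      80 * ((σ / α) * √(Real.log n / n)) := by field_simp
  rw [h1]
  nlinarith

end Large

end Seriation

theorem corollary4p1 :
    (∃ K : ℕ, ∀ n : ℕ, 1 ≤ n →
      ∀ (σ : ℝ) (A : Fin n → Fin n → ℝ) (s : Fin n → Fin 3),
        (Seriation.sabreTimed σ A s).val = Seriation.sabre σ A s ∧
          (Seriation.sabreTimed σ A s).time ≤ K * n ^ 3) ∧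
    ∀ α β σ : ℝ, 0 < α → 0 < β → 0 < σ →
      ∃ C : ℝ, ∀ n : ℕ, C ≤ n →
        ∀ (Ω : Type*) [MeasurableSpace Ω] (μ : Measure Ω) [IsProbabilityMeasure μ]
          (F : Matrix (Fin n) (Fin n) ℝ) (π : Equiv.Perm (Fin n))
          (E : Fin n → Fin n → Ω → ℝ) (S : Ω → Fin n → Fin 3),
          Seriation.IsRobinson F → Seriation.IsBiLipschitz α β F → Seriation.IsNoise μ E →
          Measurable S →
          μ.map S = uniformOn (Seriation.balancedPartitions n : Set (Fin n → Fin 3)) →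
          IndepFun S (fun ω i j => E i j ω) μ →
          1 - 1 / (n : ℝ) ^ 2 ≤
            μ.real {ω |
              Seriation.maxLoss (Seriation.sabre σ (Seriation.observation F π σ E ω) (S ω)) π ≤
                160 * (σ / α) * √(Real.log n / n)} := by
  refine ⟨⟨2000, fun n hn σ A s =>
    ⟨Seriation.sabreTimed_val σ A s, Seriation.sabreTimed_time_le hn σ A s⟩⟩,
    fun α β σ hα hβ hσ => ?_⟩
  obtain ⟨C, hC⟩ := Seriation.exists_isLarge α β σ
  refine ⟨C, fun n hn Ω _ μ _ F π E S _ hF hE hS hSμ hSE => ?_⟩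
  have hl := hC n hn
  have h8 := hl.eight_le
  have hn8 : (8 : ℝ) ≤ n := by exact_mod_cast h8
  set good := {ω | Seriation.maxLoss (Seriation.sabre σ (Seriation.observation F π σ E ω) (S ω)) π ≤
    160 * (σ / α) * √(Real.log n / n)} with hgood
  have hbad : μ goodᶜ ≤ ENNReal.ofReal (1 / (n : ℝ) ^ 2) := by
    refine (measure_mono (fun ω hω => ?_)).trans ((Seriation.measure_not_good_le (y := π) (σ := σ)
      (δ := Seriation.tuning n 4) h8 (hl.facts hα hβ hσ).2.2.1 hE hF hS hSμ hSE).trans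
        (ENNReal.ofReal_le_ofReal ?_))
    · intro hg
      exact hω (hg.2.maxLoss_sabre_le hl hg.1 hF hα hβ hσ)
    · have h1 := hl.prob
      have h2 : 3 * (n : ℝ) * (3 / 4) ^ Seriation.windowLength n ≤ 1 / (2 * (n : ℝ) ^ 2) := by
        rw [le_div_iff₀ (by positivity)]
        linarith
      have h3 : 30 / (n : ℝ) ^ 4 ≤ 1 / (2 * (n : ℝ) ^ 2) := by
        rw [div_le_div_iff₀ (by positivity) (by positivity)]
        nlinarith [mul_self_nonneg ((n : ℝ) ^ 2), pow_le_pow_left₀ (by norm_num) hn8 2]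
      calc 3 * (n : ℝ) * (3 / 4) ^ Seriation.windowLength n + 30 / (n : ℝ) ^ 4
          ≤ 1 / (2 * (n : ℝ) ^ 2) + 1 / (2 * (n : ℝ) ^ 2) := add_le_add h2 h3
        _ = 1 / (n : ℝ) ^ 2 := by ring
  have hone : 1 ≤ μ.real good + μ.real goodᶜ := by
    have := measureReal_union_le (μ := μ) good goodᶜ
    rwa [Set.union_compl_self, probReal_univ] at this
  have : μ.real goodᶜ ≤ 1 / (n : ℝ) ^ 2 :=
    ENNReal.toReal_le_of_le_ofReal (by positivity) hbad
  linarith
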